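/- Let $d\ge 1$, let $X,Y$ be compact smooth manifolds (without boundary), $f:X\to X$ a smooth map preserving a Borel probability measure $\mu$, $(G_t)_{t\in\mathbb R^d}$ a smooth $d$-parameter flow on $Y$ preserving a Borel probability measure $\nu$, and $\tau:X\to\mathbb R^d$ smooth. Put $F(x,y)=(f(x),G_{\tau(x)}y)$, $\tau_N=\sum_{n=0}^{N-1}\tau\circ f^n$, $\zeta=\mu\times\nu$, and $$\rho_{H_1,H_2}(N)=\zeta(H_1\,(H_2\circ F^N))-\zeta(H_1)\zeta(H_2).$$ For $B:Y\to\mathbb R$ and $T>0$ put $S_T^B(y)=\int_{[0,T]^d}B(G_sy)\,ds$. Let $\beta<1$, $r_1\in\mathbb N$, $r_2,r_4\in\mathbb R$ with $r_1>2d(1-\beta)$, $r_2>d(1-\beta)$, $r_4>d(1-\beta)$, and assume: (A1') $(f,\tau)$ satisfies a mixing averaged double Edgeworth expansion of order $r=r_1$: there are $k_1,k_2\in\mathbb N$, a sequence $\delta_N\to0$, a centered Gaussian density $\mathfrak g$ on $\mathbb R^d$ with positive definite covariance matrix, a constant $C$, and for $0\le p_1,p_2\le r$ real polynomials $P_{p_1,p_2}^{A_1,A_2,A_3}(u,v)$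 in $u,v\in\mathbb R^d$ (of degree bounded independently of the $A_j$) whose coefficients are trilinear forms in $A_1,A_2,A_3\in C^{k_1}(X)$ bounded in absolute value by $C\prod_j\|A_j\|_{C^{k_1}}$, with $P_{0,0}^{A_1,A_2,A_3}=\mu(A_1)\mu(A_2)\mu(A_3)$, such that for all $A_j\in C^{k_1}(X)$, all integers $1\le N_1<N_2$ and all $\phi_i\in C^{k_2}(\mathbb R^d)$ supported in boxes $J_i\subset\mathbb R^d$, writing $n=N_2-N_1$, $$\Big|\mu\big(A_1\,(A_2\circ f^{N_1})(A_3\circ f^{N_2})\,\phi_1(\tau_{N_1})\phi_2(\tau_{N_2})\big)-\iint\phi_1(s_1)\,\mathfrak g\Big(\frac{s_1}{\sqrt{N_1}}\Big)\phi_2(s_2)\,\mathfrak g\Big(\frac{s_2-s_1}{\sqrt n}\Big)N_1^{-d/2}n^{-d/2}\sum_{p_1,p_2=0}^{r}\frac{P_{p_1,p_2}^{A_1,A_2,A_3}\big(\frac{s_1}{\sqrt{N_1}},\frac{s_2-s_1}{\sqrt n}\big)}{N_1^{p_1/2}n^{p_2/2}}\,ds_1ds_2\Big|$$ $$\le\prod_{j=1}^3\|A_j\|_{C^{k_1}}\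 \prod_{i=1}^2\|\phi_i\|_{C^{k_2}}\mathrm{Vol}(J_i)\ \cdot\ \delta_{\min\{N_1,n\}}\,(\max\{N_1,n\})^{-d/2}\,(\min\{N_1,n\})^{-(d+r)/2}.$$ (A2) For each $\delta>0$, $\mu(|\tau_N|>N^{1/2+\delta})=O_\delta(N^{-r_2})$. (A3') There is $k_3$ such that for every $B\in C^{k_3}(Y)$ with $\nu(B)=0$ and every positive integer $M$ there is a constant $C$ with $\nu(|S_T^B|>T^{d\beta})\le C\,T^{-M}$ for all $T>0$. (A4) There are $k$ and $C$ such that $|\mu(A_1\,(A_2\circ f^N))-\mu(A_1)\mu(A_2)|\le C\|A_1\|_{C^{k}}\|A_2\|_{C^{k}}N^{-r_4}$ for all $A_1,A_2\in C^{k}(X)$ and $N\ge1$. Then there exists $K$ such that for every $\delta>0$ there is a constant $C_\delta$ with $$|\rho_{H_1,H_2}(N)|\le C_\delta\,\|H_1\|_{C^K}\|H_2\|_{C^K}\,N^{d(\beta-1)+\delta}\qquad\text{for all }H_1,H_2\in C^K(X\times Y),\ N\ge1.$$ -/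

import Mathlib

open MeasureTheory Filter Topology
open scoped Manifold ContDiff

noncomputable section

namespace SkewMixing

/-! ### `C^k` norms -/

section ManifoldNorm

variable {E : Type*} [NormedAddCommGroup E] [NormedSpace ℝ E]
  {H : Type*} [TopologicalSpace H]
  {M : Type*} [TopologicalSpace M] [ChartedSpace H M]

/-- A finite family of preferred charts of `M`, each with a compact piece of its domain, such
that the pieces cover `M`. -/
structure ChartCover (H : Type*) [TopologicalSpace H] (M : Type*) [TopologicalSpace M]
    [ChartedSpace H M] where
  centers : Finset M
  piece : M → Set M
  isCompact_piece : ∀ x ∈ centers, IsCompact (piece x)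
  piece_subset : ∀ x ∈ centers, piece x ⊆ (chartAt H x).source
  covers : ∀ p : M, ∃ x ∈ centers, p ∈ piece x

theorem ChartCover.nonempty (H : Type*) [TopologicalSpace H] (M : Type*) [TopologicalSpace M]
    [ChartedSpace H M] [CompactSpace M] [T2Space M] : Nonempty (ChartCover H M) := by
  have h : ∀ x : M, ∃ s ∈ 𝓝 x, s ⊆ (chartAt H x).source ∧ IsCompact s := fun x =>
    local_compact_nhds ((chartAt H x).open_source.mem_nhds (mem_chart_source H x))
  choose s hs hsub hc using h
  obtain ⟨t, ht⟩ := CompactSpace.elim_nhds_subcover s hs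
  refine ⟨⟨t, s, fun x _ => hc x, fun x _ => hsub x, fun p => ?_⟩⟩
  have hp : p ∈ ⋃ x ∈ t, s x := by rw [ht]; trivial
  simpa using hp

/-- The `C^k` norm of `A : M → ℝ` read in a chart cover: the supremum of the norms of the
derivatives of order at most `k` of the local representatives of `A`, over the pieces. -/
def ckNormOn (I : ModelWithCorners ℝ E H) (𝒰 : ChartCover H M) (k : ℕ) (A : M → ℝ) : ℝ :=
  sSup {r : ℝ | ∃ x ∈ 𝒰.centers, ∃ j ≤ k, ∃ p ∈ 𝒰.piece x,
    r = ‖iteratedFDerivWithin ℝ j (A ∘ (extChartAt I x).symm) (Set.range I) (extChartAt I x p)‖}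

/-- The `C^k` norm on a compact manifold, read in a fixed chart cover. On `C^k` functions, any
two chart covers give equivalent norms. -/
def ckNorm (I : ModelWithCorners ℝ E H) [CompactSpace M] [T2Space M] (k : ℕ) (A : M → ℝ) : ℝ :=
  ckNormOn I (Classical.choice (ChartCover.nonempty H M)) k A

end ManifoldNorm

/-- The `C^k` norm of a (compactly supported, `C^k`) function on `ℝ^d`. -/
def ckNormEuclidean {d : ℕ} (k : ℕ) (φ : EuclideanSpace ℝ (Fin d) → ℝ) : ℝ :=
  sSup {r : ℝ | ∃ j ≤ k, ∃ s, r = ‖iteratedFDeriv ℝ j φ s‖}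

/-! ### Boxes and Gaussian densities in `ℝ^d` -/

/-- The closed box `∏ [a i, b i]`. -/
def box {d : ℕ} (a b : Fin d → ℝ) : Set (EuclideanSpace ℝ (Fin d)) :=
  {s | ∀ i, a i ≤ s i ∧ s i ≤ b i}

/-- The density of the centered Gaussian law on `ℝ^d` with covariance matrix `V`. -/
def gaussianDensity {d : ℕ} (V : Matrix (Fin d) (Fin d) ℝ) (s : EuclideanSpace ℝ (Fin d)) : ℝ :=
  (Real.sqrt ((2 * Real.pi) ^ d * V.det))⁻¹ *
    Real.exp (-(1 / 2) * dotProduct s.ofLp (V⁻¹.mulVec s.ofLp))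

/-! ### Conditions on the base -/

section Base

variable {d : ℕ} {E X : Type*} [NormedAddCommGroup E] [NormedSpace ℝ E]
  [TopologicalSpace X] [ChartedSpace E X] [CompactSpace X] [T2Space X] [MeasurableSpace X]

/-- `(f, τ)` satisfies a mixing averaged double Edgeworth expansion of order `r`.
Here `birkhoffSum f τ N x = ∑ n < N, τ (f^n x)`. -/
def MixingDoubleEdgeworth (μ : Measure X) (f : X → X) (τ : X → EuclideanSpace ℝ (Fin d))
    (r : ℕ) : Prop :=
  ∃ (k₁ k₂ : ℕ) (δ : ℕ → ℝ) (V : Matrix (Fin d) (Fin d) ℝ)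
    (P : ℕ → ℕ → C^k₁⟮𝓘(ℝ, E), X; ℝ⟯ →ₗ[ℝ] C^k₁⟮𝓘(ℝ, E), X; ℝ⟯ →ₗ[ℝ]
      C^k₁⟮𝓘(ℝ, E), X; ℝ⟯ →ₗ[ℝ] MvPolynomial (Fin d ⊕ Fin d) ℝ)
    (D : ℕ) (C : ℝ),
    Tendsto δ atTop (𝓝 0) ∧ V.PosDef ∧
    (∀ A₁ A₂ A₃, P 0 0 A₁ A₂ A₃ =
      MvPolynomial.C ((∫ x, A₁ x ∂μ) * (∫ x, A₂ x ∂μ) * ∫ x, A₃ x ∂μ)) ∧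
    (∀ p₁ ≤ r, ∀ p₂ ≤ r, ∀ A₁ A₂ A₃, (P p₁ p₂ A₁ A₂ A₃).totalDegree ≤ D) ∧
    (∀ p₁ ≤ r, ∀ p₂ ≤ r, ∀ A₁ A₂ A₃, ∀ m, |MvPolynomial.coeff m (P p₁ p₂ A₁ A₂ A₃)| ≤
      C * (ckNorm 𝓘(ℝ, E) k₁ A₁ * ckNorm 𝓘(ℝ, E) k₁ A₂ * ckNorm 𝓘(ℝ, E) k₁ A₃)) ∧
    ∀ (A₁ A₂ A₃ : C^k₁⟮𝓘(ℝ, E), X; ℝ⟯) (N₁ N₂ : ℕ), 0 < N₁ → N₁ < N₂ →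
    ∀ (φ₁ φ₂ : EuclideanSpace ℝ (Fin d) → ℝ) (a₁ b₁ a₂ b₂ : Fin d → ℝ),
      ContDiff ℝ k₂ φ₁ → ContDiff ℝ k₂ φ₂ →
      Function.support φ₁ ⊆ box a₁ b₁ → Function.support φ₂ ⊆ box a₂ b₂ →
      |(∫ x, A₁ x * A₂ (f^[N₁] x) * A₃ (f^[N₂] x) *
            φ₁ (birkhoffSum f τ N₁ x) * φ₂ (birkhoffSum f τ N₂ x) ∂μ) -
        ∫ s₁, ∫ s₂,
          φ₁ s₁ * gaussianDensity V ((Real.sqrt (N₁ : ℝ))⁻¹ • s₁) *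
          (φ₂ s₂ * gaussianDensity V ((Real.sqrt ((N₂ : ℝ) - N₁))⁻¹ • (s₂ - s₁))) *
          ((N₁ : ℝ) ^ (-(d : ℝ) / 2) * ((N₂ : ℝ) - N₁) ^ (-(d : ℝ) / 2)) *
          ∑ p₁ ∈ Finset.range (r + 1), ∑ p₂ ∈ Finset.range (r + 1),
            MvPolynomial.eval
                (Sum.elim ((Real.sqrt (N₁ : ℝ))⁻¹ • s₁).ofLp
                  ((Real.sqrt ((N₂ : ℝ) - N₁))⁻¹ • (s₂ - s₁)).ofLp)
                (P p₁ p₂ A₁ A₂ A₃) /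
              ((N₁ : ℝ) ^ ((p₁ : ℝ) / 2) * ((N₂ : ℝ) - N₁) ^ ((p₂ : ℝ) / 2))|
      ≤ (ckNorm 𝓘(ℝ, E) k₁ A₁ * ckNorm 𝓘(ℝ, E) k₁ A₂ * ckNorm 𝓘(ℝ, E) k₁ A₃) *
        ((ckNormEuclidean k₂ φ₁ * volume.real (box a₁ b₁)) *
          (ckNormEuclidean k₂ φ₂ * volume.real (box a₂ b₂))) *
        (δ (min N₁ (N₂ - N₁)) *
          ((max N₁ (N₂ - N₁) : ℕ) : ℝ) ^ (-(d : ℝ) / 2) *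
          ((min N₁ (N₂ - N₁) : ℕ) : ℝ) ^ (-((d : ℝ) + r) / 2))

/-- For each `δ > 0`, `μ(|τ_N| > N^{1/2+δ}) = O_δ(N^{-r})`. -/
def ModerateDeviations (μ : Measure X) (f : X → X) (τ : X → EuclideanSpace ℝ (Fin d))
    (r : ℝ) : Prop :=
  ∀ δ > (0 : ℝ), ∃ C : ℝ, ∀ N : ℕ, 0 < N →
    μ.real {x | (N : ℝ) ^ ((1 : ℝ) / 2 + δ) < ‖birkhoffSum f τ N x‖} ≤ C * (N : ℝ) ^ (-r)

/-- `f` is mixing at rate `N^{-r}` on `C^k` functions, for some `k`. -/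
def BaseMixing (E : Type*) [NormedAddCommGroup E] [NormedSpace ℝ E] [ChartedSpace E X]
    (μ : Measure X) (f : X → X) (r : ℝ) : Prop :=
  ∃ (k : ℕ) (C : ℝ), ∀ A₁ A₂ : X → ℝ,
    ContMDiff 𝓘(ℝ, E) 𝓘(ℝ, ℝ) k A₁ → ContMDiff 𝓘(ℝ, E) 𝓘(ℝ, ℝ) k A₂ →
    ∀ N : ℕ, 0 < N →
      |(∫ x, A₁ x * A₂ (f^[N] x) ∂μ) - (∫ x, A₁ x ∂μ) * ∫ x, A₂ x ∂μ| ≤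
        C * (ckNorm 𝓘(ℝ, E) k A₁ * ckNorm 𝓘(ℝ, E) k A₂) * (N : ℝ) ^ (-r)

end Base

/-! ### Conditions on the fiber, and the skew product -/

/-- The ergodic integral of `B` over the cube `[0, T]^d`. -/
def ergodicIntegral {d : ℕ} {Y : Type*} (G : EuclideanSpace ℝ (Fin d) → Y → Y) (B : Y → ℝ)
    (T : ℝ) (y : Y) : ℝ :=
  ∫ s in box (fun _ => 0) (fun _ => T), B (G s y)

/-- For some `k`, every `C^k` function `B` of zero mean satisfies
`ν(|S_T^B| > T^{dβ}) ≤ C T^{-M}` for all `M`, where `C` does not depend on `T`. -/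
def FiberDeviations {d : ℕ} (E : Type*) [NormedAddCommGroup E] [NormedSpace ℝ E] {Y : Type*}
    [TopologicalSpace Y] [ChartedSpace E Y] [MeasurableSpace Y]
    (ν : Measure Y) (G : EuclideanSpace ℝ (Fin d) → Y → Y) (β : ℝ) : Prop :=
  ∃ k : ℕ, ∀ B : Y → ℝ, ContMDiff 𝓘(ℝ, E) 𝓘(ℝ, ℝ) k B → ∫ y, B y ∂ν = 0 →
    ∀ M : ℕ, 0 < M → ∃ C : ℝ, ∀ T : ℝ, 0 < T →
      ν.real {y | T ^ ((d : ℝ) * β) < |ergodicIntegral G B T y|} ≤ C * T ^ (-(M : ℝ))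

/-- The skew product `F(x, y) = (f x, G_{τ(x)} y)`. -/
def skewProduct {d : ℕ} {X Y : Type*} (f : X → X) (τ : X → EuclideanSpace ℝ (Fin d))
    (G : EuclideanSpace ℝ (Fin d) → Y → Y) (z : X × Y) : X × Y :=
  (f z.1, G (τ z.1) z.2)

/-- The correlation `ζ(H₁ · (H₂ ∘ F^N)) - ζ(H₁) ζ(H₂)`. -/
def correlation {Z : Type*} [MeasurableSpace Z] (ζ : Measure Z) (F : Z → Z) (H₁ H₂ : Z → ℝ)
    (N : ℕ) : ℝ :=
  (∫ z, H₁ z * H₂ (F^[N] z) ∂ζ) - (∫ z, H₁ z ∂ζ) * ∫ z, H₂ z ∂ζ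

end SkewMixing

end

/-!
The correlation `ρ_{H₁,H₂}(N)` is bilinear, so it is enough to bound it on products `u(x) v(y)` that
oscillate at a given frequency, provided that the constants grow at most polynomially with the
frequency. Indeed, with partitions of unity on `X` and `Y` and Fourier series in the charts, every
sufficiently smooth function on `X × Y` is a rapidly convergent series of products of atoms, an atom
being a plane wave in a chart times a function of the partition of unity (`exists_atom_expansion`,
`abs_correlation_le_of_hasSum`).

For products, `F^N (x, y) = (f^N x, G_{τ_N(x)} y)` gives (`correlation_prod_eq`)
`ρ(N) = ∫ u (u' ∘ f^N) (R ∘ τ_N) dμ + ν(v) ν(v') (μ(u (u' ∘ f^N)) - μ(u) μ(u'))`, where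
`R(t) = ∫ (v - ν(v)) (v' ∘ G_t) dν`. The second term is controlled by the mixing of the base. For
the first one, put `κ = d (1 - β)`.

* The correlation `R` need not tend to zero, but its averages do: by invariance of `ν`, the average
  of `R(t - s₁ + s₂)` over `s₁, s₂ ∈ [0, T]^d` is `T^{-2d}` times the scalar product of the ergodic
  integral of `v - ν(v)` with that of `v'` composed with `G_t`
  (`integral_fiberCorrelation_cubeDifference`), and `v'` may be replaced by `v' - ν(v')`. The
  deviation bounds in the fiber make the average `O(T^{-2κ})`. These bounds come with a constant
  that depends on the function in an unspecified way. The uniform boundedness principle, applied to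
  combinations of atoms with rapidly decreasing coefficients, shows that the constant is polynomial
  in the frequency (`exists_uniform_integral_sq_ergodicIntegral_le`). Moreover `R` is smooth with
  bounded derivatives (`exists_norm_iteratedFDeriv_fiberCorrelation_le`).

* By the moderate deviation bound one may insert cutoffs of `τ_{N/2}` and `τ_N` at scale
  `N^{1/2+ε}`. The double Edgeworth expansion, with the middle observable equal to one and `N₁`
  about `N/2`, replaces the first term by a double integral of `R(s₂)` against polynomials times
  Gaussian densities. The supports of the test functions have volume about `N^{d/2+dε}`, so that the
  error is `O(N^{2dε-r₁/2})`, and `r₁ > 2κ`.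

* In the double integral, `R` is integrated against a density that varies at scale `N^{1/2}`, which
  is much larger than `T = N^{1/2-ε}`. Let `K` be the averaging operator over differences of points
  of `[0, T]^d`. Each factor `1 - K` applied to the density gains `N^{-ε}`, and each `K` may be
  moved to `R`, where it gains `T^{-2κ}`. Applying `1 = K + (1 - K)` about `κ/ε` times bounds the
  integral by `N^{-κ}` up to an arbitrarily small power of `N` (`abs_integral_mul_le_of_average_le`,
  `exists_abs_edgeworthIntegral_le`).
-/

noncomputable section

namespace SkewMixing

/-! ### Derivative bounds for products and compositions -/

section Calculus

variable {E V : Type*} [NormedAddCommGroup E] [NormedSpace ℝ E]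
  [NormedAddCommGroup V] [NormedSpace ℝ V]

/-- Derivatives of `θ · (F ∘ φ)` at a point, by the Leibniz and Faà di Bruno formulas. The bound is
linear in the bound `B` for the derivatives of `F`, with a factor that depends only on `θ` and
`φ`. -/
theorem norm_iteratedFDeriv_mul_comp_le {U : Set E} (hU : IsOpen U) {T : Set V} (hT : IsOpen T)
    {θ : E → ℝ} {φ : E → V} {F : V → ℝ} {k : ℕ} (hθ : ContDiffOn ℝ k θ U)
    (hφ : ContDiffOn ℝ k φ U) (hF : ContDiffOn ℝ k F T) (hm : Set.MapsTo φ U T) {x : E}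
    (hx : x ∈ U) {A B : ℝ} (hA : 1 ≤ A) (hB : 0 ≤ B)
    (hθA : ∀ i ≤ k, ‖iteratedFDeriv ℝ i θ x‖ ≤ A)
    (hφA : ∀ i ≤ k, ‖iteratedFDeriv ℝ i φ x‖ ≤ A)
    (hFB : ∀ i ≤ k, ‖iteratedFDeriv ℝ i F (φ x)‖ ≤ B) {j : ℕ} (hj : j ≤ k) :
    ‖iteratedFDeriv ℝ j (fun z => θ z * F (φ z)) x‖ ≤
      2 ^ k * (k.factorial : ℝ) * A ^ (k + 1) * B := by
  have hA0 : 0 ≤ A := zero_le_one.trans hA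
  have hcomp : ∀ i ≤ k, ‖iteratedFDerivWithin ℝ i (F ∘ φ) U x‖ ≤
      (k.factorial : ℝ) * B * A ^ k := by
    intro i hi
    have h1 := norm_iteratedFDerivWithin_comp_le (n := i) (C := B) (D := A) hF hφ
      (by exact_mod_cast hi) hT.uniqueDiffOn hU.uniqueDiffOn hm hx
      (fun l hl => by
        rw [iteratedFDerivWithin_of_isOpen l hT (hm hx)]
        exact hFB l (hl.trans hi))
      (fun l hl1 hl => by
        rw [iteratedFDerivWithin_of_isOpen l hU hx]
        exact (hφA l (hl.trans hi)).trans (le_self_pow₀ hA (by omega)))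
    refine h1.trans ?_
    gcongr
  rw [← iteratedFDerivWithin_of_isOpen j hU hx]
  have h2 := norm_iteratedFDerivWithin_mul_le (n := j) (N := k) hθ (hF.comp hφ hm)
    hU.uniqueDiffOn hx (by exact_mod_cast hj)
  refine h2.trans ?_
  calc ∑ i ∈ Finset.range (j + 1), (j.choose i : ℝ) * ‖iteratedFDerivWithin ℝ i θ U x‖ *
        ‖iteratedFDerivWithin ℝ (j - i) (F ∘ φ) U x‖
      ≤ ∑ i ∈ Finset.range (j + 1), (j.choose i : ℝ) * A * ((k.factorial : ℝ) * B * A ^ k) := by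
        refine Finset.sum_le_sum fun i hi => ?_
        have hi' : i ≤ k := by
          have := Finset.mem_range.1 hi
          omega
        gcongr
        · rw [iteratedFDerivWithin_of_isOpen i hU hx]
          exact hθA i hi'
        · exact hcomp _ (by omega)
    _ = 2 ^ j * (A * ((k.factorial : ℝ) * B * A ^ k)) := by
        simp_rw [mul_assoc]
        rw [← Finset.sum_mul, ← Nat.cast_sum, Nat.sum_range_choose]
        push_cast; ring
    _ ≤ 2 ^ k * (A * ((k.factorial : ℝ) * B * A ^ k)) := by
        gcongr
        norm_num
    _ = _ := by ring

/-- On a compact subset of an open set, the derivatives of a `C^k` function up to order `k` are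
uniformly bounded. -/
theorem exists_forall_norm_iteratedFDeriv_le {U Q : Set E} (hU : IsOpen U) (hQ : IsCompact Q)
    (hQU : Q ⊆ U) {φ : E → V} {k : ℕ} (hφ : ContDiffOn ℝ k φ U) :
    ∃ A : ℝ, 1 ≤ A ∧ ∀ x ∈ Q, ∀ i ≤ k, ‖iteratedFDeriv ℝ i φ x‖ ≤ A := by
  have h : ∀ i ∈ Finset.range (k + 1), ∃ A : ℝ, ∀ x ∈ Q, ‖iteratedFDeriv ℝ i φ x‖ ≤ A := by
    intro i hi
    have hi' : i ≤ k := by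
      have := Finset.mem_range.1 hi
      omega
    have hc : ContinuousOn (iteratedFDeriv ℝ i φ) U := by
      refine (hφ.continuousOn_iteratedFDerivWithin (m := i) (by exact_mod_cast hi')
        hU.uniqueDiffOn).congr fun x hx => (iteratedFDerivWithin_of_isOpen i hU hx).symm
    exact hQ.exists_bound_of_continuousOn (hc.mono hQU)
  choose! A hA using h
  refine ⟨1 + ∑ i ∈ Finset.range (k + 1), |A i|, ?_, fun x hx i hi => ?_⟩
  · have : 0 ≤ ∑ i ∈ Finset.range (k + 1), |A i| := Finset.sum_nonneg fun _ _ => abs_nonneg _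
    linarith
  · have hi' : i ∈ Finset.range (k + 1) := by simpa using Nat.lt_succ_of_le hi
    have h1 := Finset.single_le_sum (f := fun i => |A i|) (fun _ _ => abs_nonneg _) hi'
    have h2 := hA i hi' x hx
    have h3 := le_abs_self (A i)
    linarith

end Calculus

/-! ### Plane waves -/

section Trig

variable {V : Type*} [NormedAddCommGroup V] [InnerProductSpace ℝ V]

/-- The plane wave `u ↦ cos (⟨ξ, u⟩ + p)` of frequency `ξ` and phase `p`. -/
def planeWave (ξ : V) (p : ℝ) (u : V) : ℝ := Real.cos (inner ℝ ξ u + p)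

theorem contDiff_planeWave (ξ : V) (p : ℝ) {n : WithTop ℕ∞} : ContDiff ℝ n (planeWave ξ p) := by
  unfold planeWave
  exact Real.contDiff_cos.comp ((contDiff_const.inner ℝ contDiff_id).add contDiff_const)

theorem abs_planeWave_le (ξ : V) (p : ℝ) (u : V) : |planeWave ξ p u| ≤ 1 :=
  Real.abs_cos_le_one _

theorem norm_iteratedFDeriv_planeWave_le (ξ : V) (p : ℝ) {i k : ℕ} (hi : i ≤ k) (u : V) :
    ‖iteratedFDeriv ℝ i (planeWave ξ p) u‖ ≤ (k.factorial : ℝ) * (1 + ‖ξ‖) ^ k := by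
  have hcos : ∀ l : ℕ, ∀ t : ℝ, ‖iteratedFDeriv ℝ l Real.cos t‖ ≤ 1 := by
    intro l t
    rw [norm_iteratedFDeriv_eq_norm_iteratedDeriv]
    exact Real.abs_iteratedDeriv_cos_le_one l t
  have hin : ContDiff ℝ i (fun u : V => inner ℝ ξ u + p) :=
    (contDiff_const.inner ℝ contDiff_id).add contDiff_const
  have h := norm_iteratedFDeriv_comp_le (n := i) (N := i) (C := 1) (D := 1 + ‖ξ‖)
    (g := Real.cos) (f := fun u : V => inner ℝ ξ u + p) Real.contDiff_cos hin le_rfl u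
    (fun l _ => hcos l _) (fun l hl1 _ => by
      have e : (fun u : V => inner ℝ ξ u + p) = fun u => innerSL ℝ ξ u + p := rfl
      have e2 : iteratedFDeriv ℝ l (fun u : V => innerSL ℝ ξ u + p) u =
          iteratedFDeriv ℝ l (fun u : V => innerSL ℝ ξ u) u := by
        have := iteratedFDeriv_add_apply (𝕜 := ℝ) (i := l) (x := u)
          (f := fun u : V => innerSL ℝ ξ u) (g := fun _ : V => p)
          (innerSL ℝ ξ).contDiff.contDiffAt contDiff_const.contDiffAt
        simp only [Pi.add_def] at this
        rw [this, iteratedFDeriv_const_of_ne (by omega)]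
        simp
      rw [e, e2]
      rcases Nat.lt_or_ge 1 l with h | h
      · obtain ⟨m, rfl⟩ : ∃ m, l = m + 2 := ⟨l - 2, by omega⟩
        have : iteratedFDeriv ℝ (m + 2) (fun u : V => innerSL ℝ ξ u) u = 0 := by
          rw [← norm_eq_zero, ← norm_iteratedFDeriv_fderiv]
          have : (fderiv ℝ fun u : V => innerSL ℝ ξ u) = fun _ => innerSL ℝ ξ := by
            ext1 u
            exact (innerSL ℝ ξ).fderiv
          rw [this, iteratedFDeriv_const_of_ne (by omega)]
          simp
        rw [this, norm_zero]
        positivity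
      · obtain rfl : l = 1 := by omega
        rw [← norm_iteratedFDeriv_fderiv, norm_iteratedFDeriv_zero]
        have : (fderiv ℝ (fun u : V => innerSL ℝ ξ u) u) = innerSL ℝ ξ := (innerSL ℝ ξ).fderiv
        rw [this, innerSL_apply_norm]
        simp)
  have hf : ((i.factorial : ℕ) : ℝ) ≤ k.factorial := by exact_mod_cast Nat.factorial_le hi
  refine h.trans ?_
  rw [mul_one]
  gcongr
  simp

end Trig

/-! ### Averaging over small translations -/

section Averaging

variable {V : Type*} [NormedAddCommGroup V]

/-- All `m`-fold finite differences of `h` with steps of norm at most `L` are bounded by `A`. -/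
def DiffBound (L : ℝ) : ℕ → ℝ → (V → ℝ) → Prop
  | 0, A, h => ∀ u, |h u| ≤ A
  | m + 1, A, h => ∀ s, ‖s‖ ≤ L → DiffBound L m A fun u => h u - h (u + s)

/-- An `m`-fold finite difference with steps of norm at most `L` gains a factor `L` from each
derivative. -/
theorem diffBound_of_norm_iteratedFDeriv_le [NormedSpace ℝ V] {L : ℝ} {m : ℕ} :
    ∀ {h : V → ℝ} {B : ℝ}, ContDiff ℝ m h → (∀ u, ‖iteratedFDeriv ℝ m h u‖ ≤ B) →
      DiffBound L m (L ^ m * B) h := by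
  induction m with
  | zero =>
    intro h B _ hB u
    simpa using hB u
  | succ m ih =>
    intro h B hh hB s hs
    have hhm : ContDiff ℝ m h := hh.of_le (by exact_mod_cast Nat.le_succ m)
    have hshift : ContDiff ℝ m fun u => h (u + s) := hhm.comp (contDiff_id.add contDiff_const)
    have hB0 : 0 ≤ B := (norm_nonneg _).trans (hB 0)
    have key := ih (h := fun u => h u - h (u + s)) (B := L * B) (hhm.sub hshift) fun u => by
      have e : iteratedFDeriv ℝ m (fun u => h u - h (u + s)) u =
          iteratedFDeriv ℝ m h u - iteratedFDeriv ℝ m h (u + s) := by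
        have := iteratedFDeriv_sub_apply (𝕜 := ℝ) (i := m) (x := u) (f := h)
          (g := fun u => h (u + s)) hhm.contDiffAt hshift.contDiffAt
        rw [iteratedFDeriv_comp_add_right] at this
        exact this
      rw [e]
      have hd : Differentiable ℝ (iteratedFDeriv ℝ m h) :=
        hh.differentiable_iteratedFDeriv (by exact_mod_cast Nat.lt_succ_self m)
      have h1 := Convex.norm_image_sub_le_of_norm_fderiv_le (𝕜 := ℝ) (s := Set.univ) (C := B)
        (f := iteratedFDeriv ℝ m h) (fun x _ => hd x)
        (fun x _ => by rw [norm_fderiv_iteratedFDeriv]; exact hB x) convex_univ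
        (Set.mem_univ (u + s)) (Set.mem_univ u)
      refine h1.trans ?_
      have : ‖u - (u + s)‖ = ‖s‖ := by rw [sub_add_cancel_left, norm_neg]
      rw [this, mul_comm]
      gcongr
    convert key using 1
    ring

variable [MeasurableSpace V]

/-- Bounds for finite differences are inherited by averages of functions. -/
theorem diffBound_integral {κ : Measure V} [IsProbabilityMeasure κ] {L : ℝ} {m : ℕ} :
    ∀ {A : ℝ} {g : V → V → ℝ}, (∀ u, Integrable (fun s => g s u) κ) →
      (∀ᵐ s ∂κ, DiffBound L m A (g s)) → DiffBound L m A fun u => ∫ s, g s u ∂κ := by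
  induction m with
  | zero =>
    intro A g hg hb u
    have := norm_integral_le_of_norm_le_const (μ := κ) (f := fun s => g s u) (C := A)
      (by filter_upwards [hb] with s hs using hs u)
    simpa using this
  | succ m ih =>
    intro A g hg hb t ht
    have := ih (A := A) (g := fun s u => g s u - g s (u + t)) (fun u => (hg u).sub (hg (u + t)))
      (by filter_upwards [hb] with s hs using hs t ht)
    convert this using 2 with u
    exact (integral_sub (hg u) (hg (u + t))).symm

end Averaging

section AveragingIntegral

variable {V : Type*} [NormedAddCommGroup V] [NormedSpace ℝ V] [FiniteDimensional ℝ V]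
  [MeasureSpace V] [BorelSpace V] [(volume : Measure V).IsAddHaarMeasure]
  {κ : Measure V} [IsProbabilityMeasure κ]

theorem integrable_of_bound_of_support {f : V → ℝ} (hf : Continuous f) {A R : ℝ}
    (hA : ∀ u, |f u| ≤ A) (hR : ∀ u, R < ‖u‖ → f u = 0) : Integrable f := by
  have : Integrable ((Metric.closedBall (0 : V) R).indicator fun _ => A) :=
    (integrable_indicator_iff measurableSet_closedBall).2
      (integrableOn_const (measure_closedBall_lt_top).ne)
  refine this.mono' hf.aestronglyMeasurable (ae_of_all _ fun u => ?_)
  by_cases hu : ‖u‖ ≤ R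
  · rw [Set.indicator_of_mem (by simpa using hu)]; exact hA u
  · rw [hR u (not_le.1 hu), norm_zero]
    exact Set.indicator_nonneg (fun _ _ => (abs_nonneg _).trans (hA 0)) _

omit [BorelSpace V] in
theorem abs_integral_le_of_bound_of_support {f : V → ℝ} {A R : ℝ}
    (hA : ∀ u, |f u| ≤ A) (hR : ∀ u, R < ‖u‖ → f u = 0) :
    |∫ u, f u| ≤ A * volume.real (Metric.closedBall (0 : V) R) := by
  rw [← setIntegral_eq_integral_of_forall_compl_eq_zero (s := Metric.closedBall (0 : V) R)
    fun u hu => hR u (by simpa using hu)]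
  exact norm_setIntegral_le_of_norm_le_const (f := f) measure_closedBall_lt_top fun u _ => hA u

/-- Averaging against `κ` is moved from one factor of an integral to the other. -/
theorem integral_mul_average_comm {ρ h : V → ℝ} (hρ : Continuous ρ) (hh : Continuous h)
    {W A R L : ℝ} (hW : ∀ u, |ρ u| ≤ W) (hA : ∀ u, |h u| ≤ A) (hR : ∀ u, R < ‖u‖ → h u = 0)
    (hL : ∀ᵐ s ∂κ, ‖s‖ ≤ L) :
    ∫ u, ρ u * ∫ s, h (u + s) ∂κ = ∫ u, (∫ s, ρ (u - s) ∂κ) * h u := by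
  have hW0 : 0 ≤ W := (abs_nonneg _).trans (hW 0)
  have hA0 : 0 ≤ A := (abs_nonneg _).trans (hA 0)
  have hball : ∀ R' : ℝ, Integrable (fun p : V × V =>
      (Metric.closedBall (0 : V) R').indicator (fun _ => W * A) p.1) (volume.prod κ) := by
    intro R'
    have : Integrable ((Metric.closedBall (0 : V) R').indicator fun _ => W * A) :=
      (integrable_indicator_iff measurableSet_closedBall).2
        (integrableOn_const (measure_closedBall_lt_top).ne)
    exact this.comp_fst κ
  have hprod : ∀ x y : V, |ρ x * h y| ≤ W * A := fun x y => by
    rw [abs_mul]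
    exact mul_le_mul (hW x) (hA y) (abs_nonneg _) hW0
  have h1 : Integrable (Function.uncurry fun u s : V => ρ u * h (u + s)) (volume.prod κ) := by
    refine (hball (R + L)).mono' (by
      apply Continuous.aestronglyMeasurable
      simp only [Function.uncurry_def]
      fun_prop) ?_
    have : ∀ᵐ p ∂((volume : Measure V).prod κ), ‖p.2‖ ≤ L :=
      Measure.quasiMeasurePreserving_snd.ae hL
    filter_upwards [this] with p hp
    by_cases hu : ‖p.1‖ ≤ R + L
    · rw [Set.indicator_of_mem (by simpa using hu)]; exact hprod _ _
    · have h0 : h (p.1 + p.2) = 0 := hR _ (by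
        have := norm_sub_norm_le p.1 (-p.2)
        rw [sub_neg_eq_add, norm_neg] at this
        linarith)
      simp only [Function.uncurry_def, h0, mul_zero, norm_zero]
      exact Set.indicator_nonneg (fun _ _ => mul_nonneg hW0 hA0) _
  have h2 : Integrable (Function.uncurry fun u s : V => ρ (u - s) * h u) (volume.prod κ) := by
    refine (hball R).mono' (by
      apply Continuous.aestronglyMeasurable
      simp only [Function.uncurry_def]
      fun_prop) (ae_of_all _ fun p => ?_)
    by_cases hu : ‖p.1‖ ≤ R
    · rw [Set.indicator_of_mem (by simpa using hu)]; exact hprod _ _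
    · simp only [Function.uncurry_def, hR _ (not_le.1 hu), mul_zero, norm_zero]
      exact Set.indicator_nonneg (fun _ _ => mul_nonneg hW0 hA0) _
  calc ∫ u, ρ u * ∫ s, h (u + s) ∂κ = ∫ u, ∫ s, ρ u * h (u + s) ∂κ := by
        simp_rw [integral_const_mul]
    _ = ∫ s, (∫ u, ρ u * h (u + s)) ∂κ := integral_integral_swap h1
    _ = ∫ s, (∫ u, ρ (u - s) * h u) ∂κ := by
        congr 1; ext s
        rw [← integral_sub_right_eq_self (fun u => ρ u * h (u + s)) s]
        simp
    _ = ∫ u, ∫ s, ρ (u - s) * h u ∂κ := (integral_integral_swap h2).symm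
    _ = _ := by simp_rw [integral_mul_const]

/-- If the averages of `ρ` against `κ` are at most `η`, then the integral of `ρ` against a
function `h` that varies slowly at the scale of `κ` is small. Writing `K` for the averaging
operator, `∫ ρ h = ∑_{i < m} ∫ (Kᵗρ) (1 - K)^i h + ∫ ρ (1 - K)^m h`, and `(1 - K)^m h` is an average
of `m`-fold finite differences of `h`. -/
theorem abs_integral_mul_le_of_average_le {ρ : V → ℝ} (hρ : Continuous ρ) {W L η : ℝ}
    (hW : ∀ u, |ρ u| ≤ W) (hL0 : 0 ≤ L) (hL : ∀ᵐ s ∂κ, ‖s‖ ≤ L)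
    (hη : ∀ u, |∫ s, ρ (u - s) ∂κ| ≤ η) {m : ℕ} :
    ∀ {h : V → ℝ} {A₀ A R : ℝ}, Continuous h → (∀ u, |h u| ≤ A₀) → DiffBound L m A h →
      (∀ u, R < ‖u‖ → h u = 0) →
      |∫ u, ρ u * h u| ≤
        ((2 ^ m - 1) * A₀ * η + W * A) * volume.real (Metric.closedBall (0 : V) (R + m * L)) := by
  have hW0 : 0 ≤ W := (abs_nonneg _).trans (hW 0)
  have hη0 : 0 ≤ η := (abs_nonneg _).trans (hη 0)
  induction m with
  | zero =>
    intro h A₀ A R _ _ hA hR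
    have := abs_integral_le_of_bound_of_support (f := fun u => ρ u * h u) (A := W * A) (R := R)
      (fun u => by
        rw [abs_mul]
        exact mul_le_mul (hW u) (hA u) (abs_nonneg _) hW0)
      (fun u hu => by simp [hR u hu])
    simpa using this
  | succ m ih =>
    intro h A₀ A R hh hA₀ hA hR
    have hA00 : 0 ≤ A₀ := (abs_nonneg _).trans (hA₀ 0)
    have hint : ∀ u, Integrable (fun s => h (u + s)) κ := fun u =>
      Integrable.of_bound (by
        apply Continuous.aestronglyMeasurable
        fun_prop) A₀ (ae_of_all _ fun s => hA₀ _)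
    set Kh : V → ℝ := fun u => ∫ s, h (u + s) ∂κ with hKh
    have hKc : Continuous Kh := continuous_of_dominated (bound := fun _ => A₀)
      (fun u => (hint u).aestronglyMeasurable) (fun u => ae_of_all _ fun s => hA₀ _)
      (integrable_const _) (ae_of_all _ fun s => by fun_prop)
    have hKb : ∀ u, |Kh u| ≤ A₀ := fun u => by
      have := norm_integral_le_of_norm_le_const (μ := κ) (f := fun s => h (u + s)) (C := A₀)
        (ae_of_all _ fun s => hA₀ _)
      simpa using this
    have hKR : ∀ u, R + L < ‖u‖ → Kh u = 0 := fun u hu => by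
      refine integral_eq_zero_of_ae ?_
      filter_upwards [hL] with s hs
      refine hR _ ?_
      have := norm_sub_norm_le u (-s)
      rw [sub_neg_eq_add, norm_neg] at this
      linarith
    have hdR : ∀ u, R + L < ‖u‖ → h u - Kh u = 0 := fun u hu => by
      rw [hKR u hu, hR u (by linarith), sub_zero]
    have hdb : ∀ u, |h u - Kh u| ≤ 2 * A₀ := fun u => by
      have := abs_sub (h u) (Kh u)
      linarith [hA₀ u, hKb u]
    have hdd : DiffBound L m A fun u => h u - Kh u := by
      have := diffBound_integral (κ := κ) (L := L) (m := m) (A := A)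
        (g := fun s u => h u - h (u + s)) (fun u => (integrable_const _).sub (hint u))
        (by filter_upwards [hL] with s hs using hA s hs)
      convert this using 2 with u
      rw [integral_sub (integrable_const _) (hint u)]
      simp [hKh]
    -- `h = K h + (1 - K) h`: the first part is treated by moving `K` to `ρ`, the second one by
    -- induction
    have h2 := ih (h := fun u => h u - Kh u) (hh.sub hKc) hdb hdd hdR
    have h1 : |∫ u, ρ u * Kh u| ≤
        A₀ * η * volume.real (Metric.closedBall (0 : V) (R + (m + 1 : ℕ) * L)) := by
      rw [integral_mul_average_comm hρ hh hW hA₀ hR hL]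
      refine (abs_integral_le_of_bound_of_support (A := η * A₀) (R := R) (fun u => ?_)
        fun u hu => by simp [hR u hu]).trans ?_
      · rw [abs_mul]
        exact mul_le_mul (hη u) (hA₀ u) (abs_nonneg _) hη0
      · rw [mul_comm η]
        gcongr
        · exact measure_closedBall_lt_top.ne
        · have : 0 ≤ ((m + 1 : ℕ) : ℝ) * L := by positivity
          linarith
    have hbR : ∀ g : V → ℝ, Continuous g → ∀ B R', (∀ u, |g u| ≤ B) → (∀ u, R' < ‖u‖ → g u = 0) →
        Integrable fun u => ρ u * g u := fun g hg B R' hgB hgR =>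
      integrable_of_bound_of_support (hρ.mul hg) (A := W * B) (R := R') (fun u => by
        rw [abs_mul]
        exact mul_le_mul (hW u) (hgB u) (abs_nonneg _) hW0) fun u hu => by simp [hgR u hu]
    have e : ∫ u, ρ u * h u = (∫ u, ρ u * Kh u) + ∫ u, ρ u * (h u - Kh u) := by
      rw [← integral_add (hbR Kh hKc _ _ hKb hKR)
        (hbR (fun u => h u - Kh u) (hh.sub hKc) _ _ hdb hdR)]
      congr 1; ext u; ring
    have e2 : R + L + m * L = R + (m + 1 : ℕ) * L := by push_cast; ring
    rw [e2] at h2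
    rw [e]
    refine (abs_add_le _ _).trans ((add_le_add h1 h2).trans (le_of_eq ?_))
    ring

end AveragingIntegral

/-! ### Boxes -/

section Box

variable {d : ℕ}

theorem box_eq_preimage (a b : Fin d → ℝ) :
    box a b = (WithLp.ofLp : EuclideanSpace ℝ (Fin d) → Fin d → ℝ) ⁻¹' Set.Icc a b := by
  ext s
  simp [box, Set.mem_Icc, Pi.le_def, forall_and]

theorem volume_box (a b : Fin d → ℝ) :
    volume (box a b) = ∏ i, ENNReal.ofReal (b i - a i) := by
  rw [box_eq_preimage, (PiLp.volume_preserving_ofLp (Fin d)).measure_preimage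
    measurableSet_Icc.nullMeasurableSet, Real.volume_Icc_pi]

theorem measurableSet_box (a b : Fin d → ℝ) : MeasurableSet (box a b) := by
  rw [box_eq_preimage]
  exact (PiLp.volume_preserving_ofLp (Fin d)).measurable measurableSet_Icc

theorem volume_box_lt_top (a b : Fin d → ℝ) : volume (box a b) < ⊤ := by
  rw [volume_box]
  exact ENNReal.prod_lt_top fun i _ => ENNReal.ofReal_lt_top

theorem volumeReal_box_const {a b : ℝ} (h : a ≤ b) :
    volume.real (box (fun _ : Fin d => a) fun _ => b) = (b - a) ^ d := by
  rw [Measure.real, volume_box]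
  simp [ENNReal.toReal_ofReal (sub_nonneg.2 h)]

theorem isCompact_box (a b : Fin d → ℝ) : IsCompact (box a b) := by
  rw [box_eq_preimage]
  exact (PiLp.homeomorph 2 (fun _ : Fin d => ℝ)).isCompact_preimage.2 isCompact_Icc

theorem norm_le_of_forall_abs_le {s : EuclideanSpace ℝ (Fin d)} {T : ℝ} (hT : 0 ≤ T)
    (h : ∀ i, |s i| ≤ T) : ‖s‖ ≤ d * T := by
  rw [EuclideanSpace.norm_eq]
  refine Real.sqrt_le_iff.2 ⟨by positivity, ?_⟩
  calc ∑ i, ‖s i‖ ^ 2 ≤ ∑ _i : Fin d, T ^ 2 := by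
        refine Finset.sum_le_sum fun i _ => ?_
        gcongr
        exact h i
    _ = d * T ^ 2 := by simp
    _ ≤ (d : ℝ) ^ 2 * T ^ 2 := by
        gcongr
        exact_mod_cast Nat.le_self_pow two_ne_zero d
    _ = _ := by ring

/-- The law of the difference of two independent uniform points of the cube `[0, T]^d`. -/
def cubeDifference (d : ℕ) (T : ℝ) : Measure (EuclideanSpace ℝ (Fin d)) :=
  Measure.map (fun p => p.1 - p.2)
    ((ProbabilityTheory.cond volume (box (fun _ => 0) fun _ => T)).prod
      (ProbabilityTheory.cond volume (box (fun _ => 0) fun _ => T)))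

theorem isProbabilityMeasure_cond_cube (d : ℕ) {T : ℝ} (hT : 0 < T) :
    IsProbabilityMeasure (ProbabilityTheory.cond
      (volume : Measure (EuclideanSpace ℝ (Fin d))) (box (fun _ => 0) fun _ => T)) := by
  refine ProbabilityTheory.cond_isProbabilityMeasure_of_finite ?_ (volume_box_lt_top _ _).ne
  rw [volume_box]
  simp [hT]

theorem isProbabilityMeasure_cubeDifference (d : ℕ) {T : ℝ} (hT : 0 < T) :
    IsProbabilityMeasure (cubeDifference d T) := by
  have := isProbabilityMeasure_cond_cube d hT
  exact Measure.isProbabilityMeasure_map (by fun_prop)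

theorem ae_cubeDifference_norm_le (d : ℕ) {T : ℝ} (hT : 0 < T) :
    ∀ᵐ s ∂(cubeDifference d T), ‖s‖ ≤ d * T := by
  have := isProbabilityMeasure_cond_cube d hT
  unfold cubeDifference
  rw [ae_map_iff (by fun_prop) (by measurability)]
  have h : ∀ᵐ s ∂(ProbabilityTheory.cond (volume : Measure (EuclideanSpace ℝ (Fin d)))
      (box (fun _ => 0) fun _ => T)), s ∈ box (fun _ : Fin d => (0 : ℝ)) fun _ => T :=
    ProbabilityTheory.ae_cond_mem (measurableSet_box _ _)
  filter_upwards [Measure.quasiMeasurePreserving_fst.ae h,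
    Measure.quasiMeasurePreserving_snd.ae h] with p h1 h2
  refine norm_le_of_forall_abs_le hT.le fun i => ?_
  have := h1 i
  have := h2 i
  rw [PiLp.sub_apply, abs_le]
  constructor <;> linarith

theorem integral_cond_cube {T : ℝ} (hT : 0 < T) (g : EuclideanSpace ℝ (Fin d) → ℝ) :
    ∫ s, g s ∂(ProbabilityTheory.cond volume (box (fun _ => 0) fun _ => T)) =
      (T ^ d)⁻¹ * ∫ s in box (fun _ => 0) (fun _ => T), g s := by
  have h : (volume : Measure (EuclideanSpace ℝ (Fin d))).real (box (fun _ => 0) fun _ => T)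
      = T ^ d := by
    simpa using volumeReal_box_const (d := d) hT.le
  rw [ProbabilityTheory.cond, integral_smul_measure, ENNReal.toReal_inv, ← h]
  rfl

end Box

/-! ### Correlations along the flow -/

section Flow

variable {d : ℕ} {Y : Type*} [TopologicalSpace Y] [CompactSpace Y] [MeasurableSpace Y]
  [BorelSpace Y] [SecondCountableTopology Y]

/-- The correlation of `b` and `b' ∘ G_t`. -/
def fiberCorrelation (ν : Measure Y) (G : EuclideanSpace ℝ (Fin d) → Y → Y) (b b' : Y → ℝ)
    (t : EuclideanSpace ℝ (Fin d)) : ℝ :=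
  ∫ y, b y * b' (G t y) ∂ν

theorem exists_abs_le_of_continuous {Z : Type*} [TopologicalSpace Z] [CompactSpace Z]
    {b : Z → ℝ} (hb : Continuous b) : ∃ M, 0 ≤ M ∧ ∀ y, |b y| ≤ M := by
  obtain ⟨M, hM⟩ := isCompact_univ.exists_bound_of_continuousOn hb.continuousOn
  exact ⟨max M 0, le_max_right _ _, fun y => (hM y trivial).trans (le_max_left _ _)⟩

theorem integrable_of_continuous {Z : Type*} [TopologicalSpace Z] [CompactSpace Z]
    [MeasurableSpace Z] [OpensMeasurableSpace Z] {m : Measure Z} [IsFiniteMeasure m]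
    {b : Z → ℝ} (hb : Continuous b) : Integrable b m := by
  obtain ⟨M, -, hM⟩ := exists_abs_le_of_continuous hb
  exact Integrable.of_bound hb.aestronglyMeasurable M (ae_of_all _ hM)

theorem abs_fiberCorrelation_le {Y : Type*} [MeasurableSpace Y] {ν : Measure Y}
    [IsProbabilityMeasure ν] {G : EuclideanSpace ℝ (Fin d) → Y → Y} {b b' : Y → ℝ} {M M' : ℝ}
    (hM : ∀ y, |b y| ≤ M) (hM' : ∀ y, |b' y| ≤ M') (t : EuclideanSpace ℝ (Fin d)) :
    |fiberCorrelation ν G b b' t| ≤ M * M' := by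
  have := norm_integral_le_of_norm_le_const (μ := ν) (f := fun y => b y * b' (G t y))
    (C := M * M') (ae_of_all _ fun y => by
      rw [Real.norm_eq_abs, abs_mul]
      exact mul_le_mul (hM _) (hM' _) (abs_nonneg _) ((abs_nonneg _).trans (hM y)))
  simpa [fiberCorrelation] using this

theorem abs_ergodicIntegral_le {Y : Type*} {G : EuclideanSpace ℝ (Fin d) → Y → Y} {b : Y → ℝ}
    {M : ℝ} (hM : ∀ y, |b y| ≤ M) {T : ℝ} (hT : 0 ≤ T) (y : Y) :
    |ergodicIntegral G b T y| ≤ M * T ^ d := by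
  have := norm_setIntegral_le_of_norm_le_const (f := fun s => b (G s y)) (C := M)
    (volume_box_lt_top (fun _ : Fin d => (0 : ℝ)) fun _ => T) fun s _ => hM _
  rwa [volumeReal_box_const hT, sub_zero] at this

variable {ν : Measure Y} [IsProbabilityMeasure ν] {G : EuclideanSpace ℝ (Fin d) → Y → Y}
  (hGc : Continuous fun p : EuclideanSpace ℝ (Fin d) × Y => G p.1 p.2)

include hGc

omit [SecondCountableTopology Y] in
theorem continuous_fiberCorrelation {b b' : Y → ℝ} (hb : Continuous b) (hb' : Continuous b') :
    Continuous (fiberCorrelation ν G b b') := by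
  obtain ⟨M, hM0, hM⟩ := exists_abs_le_of_continuous hb
  obtain ⟨M', hM0', hM'⟩ := exists_abs_le_of_continuous hb'
  refine continuous_of_dominated (bound := fun _ => M * M') (fun t => ?_)
    (fun t => ae_of_all _ fun y => ?_) (integrable_const _) (ae_of_all _ fun y => ?_)
  · exact (hb.mul (hb'.comp
      (hGc.comp (by fun_prop : Continuous fun y => (t, y))))).aestronglyMeasurable
  · rw [Real.norm_eq_abs, abs_mul]
    exact mul_le_mul (hM _) (hM' _) (abs_nonneg _) hM0
  · exact continuous_const.mul (hb'.comp (hGc.comp (continuous_id.prodMk continuous_const)))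

omit [MeasurableSpace Y] [BorelSpace Y] in
theorem continuous_ergodicIntegral {b : Y → ℝ} (hb : Continuous b) (T : ℝ) :
    Continuous (ergodicIntegral G b T) := by
  obtain ⟨M, hM0, hM⟩ := exists_abs_le_of_continuous hb
  have : IsFiniteMeasure (volume.restrict
      (box (fun _ : Fin d => (0 : ℝ)) fun _ => T)) :=
    ⟨by rw [Measure.restrict_apply_univ]; exact volume_box_lt_top _ _⟩
  refine continuous_of_dominated (bound := fun _ => M) (fun t => ?_)
    (fun t => ae_of_all _ fun y => hM _) (integrable_const _) (ae_of_all _ fun y => ?_)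
  · exact (hb.comp (hGc.comp (by fun_prop : Continuous fun s => (s, t)))).aestronglyMeasurable
  · exact hb.comp (hGc.comp (continuous_const.prodMk continuous_id))

/-- The average of the fiber correlation over differences of points of `[0, T]^d` is the
correlation of two ergodic integrals. -/
theorem integral_fiberCorrelation_cubeDifference (hG_add : ∀ s t y, G (s + t) y = G s (G t y))
    (hGν : ∀ t, MeasurePreserving (G t) ν ν) {b b' : Y → ℝ} (hb : Continuous b)
    (hb' : Continuous b') {T : ℝ} (hT : 0 < T) (u : EuclideanSpace ℝ (Fin d)) :
    ∫ s, fiberCorrelation ν G b b' (u - s) ∂(cubeDifference d T) =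
      (T ^ d)⁻¹ ^ 2 * ∫ y, ergodicIntegral G b T y * ergodicIntegral G b' T (G u y) ∂ν := by
  have := isProbabilityMeasure_cond_cube d hT
  obtain ⟨M, hM0, hM⟩ := exists_abs_le_of_continuous hb
  obtain ⟨M', hM0', hM'⟩ := exists_abs_le_of_continuous hb'
  set lam := ProbabilityTheory.cond (volume : Measure (EuclideanSpace ℝ (Fin d)))
    (box (fun _ => 0) fun _ => T) with hlam
  have hGt : ∀ {Z : Type _} [TopologicalSpace Z] {g : Z → EuclideanSpace ℝ (Fin d)} {k : Z → Y},
      Continuous g → Continuous k → Continuous fun z => G (g z) (k z) := fun hg hk =>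
    hGc.comp (hg.prodMk hk)
  have hcorr := continuous_fiberCorrelation (ν := ν) hGc hb hb'
  have hbd : ∀ t, |fiberCorrelation ν G b b' t| ≤ M * M' := abs_fiberCorrelation_le hM hM'
  -- the change of variables `y ↦ G s₁ y` preserves `ν`
  have hinv : ∀ s₁ s₂, fiberCorrelation ν G b b' (u - (s₁ - s₂)) =
      ∫ y, b (G s₁ y) * b' (G s₂ (G u y)) ∂ν := by
    intro s₁ s₂
    have hc : Continuous fun y => b y * b' (G (u - (s₁ - s₂)) y) :=
      hb.mul (hb'.comp (hGt continuous_const continuous_id))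
    have h := integral_map (hGν s₁).measurable.aemeasurable (μ := ν)
      (f := fun y => b y * b' (G (u - (s₁ - s₂)) y)) (hc.aestronglyMeasurable)
    rw [(hGν s₁).map_eq] at h
    unfold fiberCorrelation
    rw [h]
    congr 1; ext y
    rw [← hG_add, ← hG_add]
    congr 3
    abel
  calc ∫ s, fiberCorrelation ν G b b' (u - s) ∂(cubeDifference d T)
      = ∫ p, fiberCorrelation ν G b b' (u - (p.1 - p.2)) ∂(lam.prod lam) := by
        unfold cubeDifference
        have hc : Continuous fun s => fiberCorrelation ν G b b' (u - s) := by fun_prop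
        rw [integral_map (by fun_prop) hc.aestronglyMeasurable]
    _ = ∫ p, ∫ y, b (G p.1 y) * b' (G p.2 (G u y)) ∂ν ∂(lam.prod lam) := by
        simp_rw [hinv]
    _ = ∫ y, ∫ p, b (G p.1 y) * b' (G p.2 (G u y)) ∂(lam.prod lam) ∂ν := by
        refine integral_integral_swap
          (Integrable.of_bound (C := M * M') ?_ (ae_of_all _ fun z => ?_))
        · apply Continuous.aestronglyMeasurable
          exact (hb.comp (hGt (by fun_prop) (by fun_prop))).mul
            (hb'.comp (hGt (by fun_prop) (hGt continuous_const (by fun_prop))))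
        · rw [Function.uncurry_def, Real.norm_eq_abs, abs_mul]
          exact mul_le_mul (hM _) (hM' _) (abs_nonneg _) hM0
    _ = ∫ y, (T ^ d)⁻¹ ^ 2 * (ergodicIntegral G b T y * ergodicIntegral G b' T (G u y)) ∂ν := by
        congr 1; ext y
        rw [integral_prod_mul (fun s => b (G s y)) fun s => b' (G s (G u y)),
          integral_cond_cube hT, integral_cond_cube hT]
        unfold ergodicIntegral
        ring
    _ = _ := integral_const_mul _ _

/-- If the ergodic integrals of `b` and `b'` over `[0, T]^d` are at most `e` and `e'` in mean
square, then the average of the fiber correlation is at most `T^{-2d} e e'`. -/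
theorem abs_integral_fiberCorrelation_cubeDifference_le
    (hG_add : ∀ s t y, G (s + t) y = G s (G t y))
    (hGν : ∀ t, MeasurePreserving (G t) ν ν) {b b' : Y → ℝ} (hb : Continuous b)
    (hb' : Continuous b') {T e e' : ℝ} (hT : 0 < T) (he : 0 < e) (he' : 0 < e')
    (hbe : ∫ y, ergodicIntegral G b T y ^ 2 ∂ν ≤ e ^ 2)
    (hbe' : ∫ y, ergodicIntegral G b' T y ^ 2 ∂ν ≤ e' ^ 2) (u : EuclideanSpace ℝ (Fin d)) :
    |∫ s, fiberCorrelation ν G b b' (u - s) ∂(cubeDifference d T)| ≤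
      (T ^ d)⁻¹ ^ 2 * (e * e') := by
  rw [integral_fiberCorrelation_cubeDifference hGc hG_add hGν hb hb' hT, abs_mul,
    abs_of_nonneg (by positivity)]
  gcongr
  have hS := continuous_ergodicIntegral hGc hb T
  have hS' := continuous_ergodicIntegral hGc hb' T
  have hSu : Continuous fun y => ergodicIntegral G b' T (G u y) :=
    hS'.comp (hGc.comp (by fun_prop : Continuous fun y => (u, y)))
  have hinv : ∫ y, ergodicIntegral G b' T (G u y) ^ 2 ∂ν =
      ∫ y, ergodicIntegral G b' T y ^ 2 ∂ν := by
    have h := integral_map (hGν u).measurable.aemeasurable (μ := ν)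
      (f := fun y => ergodicIntegral G b' T y ^ 2) ((hS'.pow 2).aestronglyMeasurable)
    rw [(hGν u).map_eq] at h
    exact h.symm
  -- a weighted arithmetic-geometric inequality, which integrates to the Cauchy-Schwarz bound
  have hpt : ∀ y, ‖ergodicIntegral G b T y * ergodicIntegral G b' T (G u y)‖ ≤
      (e' / (2 * e)) * ergodicIntegral G b T y ^ 2 +
        (e / (2 * e')) * ergodicIntegral G b' T (G u y) ^ 2 := by
    intro y
    set p := ergodicIntegral G b T y
    set q := ergodicIntegral G b' T (G u y)
    rw [Real.norm_eq_abs, abs_mul, ← sq_abs p, ← sq_abs q]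
    have : 0 ≤ (2 * e * e')⁻¹ * (e' * |p| - e * |q|) ^ 2 := by positivity
    have e1 : (2 * e * e')⁻¹ * (e' * |p| - e * |q|) ^ 2 =
        (e' / (2 * e)) * |p| ^ 2 + (e / (2 * e')) * |q| ^ 2 - |p| * |q| := by
      field_simp; ring
    linarith
  have i1 : Integrable (fun y => (e' / (2 * e)) * ergodicIntegral G b T y ^ 2) ν :=
    integrable_of_continuous (by fun_prop)
  have i2 : Integrable (fun y => (e / (2 * e')) * ergodicIntegral G b' T (G u y) ^ 2) ν :=
    integrable_of_continuous (by fun_prop)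
  refine (norm_integral_le_of_norm_le (i1.add i2) (ae_of_all _ hpt)).trans ?_
  simp only [Pi.add_apply]
  rw [integral_add i1 i2, integral_const_mul, integral_const_mul, hinv]
  calc _ ≤ (e' / (2 * e)) * e ^ 2 + (e / (2 * e')) * e' ^ 2 := by gcongr
    _ = e * e' := by field_simp; ring

end Flow

/-! ### Gaussian densities times monomials -/

section Gaussian

variable {d : ℕ}

theorem exists_pow_mul_exp_neg_le {c : ℝ} (hc : 0 < c) (K : ℕ) :
    ∃ A : ℝ, ∀ r : ℝ, 0 ≤ r → (1 + r) ^ K * Real.exp (-(c * r ^ 2)) ≤ A := by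
  refine ⟨2 ^ K * (K.factorial : ℝ) * Real.exp c / c ^ K, fun r hr => ?_⟩
  have h1 : (1 + r) ^ K ≤ 2 ^ K * (1 + r ^ 2) ^ K := by
    rw [← mul_pow]
    gcongr
    nlinarith [sq_nonneg (r - 1)]
  have h2 := Real.pow_div_factorial_le_exp (c * (1 + r ^ 2)) (by positivity) K
  rw [div_le_iff₀ (by positivity), mul_pow] at h2
  have h3 : Real.exp (c * (1 + r ^ 2)) * Real.exp (-(c * r ^ 2)) = Real.exp c := by
    rw [← Real.exp_add]; ring_nf
  rw [le_div_iff₀ (by positivity)]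
  calc (1 + r) ^ K * Real.exp (-(c * r ^ 2)) * c ^ K
      ≤ 2 ^ K * (1 + r ^ 2) ^ K * Real.exp (-(c * r ^ 2)) * c ^ K := by gcongr
    _ = 2 ^ K * (c ^ K * (1 + r ^ 2) ^ K) * Real.exp (-(c * r ^ 2)) := by ring
    _ ≤ 2 ^ K * (Real.exp (c * (1 + r ^ 2)) * (K.factorial : ℝ)) * Real.exp (-(c * r ^ 2)) := by
        gcongr
    _ = 2 ^ K * (K.factorial : ℝ) *
        (Real.exp (c * (1 + r ^ 2)) * Real.exp (-(c * r ^ 2))) := by ring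
    _ = _ := by rw [h3]

theorem exists_mul_norm_sq_le_of_posDef {A : Matrix (Fin d) (Fin d) ℝ} (hA : A.PosDef) :
    ∃ c : ℝ, 0 < c ∧ ∀ u : EuclideanSpace ℝ (Fin d),
      c * ‖u‖ ^ 2 ≤ dotProduct u.ofLp (A.mulVec u.ofLp) := by
  have hcont : Continuous fun u : EuclideanSpace ℝ (Fin d) =>
      dotProduct u.ofLp (A.mulVec u.ofLp) := by
    simp only [dotProduct, Matrix.mulVec]
    fun_prop
  have hpos : ∀ u : EuclideanSpace ℝ (Fin d), u ≠ 0 →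
      0 < dotProduct u.ofLp (A.mulVec u.ofLp) := by
    intro u hu
    have := hA.dotProduct_mulVec_pos (x := u.ofLp) (by simpa using hu)
    simpa using this
  rcases (Metric.sphere (0 : EuclideanSpace ℝ (Fin d)) 1).eq_empty_or_nonempty with he | hne
  · refine ⟨1, one_pos, fun u => ?_⟩
    by_cases hu : u = 0
    · subst hu; simp
    · exfalso
      have : ‖u‖⁻¹ • u ∈ Metric.sphere (0 : EuclideanSpace ℝ (Fin d)) 1 := by
        simp [norm_smul, norm_ne_zero_iff.2 hu]
      rw [he] at this
      exact this
  · obtain ⟨v, hv, hmin⟩ := (isCompact_sphere _ _).exists_isMinOn hne hcont.continuousOn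
    refine ⟨_, hpos v (by rintro rfl; simp at hv), fun u => ?_⟩
    by_cases hu : u = 0
    · subst hu; simp
    · have hn : ‖u‖ ≠ 0 := norm_ne_zero_iff.2 hu
      have hm : ‖u‖⁻¹ • u ∈ Metric.sphere (0 : EuclideanSpace ℝ (Fin d)) 1 := by
        simp [norm_smul, hn]
      have h := hmin hm
      simp only [Set.mem_ofPred_eq, WithLp.ofLp_smul, Matrix.mulVec_smul, dotProduct_smul,
        smul_dotProduct, smul_eq_mul] at h
      have h2 := mul_le_mul_of_nonneg_right h (sq_nonneg ‖u‖)
      refine h2.trans (le_of_eq ?_)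
      field_simp

/-- The product of the Gaussian density and the monomial of exponent `q`. -/
def gaussianMonomial (S : Matrix (Fin d) (Fin d) ℝ) (q : Fin d → ℕ)
    (u : EuclideanSpace ℝ (Fin d)) : ℝ :=
  gaussianDensity S u * ∏ i, u i ^ q i

theorem contDiff_gaussianMonomial (S : Matrix (Fin d) (Fin d) ℝ) (q : Fin d → ℕ)
    {n : WithTop ℕ∞} : ContDiff ℝ n (gaussianMonomial S q) := by
  unfold gaussianMonomial gaussianDensity
  simp only [dotProduct, Matrix.mulVec]
  fun_prop

theorem hasTemperateGrowth_coord (i : Fin d) :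
    (fun u : EuclideanSpace ℝ (Fin d) => u i).HasTemperateGrowth :=
  (EuclideanSpace.proj i : EuclideanSpace ℝ (Fin d) →L[ℝ] ℝ).hasTemperateGrowth

theorem hasTemperateGrowth_prod_pow (q : Fin d → ℕ) (s : Finset (Fin d)) :
    (fun u : EuclideanSpace ℝ (Fin d) => ∏ i ∈ s, u i ^ q i).HasTemperateGrowth := by
  classical
  induction s using Finset.induction_on with
  | empty => simp
  | insert a s ha ih =>
    simp_rw [Finset.prod_insert ha]
    exact ((hasTemperateGrowth_coord a).pow (q a)).mul ih

theorem exists_norm_iteratedFDeriv_gaussianMonomial_le {S : Matrix (Fin d) (Fin d) ℝ}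
    (hS : S.PosDef) (q : Fin d → ℕ) (k : ℕ) :
    ∃ A : ℝ, ∀ j ≤ k, ∀ u, ‖iteratedFDeriv ℝ j (gaussianMonomial S q) u‖ ≤ A := by
  obtain ⟨c, hc, hcQ⟩ := exists_mul_norm_sq_le_of_posDef hS.inv
  set Q : EuclideanSpace ℝ (Fin d) → ℝ := fun u =>
    -(1 / 2) * dotProduct u.ofLp (S⁻¹.mulVec u.ofLp) with hQ
  set p : EuclideanSpace ℝ (Fin d) → ℝ := fun u =>
    (Real.sqrt ((2 * Real.pi) ^ d * S.det))⁻¹ * ∏ i, u i ^ q i with hp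
  have hQt : Q.HasTemperateGrowth := by
    refine (Function.HasTemperateGrowth.const (-(1 / 2) : ℝ)).mul ?_
    simp only [dotProduct, Matrix.mulVec]
    exact Function.HasTemperateGrowth.sum fun i _ => (hasTemperateGrowth_coord i).mul
      (Function.HasTemperateGrowth.sum fun j _ =>
        (Function.HasTemperateGrowth.const _).mul (hasTemperateGrowth_coord j))
  have hpt : p.HasTemperateGrowth :=
    (Function.HasTemperateGrowth.const _).mul (hasTemperateGrowth_prod_pow q Finset.univ)
  obtain ⟨k₁, C₁, hC₁, h₁⟩ := hQt.norm_iteratedFDeriv_le_uniform k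
  obtain ⟨k₂, C₂, hC₂, h₂⟩ := hpt.norm_iteratedFDeriv_le_uniform k
  have he : gaussianMonomial S q = fun u => p u * Real.exp (Q u) := by
    ext u
    simp only [gaussianMonomial, gaussianDensity, hp, hQ]
    ring
  obtain ⟨B, hB⟩ := exists_pow_mul_exp_neg_le (half_pos hc) ((k₁ + k₂) * (k + 1))
  refine ⟨2 ^ k * (k.factorial : ℝ) * (1 + C₁ + C₂) ^ (k + 1) * B, fun j hj u => ?_⟩
  rw [he]
  have h1u : 1 ≤ 1 + ‖u‖ := by simp
  have hbase : 1 ≤ (1 + ‖u‖) ^ (k₁ + k₂) := one_le_pow₀ h1u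
  have hexp : ∀ i ≤ k, ‖iteratedFDeriv ℝ i Real.exp (Q u)‖ ≤ Real.exp (Q u) := by
    intro i _
    rw [norm_iteratedFDeriv_eq_norm_iteratedDeriv, iteratedDeriv_eq_iterate, Real.iter_deriv_exp,
      Real.norm_of_nonneg (Real.exp_pos _).le]
  have key := norm_iteratedFDeriv_mul_comp_le (k := k) (θ := p) (φ := Q) (F := Real.exp)
    (A := (1 + C₁ + C₂) * (1 + ‖u‖) ^ (k₁ + k₂)) isOpen_univ isOpen_univ
    ((hpt.1.of_le (by exact_mod_cast le_top)).contDiffOn)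
    ((hQt.1.of_le (by exact_mod_cast le_top)).contDiffOn)
    Real.contDiff_exp.contDiffOn (Set.mapsTo_univ _ _) (Set.mem_univ u)
    (one_le_mul_of_one_le_of_one_le (by linarith) hbase) (Real.exp_pos _).le
    (fun i hi => (h₂ i hi u).trans (by
      gcongr
      · linarith
      · omega))
    (fun i hi => (h₁ i hi u).trans (by
      gcongr
      · linarith
      · omega)) hexp hj
  refine key.trans ?_
  have hQle : Real.exp (Q u) ≤ Real.exp (-(c / 2 * ‖u‖ ^ 2)) := by
    apply Real.exp_le_exp.2
    have := hcQ u
    simp only [hQ]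
    linarith
  rw [mul_pow, ← pow_mul]
  calc 2 ^ k * (k.factorial : ℝ) * ((1 + C₁ + C₂) ^ (k + 1) *
        (1 + ‖u‖) ^ ((k₁ + k₂) * (k + 1))) * Real.exp (Q u)
      ≤ 2 ^ k * (k.factorial : ℝ) * ((1 + C₁ + C₂) ^ (k + 1) *
        (1 + ‖u‖) ^ ((k₁ + k₂) * (k + 1))) * Real.exp (-(c / 2 * ‖u‖ ^ 2)) := by gcongr
    _ = 2 ^ k * (k.factorial : ℝ) * (1 + C₁ + C₂) ^ (k + 1) *
        ((1 + ‖u‖) ^ ((k₁ + k₂) * (k + 1)) * Real.exp (-(c / 2 * ‖u‖ ^ 2))) := by ring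
    _ ≤ _ := by
        gcongr
        exact hB _ (norm_nonneg u)

/-- A common bound, over all monomials of bounded degree, for the derivatives of Gaussian densities
times monomials. -/
theorem exists_norm_iteratedFDeriv_gaussianMonomial_le_of_finset
    {S : Matrix (Fin d) (Fin d) ℝ} (hS : S.PosDef) {ι : Type*} (s : Finset ι)
    (q : ι → Fin d → ℕ) (k : ℕ) :
    ∃ A : ℝ, 1 ≤ A ∧ ∀ a ∈ s, ∀ j ≤ k, ∀ u,
      ‖iteratedFDeriv ℝ j (gaussianMonomial S (q a)) u‖ ≤ A := by
  choose A hA using fun a => exists_norm_iteratedFDeriv_gaussianMonomial_le hS (q a) k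
  refine ⟨1 + ∑ a ∈ s, |A a|, ?_, fun a ha j hj u => (hA a j hj u).trans ?_⟩
  · have := Finset.sum_nonneg fun a (_ : a ∈ s) => abs_nonneg (A a)
    linarith
  · have := Finset.single_le_sum (f := fun a => |A a|) (fun _ _ => abs_nonneg _) ha
    have := le_abs_self (A a)
    linarith

end Gaussian

/-! ### Rescaled functions and cutoffs -/

section Scaling

variable {V : Type*} [NormedAddCommGroup V] [NormedSpace ℝ V]

theorem norm_iteratedFDeriv_comp_smul_sub_le {F : V → ℝ} {k : ℕ} (hF : ContDiff ℝ k F) {A : ℝ}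
    (hA : ∀ u, ‖iteratedFDeriv ℝ k F u‖ ≤ A) (c : ℝ) (v u : V) :
    ‖iteratedFDeriv ℝ k (fun z => F (c • (z - v))) u‖ ≤ |c| ^ k * A := by
  have h1 := iteratedFDeriv_comp_sub (𝕜 := ℝ) (f := fun z => F (c • z)) k v u
  rw [h1, iteratedFDeriv_comp_const_smul c hF, norm_smul, norm_pow, Real.norm_eq_abs]
  gcongr
  exact hA _

theorem norm_iteratedFDeriv_mul_le_of_le {F K : V → ℝ} {k : ℕ} (hF : ContDiff ℝ k F)
    (hK : ContDiff ℝ k K) {c A B : ℝ} (hc : 0 ≤ c) (hA : 0 ≤ A) {u : V}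
    (hFA : ∀ j ≤ k, ‖iteratedFDeriv ℝ j F u‖ ≤ c ^ j * A)
    (hKB : ∀ j ≤ k, ‖iteratedFDeriv ℝ j K u‖ ≤ c ^ j * B) :
    ‖iteratedFDeriv ℝ k (fun z => F z * K z) u‖ ≤ c ^ k * (2 ^ k * A * B) := by
  refine (norm_iteratedFDeriv_mul_le hF hK u le_rfl).trans ?_
  calc ∑ i ∈ Finset.range (k + 1), (k.choose i : ℝ) * ‖iteratedFDeriv ℝ i F u‖ *
        ‖iteratedFDeriv ℝ (k - i) K u‖
      ≤ ∑ i ∈ Finset.range (k + 1), (k.choose i : ℝ) * (c ^ k * (A * B)) := by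
        refine Finset.sum_le_sum fun i hi => ?_
        have hi' : i ≤ k := Nat.lt_succ_iff.1 (Finset.mem_range.1 hi)
        have h1 := mul_le_mul (hFA i hi') (hKB (k - i) (Nat.sub_le _ _)) (norm_nonneg _)
          (by positivity)
        rw [mul_assoc]
        refine mul_le_mul_of_nonneg_left (h1.trans (le_of_eq ?_)) (Nat.cast_nonneg _)
        have : c ^ k = c ^ i * c ^ (k - i) := by rw [← pow_add, Nat.add_sub_cancel' hi']
        rw [this]; ring
    _ = c ^ k * (2 ^ k * A * B) := by
        rw [← Finset.sum_mul, ← Nat.cast_sum, Nat.sum_range_choose]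
        push_cast; ring

variable [FiniteDimensional ℝ V]

/-- A smooth cutoff function: equal to `1` on the unit ball, supported in the ball of
radius `2`. -/
def cutoff (V : Type*) [NormedAddCommGroup V] [NormedSpace ℝ V] [FiniteDimensional ℝ V] :
    ContDiffBump (0 : V) :=
  ⟨1, 2, one_pos, one_lt_two⟩

/-- The cutoff function at scale `R`, as a rescaling of `cutoff` centered at the origin. -/
def scaledCutoff (R : ℝ) (s : V) : ℝ := cutoff V (R⁻¹ • (s - 0))

theorem contDiff_scaledCutoff (R : ℝ) {n : ℕ} : ContDiff ℝ n (scaledCutoff (V := V) R) :=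
  (cutoff V).contDiff.comp (by fun_prop)

theorem exists_norm_iteratedFDeriv_scaledCutoff_le (V : Type*) [NormedAddCommGroup V]
    [NormedSpace ℝ V] [FiniteDimensional ℝ V] (k : ℕ) :
    ∃ A : ℝ, 1 ≤ A ∧ ∀ R : ℝ, 0 < R → ∀ j ≤ k, ∀ u,
      ‖iteratedFDeriv ℝ j (scaledCutoff (V := V) R) u‖ ≤ R⁻¹ ^ j * A := by
  have hb : ∀ j, ∃ A : ℝ, ∀ u, ‖iteratedFDeriv ℝ j (cutoff V) u‖ ≤ A := fun j => by
    have hc : Continuous (iteratedFDeriv ℝ j (cutoff V)) :=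
      (cutoff V).contDiff.continuous_iteratedFDeriv (n := ∞) (by exact_mod_cast le_top)
    have hs : HasCompactSupport (iteratedFDeriv ℝ j (cutoff V)) :=
      (cutoff V).hasCompactSupport.iteratedFDeriv j
    exact hs.exists_bound_of_continuous hc
  choose A hA using hb
  refine ⟨1 + ∑ j ∈ Finset.range (k + 1), |A j|, ?_, fun R hR j hj u => ?_⟩
  · have := Finset.sum_nonneg fun a (_ : a ∈ Finset.range (k + 1)) => abs_nonneg (A a)
    linarith
  · have h := norm_iteratedFDeriv_comp_smul_sub_le (F := cutoff V) (k := j)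
      (cutoff V).contDiff (A := 1 + ∑ j ∈ Finset.range (k + 1), |A j|) (fun u => (hA j u).trans (by
        have := Finset.single_le_sum (f := fun a => |A a|) (fun _ _ => abs_nonneg _)
          (Finset.mem_range.2 (Nat.lt_succ_of_le hj))
        have := le_abs_self (A j)
        linarith)) R⁻¹ 0 u
    rwa [abs_of_pos (inv_pos.2 hR)] at h

theorem scaledCutoff_eq_one {R : ℝ} (hR : 0 < R) {s : V} (hs : ‖s‖ ≤ R) : scaledCutoff R s = 1 := by
  refine (cutoff V).one_of_mem_closedBall ?_
  rw [mem_closedBall_zero_iff, sub_zero, norm_smul, norm_inv, Real.norm_of_nonneg hR.le]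
  exact (inv_mul_le_one₀ hR).2 hs

theorem scaledCutoff_eq_zero {R : ℝ} (hR : 0 < R) {s : V} (hs : 2 * R < ‖s‖) :
    scaledCutoff R s = 0 := by
  refine (cutoff V).zero_of_le_dist ?_
  rw [dist_zero_right, sub_zero, norm_smul, norm_inv, Real.norm_of_nonneg hR.le]
  change 2 ≤ _
  rw [inv_mul_eq_div, le_div_iff₀ hR]
  exact hs.le

theorem scaledCutoff_nonneg (R : ℝ) (s : V) : 0 ≤ scaledCutoff R s := (cutoff V).nonneg

theorem scaledCutoff_le_one (R : ℝ) (s : V) : scaledCutoff R s ≤ 1 := (cutoff V).le_one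

theorem abs_scaledCutoff_le_one (R : ℝ) (s : V) : |scaledCutoff R s| ≤ 1 := by
  rw [abs_of_nonneg (scaledCutoff_nonneg R s)]
  exact scaledCutoff_le_one R s

end Scaling

/-! ### The main term of the Edgeworth expansion -/

section MainTerm

variable {d : ℕ}

/-- `ρ` is continuous and bounded by `W`, and its averages over differences of points of a cube of
side `T` are bounded by `W T^{-2κ}`. -/
structure AverageDecay (κ W : ℝ) (ρ : EuclideanSpace ℝ (Fin d) → ℝ) : Prop where
  continuous : Continuous ρ
  abs_le : ∀ u, |ρ u| ≤ W
  average_le : ∀ T : ℝ, 1 ≤ T → ∀ u,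
    |∫ s, ρ (u - s) ∂(cubeDifference d T)| ≤ W * T ^ (-2 * κ)

theorem rpow_neg_half_le {N x : ℝ} (hN : 1 ≤ N) (hx : N / 3 ≤ x) :
    (Real.sqrt x)⁻¹ ≤ 2 * N ^ (-(1 / 2) : ℝ) := by
  have hN0 : 0 < N := by linarith
  have h1 : Real.sqrt N ≤ 2 * Real.sqrt x := by
    rw [← Real.sqrt_sq (show (0 : ℝ) ≤ 2 by norm_num), ← Real.sqrt_mul (by norm_num)]
    apply Real.sqrt_le_sqrt
    linarith
  have hs : 0 < Real.sqrt N := Real.sqrt_pos.2 hN0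
  rw [Real.rpow_neg hN0.le, ← Real.sqrt_eq_rpow, inv_le_iff_one_le_mul₀ (by linarith),
    ← div_eq_mul_inv, div_mul_eq_mul_div, le_div_iff₀ hs]
  linarith

/-- The integral of `ρ` against a Gaussian density at scale `√N`, times a monomial and a cutoff at
scale `N^{1/2+ε}`. It is smaller than the volume of the support of the cutoff by a factor
`N^{-(1-2ε)κ}`, uniformly in the center `v` of the Gaussian. -/
theorem exists_abs_integral_mul_cutoff_gaussian_le {S : Matrix (Fin d) (Fin d) ℝ} (hS : S.PosDef)
    {ι : Type*} (s : Finset ι) (q : ι → Fin d → ℕ) {κ ε : ℝ} (hκ : 0 < κ) (hε : 0 < ε)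
    (hε' : ε ≤ 1 / 2) :
    ∃ C : ℝ, 0 ≤ C ∧ ∀ N : ℝ, 1 ≤ N → ∀ x : ℝ, N / 3 ≤ x → x ≤ N → ∀ ρ W, AverageDecay κ W ρ →
      ∀ a ∈ s, ∀ v : EuclideanSpace ℝ (Fin d),
      |∫ u, ρ u * (scaledCutoff (N ^ (1 / 2 + ε)) u *
        gaussianMonomial S (q a) ((Real.sqrt x)⁻¹ • (u - v)))| ≤
        C * W * N ^ ((1 / 2 + ε) * d - (1 - 2 * ε) * κ) := by
  -- With `T = N^{1/2-ε}` the averages of `ρ` are `O(N^{-(1-2ε)κ})`, and each finite difference of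
  -- the density with steps of size `T` gains `N^{-ε}`, so that `m ≥ κ / ε` differences suffice.
  set m : ℕ := ⌈κ / ε⌉₊ with hm
  obtain ⟨A, hA1, hA⟩ := exists_norm_iteratedFDeriv_gaussianMonomial_le_of_finset hS s q m
  obtain ⟨B, hB1, hB⟩ := exists_norm_iteratedFDeriv_scaledCutoff_le (EuclideanSpace ℝ (Fin d)) m
  set v₁ := (volume : Measure (EuclideanSpace ℝ (Fin d))).real (Metric.ball 0 1) with hv₁
  have hv₁0 : 0 ≤ v₁ := measureReal_nonneg
  refine ⟨(2 ^ m * A + (2 * d) ^ m * (2 ^ m * B * A)) * ((2 + m * d) ^ d * v₁), by positivity, ?_⟩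
  intro N hN x hx hxN ρ W hρ a ha v
  have hN0 : 0 < N := by linarith
  have hW : 0 ≤ W := (abs_nonneg _).trans (hρ.abs_le 0)
  have hx0 : 0 < x := by linarith
  set R : ℝ := N ^ (1 / 2 + ε) with hR
  have hR0 : 0 < R := Real.rpow_pos_of_pos hN0 _
  set T : ℝ := N ^ (1 / 2 - ε) with hT
  have hT1 : 1 ≤ T := Real.one_le_rpow hN (by linarith)
  have hT0 : 0 < T := by linarith
  have hTR : T ≤ R := Real.rpow_le_rpow_of_exponent_le hN (by linarith)
  set c : ℝ := (Real.sqrt x)⁻¹ with hc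
  have hc0 : 0 ≤ c := by positivity
  have hcN : c ≤ 2 * N ^ (-(1 / 2) : ℝ) := rpow_neg_half_le hN hx
  have hRc : R⁻¹ ≤ c := by
    rw [hc]
    apply inv_anti₀ (Real.sqrt_pos.2 hx0)
    calc Real.sqrt x ≤ Real.sqrt N := Real.sqrt_le_sqrt hxN
      _ = N ^ (1 / 2 : ℝ) := Real.sqrt_eq_rpow N
      _ ≤ R := Real.rpow_le_rpow_of_exponent_le hN (by linarith)
  set g : EuclideanSpace ℝ (Fin d) → ℝ := fun u => gaussianMonomial S (q a) (c • (u - v)) with hg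
  have hgc : ∀ {n : ℕ}, ContDiff ℝ n g := (contDiff_gaussianMonomial S (q a)).comp (by fun_prop)
  set h : EuclideanSpace ℝ (Fin d) → ℝ := fun u => scaledCutoff R u * g u with hh
  have hhc : ∀ {n : ℕ}, ContDiff ℝ n h := (contDiff_scaledCutoff R).mul hgc
  have hgA : ∀ j ≤ m, ∀ u, ‖iteratedFDeriv ℝ j g u‖ ≤ c ^ j * A := by
    intro j hj u
    have := norm_iteratedFDeriv_comp_smul_sub_le (F := gaussianMonomial S (q a)) (k := j)
      (contDiff_gaussianMonomial S (q a)) (hA a ha j hj) c v u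
    rwa [abs_of_nonneg hc0] at this
  have hhA : ∀ u, |h u| ≤ A := by
    intro u
    have h1 : |g u| ≤ A := by simpa using hgA 0 (Nat.zero_le _) u
    rw [hh, abs_mul, ← one_mul A]
    exact mul_le_mul (abs_scaledCutoff_le_one R u) h1 (abs_nonneg _) zero_le_one
  have hhD : ∀ u, ‖iteratedFDeriv ℝ m h u‖ ≤ c ^ m * (2 ^ m * B * A) := by
    intro u
    refine norm_iteratedFDeriv_mul_le_of_le (contDiff_scaledCutoff R) hgc hc0 (by linarith)
      (fun j hj => (hB R hR0 j hj u).trans ?_) (fun j hj => hgA j hj u)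
    gcongr
  have := isProbabilityMeasure_cubeDifference d hT0
  have key := abs_integral_mul_le_of_average_le (κ := cubeDifference d T) hρ.continuous hρ.abs_le
    (L := d * T) (by positivity) (ae_cubeDifference_norm_le d hT0) (hρ.average_le T hT1)
    (m := m) (h := h) (R := 2 * R) (hhc (n := 0)).continuous hhA
    (diffBound_of_norm_iteratedFDeriv_le hhc hhD)
    (fun u hu => by simp [hh, scaledCutoff_eq_zero hR0 hu])
  refine key.trans ?_
  have e1 : T ^ (-2 * κ) = N ^ (-((1 - 2 * ε) * κ)) := by
    rw [hT, ← Real.rpow_mul hN0.le]; congr 1; ring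
  have e2 : ((d : ℝ) * T) ^ m * (c ^ m * (2 ^ m * B * A)) ≤
      (2 * d) ^ m * (2 ^ m * B * A) * N ^ (-((1 - 2 * ε) * κ)) := by
    have h1 : (d : ℝ) * T * c ≤ 2 * d * N ^ (-ε) := by
      calc (d : ℝ) * T * c ≤ d * T * (2 * N ^ (-(1 / 2) : ℝ)) := by gcongr
        _ = 2 * d * (T * N ^ (-(1 / 2) : ℝ)) := by ring
        _ = _ := by rw [hT, ← Real.rpow_add hN0]; congr 2; ring
    have h2 : (N ^ (-ε)) ^ m ≤ N ^ (-((1 - 2 * ε) * κ)) := by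
      rw [← Real.rpow_natCast, ← Real.rpow_mul hN0.le]
      apply Real.rpow_le_rpow_of_exponent_le hN
      have h3 : κ / ε ≤ m := Nat.le_ceil _
      rw [div_le_iff₀ hε] at h3
      nlinarith
    calc ((d : ℝ) * T) ^ m * (c ^ m * (2 ^ m * B * A))
        = (d * T * c) ^ m * (2 ^ m * B * A) := by rw [mul_pow (_ * _) c]; ring
      _ ≤ (2 * d * N ^ (-ε)) ^ m * (2 ^ m * B * A) := by gcongr
      _ = (2 * d) ^ m * (2 ^ m * B * A) * (N ^ (-ε)) ^ m := by rw [mul_pow]; ring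
      _ ≤ _ := by gcongr
  have e3 : (volume : Measure (EuclideanSpace ℝ (Fin d))).real
      (Metric.closedBall 0 (2 * R + m * (d * T))) ≤
      (2 + m * d) ^ d * v₁ * N ^ ((1 / 2 + ε) * d) := by
    rw [Measure.addHaar_real_closedBall _ _ (by positivity), finrank_euclideanSpace_fin]
    have : 2 * R + m * (d * T) ≤ (2 + m * d) * R := by
      have : (m : ℝ) * (d * T) ≤ m * (d * R) := by gcongr
      linarith
    calc (2 * R + m * (d * T)) ^ d * v₁ ≤ ((2 + m * d) * R) ^ d * v₁ := by gcongr
      _ = (2 + m * d) ^ d * v₁ * R ^ d := by rw [mul_pow]; ring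
      _ = _ := by rw [hR, ← Real.rpow_natCast (N ^ _), ← Real.rpow_mul hN0.le]
  have hp : 0 ≤ N ^ (-((1 - 2 * ε) * κ)) := (Real.rpow_pos_of_pos hN0 _).le
  rw [e1]
  calc _ ≤ (2 ^ m * A * (W * N ^ (-((1 - 2 * ε) * κ))) +
        W * ((2 * d) ^ m * (2 ^ m * B * A) * N ^ (-((1 - 2 * ε) * κ)))) *
        ((2 + m * d) ^ d * v₁ * N ^ ((1 / 2 + ε) * d)) := by
        gcongr
        · linarith
    _ = (2 ^ m * A + (2 * d) ^ m * (2 ^ m * B * A)) * ((2 + m * d) ^ d * v₁) * W *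
        (N ^ ((1 / 2 + ε) * d) * N ^ (-((1 - 2 * ε) * κ))) := by ring
    _ = _ := by rw [← Real.rpow_add hN0]; rfl

theorem eval_eq_sum_of_totalDegree_le {D : ℕ} {P : MvPolynomial (Fin d ⊕ Fin d) ℝ}
    (hP : P.totalDegree ≤ D) (u w : Fin d → ℝ) :
    MvPolynomial.eval (Sum.elim u w) P =
      ∑ a ∈ (Finsupp.finite_of_degree_le (σ := Fin d ⊕ Fin d) D).toFinset,
        P.coeff a * ((∏ i, u i ^ a (Sum.inl i)) * ∏ i, w i ^ a (Sum.inr i)) := by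
  rw [MvPolynomial.eval_eq']
  refine (Finset.sum_subset (fun a ha => ?_) fun a _ ha => ?_).trans
    (Finset.sum_congr rfl fun a _ => ?_)
  · simp only [Set.Finite.mem_toFinset, Set.mem_ofPred_eq]
    exact (MvPolynomial.le_totalDegree ha).trans hP
  · rw [MvPolynomial.notMem_support_iff.1 ha, zero_mul]
  · rw [Fintype.prod_sum_type]
    rfl

/-- The main term of the Edgeworth expansion is small if `ρ` has small averages. For each monomial
of the expansion, the integral in `s₂` is bounded by `exists_abs_integral_mul_cutoff_gaussian_le`,
and the integral in `s₁` by the volume of the support of the cutoff. Each of the two integrals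
loses a factor `N^{dε}` against the normalization `x₁^{-d/2} x₂^{-d/2}`. -/
theorem exists_abs_edgeworthIntegral_le {S : Matrix (Fin d) (Fin d) ℝ} (hS : S.PosDef)
    (D r : ℕ) {κ ε : ℝ} (hκ : 0 < κ) (hε : 0 < ε) (hε' : ε ≤ 1 / 2) :
    ∃ C : ℝ, 0 ≤ C ∧ ∀ N : ℝ, 1 ≤ N → ∀ x₁ x₂ : ℝ, N / 3 ≤ x₁ → N / 3 ≤ x₂ → x₂ ≤ N →
      ∀ ρ W, AverageDecay κ W ρ →
      ∀ (P : ℕ → ℕ → MvPolynomial (Fin d ⊕ Fin d) ℝ) (B : ℝ), 0 ≤ B →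
      (∀ p₁ ≤ r, ∀ p₂ ≤ r, (P p₁ p₂).totalDegree ≤ D) →
      (∀ p₁ ≤ r, ∀ p₂ ≤ r, ∀ m, |MvPolynomial.coeff m (P p₁ p₂)| ≤ B) →
      |∫ s₁, ∫ s₂,
          scaledCutoff (N ^ (1 / 2 + ε)) s₁ * gaussianDensity S ((Real.sqrt x₁)⁻¹ • s₁) *
          ((scaledCutoff (N ^ (1 / 2 + ε)) s₂ * ρ s₂) *
            gaussianDensity S ((Real.sqrt x₂)⁻¹ • (s₂ - s₁))) *
          (x₁ ^ (-(d : ℝ) / 2) * x₂ ^ (-(d : ℝ) / 2)) *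
          ∑ p₁ ∈ Finset.range (r + 1), ∑ p₂ ∈ Finset.range (r + 1),
            MvPolynomial.eval
                (Sum.elim ((Real.sqrt x₁)⁻¹ • s₁).ofLp ((Real.sqrt x₂)⁻¹ • (s₂ - s₁)).ofLp)
                (P p₁ p₂) / (x₁ ^ ((p₁ : ℝ) / 2) * x₂ ^ ((p₂ : ℝ) / 2))| ≤
        C * B * W * N ^ (2 * d * ε - (1 - 2 * ε) * κ) := by
  set M := (Finsupp.finite_of_degree_le (σ := Fin d ⊕ Fin d) D).toFinset with hM
  obtain ⟨A, hA1, hA⟩ := exists_norm_iteratedFDeriv_gaussianMonomial_le_of_finset hS M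
    (fun a i => a (Sum.inl i)) 0
  obtain ⟨C₀, hC₀, hmain⟩ := exists_abs_integral_mul_cutoff_gaussian_le hS M
    (fun a i => a (Sum.inr i)) hκ hε hε'
  set v₁ := (volume : Measure (EuclideanSpace ℝ (Fin d))).real (Metric.ball 0 1) with hv₁
  have hv₁0 : 0 ≤ v₁ := measureReal_nonneg
  set Ix := (Finset.range (r + 1) ×ˢ Finset.range (r + 1)) ×ˢ M with hIx
  refine ⟨Ix.card * (3 ^ ((d : ℝ) / 2) * 3 ^ ((d : ℝ) / 2) * 3 ^ r * A * C₀) * (2 ^ d * v₁),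
    by positivity, ?_⟩
  intro N hN x₁ x₂ hx₁ hx₂ hx₂N ρ W hρ P B hB hdeg hcoeff
  have hN0 : 0 < N := by linarith
  have hW : 0 ≤ W := (abs_nonneg _).trans (hρ.abs_le 0)
  have hx₁0 : 0 < x₁ := by linarith
  have hx₂0 : 0 < x₂ := by linarith
  set R : ℝ := N ^ (1 / 2 + ε) with hR
  have hR0 : 0 < R := Real.rpow_pos_of_pos hN0 _
  set pref := x₁ ^ (-(d : ℝ) / 2) * x₂ ^ (-(d : ℝ) / 2) with hpref
  -- the coefficient in front of each inner integral
  set K : EuclideanSpace ℝ (Fin d) → (ℕ × ℕ) × (Fin d ⊕ Fin d →₀ ℕ) → ℝ := fun s₁ z =>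
    scaledCutoff R s₁ * gaussianMonomial S (fun i => z.2 (Sum.inl i)) ((Real.sqrt x₁)⁻¹ • s₁) *
      pref * (P z.1.1 z.1.2).coeff z.2 / (x₁ ^ ((z.1.1 : ℝ) / 2) * x₂ ^ ((z.1.2 : ℝ) / 2)) with hK
  set I : EuclideanSpace ℝ (Fin d) → (ℕ × ℕ) × (Fin d ⊕ Fin d →₀ ℕ) →
      EuclideanSpace ℝ (Fin d) → ℝ := fun s₁ z s₂ =>
    ρ s₂ * (scaledCutoff R s₂ * gaussianMonomial S (fun i => z.2 (Sum.inr i))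
      ((Real.sqrt x₂)⁻¹ • (s₂ - s₁))) with hI
  have hinner : ∀ s₁, (∫ s₂, scaledCutoff R s₁ * gaussianDensity S ((Real.sqrt x₁)⁻¹ • s₁) *
          ((scaledCutoff R s₂ * ρ s₂) *
            gaussianDensity S ((Real.sqrt x₂)⁻¹ • (s₂ - s₁))) * pref *
          ∑ p₁ ∈ Finset.range (r + 1), ∑ p₂ ∈ Finset.range (r + 1),
            MvPolynomial.eval
                (Sum.elim ((Real.sqrt x₁)⁻¹ • s₁).ofLp ((Real.sqrt x₂)⁻¹ • (s₂ - s₁)).ofLp)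
                (P p₁ p₂) / (x₁ ^ ((p₁ : ℝ) / 2) * x₂ ^ ((p₂ : ℝ) / 2))) =
      ∑ z ∈ Ix, K s₁ z * ∫ s₂, I s₁ z s₂ := by
    intro s₁
    simp_rw [← integral_const_mul]
    rw [← integral_finsetSum]
    · congr 1; ext s₂
      rw [hIx, Finset.sum_product, Finset.sum_product, Finset.mul_sum]
      refine Finset.sum_congr rfl fun p₁ hp₁ => ?_
      rw [Finset.mul_sum]
      refine Finset.sum_congr rfl fun p₂ hp₂ => ?_
      rw [eval_eq_sum_of_totalDegree_le
        (hdeg p₁ (Nat.lt_succ_iff.1 (Finset.mem_range.1 hp₁)) p₂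
          (Nat.lt_succ_iff.1 (Finset.mem_range.1 hp₂))), Finset.sum_div, Finset.mul_sum]
      refine Finset.sum_congr rfl fun a _ => ?_
      simp only [hK, hI, gaussianMonomial]
      ring
    · intro z _
      refine Integrable.const_mul ?_ _
      have hcont : Continuous fun s₂ => scaledCutoff R s₂ *
          gaussianMonomial S (fun i => z.2 (Sum.inr i)) ((Real.sqrt x₂)⁻¹ • (s₂ - s₁)) :=
        (contDiff_scaledCutoff R (n := 0)).continuous.mul
          ((contDiff_gaussianMonomial S _ (n := 0)).continuous.comp (by fun_prop))
      refine Continuous.integrable_of_hasCompactSupport (hρ.continuous.mul hcont) ?_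
      refine HasCompactSupport.of_support_subset_isCompact
        (isCompact_closedBall (0 : EuclideanSpace ℝ (Fin d)) (2 * R)) fun s₂ hs => ?_
      by_contra hcon
      refine hs ?_
      simp only [mem_closedBall_zero_iff, not_le] at hcon
      change ρ s₂ * (scaledCutoff R s₂ * _) = 0
      rw [scaledCutoff_eq_zero hR0 hcon, zero_mul, mul_zero]
  have hpow : ∀ x : ℝ, N / 3 ≤ x → x ^ (-(d : ℝ) / 2) ≤ 3 ^ ((d : ℝ) / 2) * N ^ (-(d : ℝ) / 2) := by
    intro x hx
    have h1 : x ^ (-(d : ℝ) / 2) ≤ (N / 3) ^ (-(d : ℝ) / 2) :=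
      Real.rpow_le_rpow_of_nonpos (by linarith) hx (by
        have : (0 : ℝ) ≤ d := Nat.cast_nonneg d
        linarith)
    refine h1.trans (le_of_eq ?_)
    rw [Real.div_rpow hN0.le (by norm_num), div_eq_mul_inv, ← Real.rpow_neg (by norm_num), mul_comm]
    congr 2; ring
  have hpow2 : ∀ x : ℝ, N / 3 ≤ x → ∀ p : ℕ, p ≤ r →
      (x ^ ((p : ℝ) / 2))⁻¹ ≤ 3 ^ ((r : ℝ) / 2) := by
    intro x hx p hp
    have hx0 : 0 < x := by linarith
    rw [← Real.rpow_neg hx0.le]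
    have h1 : x ^ (-((p : ℝ) / 2)) ≤ (1 / 3) ^ (-((p : ℝ) / 2)) :=
      Real.rpow_le_rpow_of_nonpos (by norm_num) (by linarith) (by
        have : (0 : ℝ) ≤ p := Nat.cast_nonneg p
        linarith)
    refine h1.trans ?_
    rw [one_div, Real.inv_rpow (by norm_num), Real.rpow_neg (by norm_num), inv_inv]
    apply Real.rpow_le_rpow_of_exponent_le (by norm_num)
    have : (p : ℝ) ≤ r := by exact_mod_cast hp
    linarith
  have hprefle : pref ≤ 3 ^ ((d : ℝ) / 2) * 3 ^ ((d : ℝ) / 2) * N ^ (-(d : ℝ)) := by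
    calc pref ≤ (3 ^ ((d : ℝ) / 2) * N ^ (-(d : ℝ) / 2)) *
          (3 ^ ((d : ℝ) / 2) * N ^ (-(d : ℝ) / 2)) := by
          rw [hpref]
          gcongr
          · exact hpow x₁ hx₁
          · exact hpow x₂ hx₂
      _ = 3 ^ ((d : ℝ) / 2) * 3 ^ ((d : ℝ) / 2) * (N ^ (-(d : ℝ) / 2) * N ^ (-(d : ℝ) / 2)) := by
          ring
      _ = _ := by rw [← Real.rpow_add hN0]; congr 2; ring
  have hKle : ∀ s₁, ∀ z ∈ Ix, |K s₁ z| ≤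
      A * (3 ^ ((d : ℝ) / 2) * 3 ^ ((d : ℝ) / 2) * N ^ (-(d : ℝ))) * B * 3 ^ r := by
    intro s₁ z hz
    obtain ⟨hz1, hz2⟩ := Finset.mem_product.1 hz
    obtain ⟨hp1, hp2⟩ := Finset.mem_product.1 hz1
    have hp1' : z.1.1 ≤ r := Nat.lt_succ_iff.1 (Finset.mem_range.1 hp1)
    have hp2' : z.1.2 ≤ r := Nat.lt_succ_iff.1 (Finset.mem_range.1 hp2)
    have hpref0 : 0 ≤ pref := by positivity
    have hd1 : (x₁ ^ ((z.1.1 : ℝ) / 2) * x₂ ^ ((z.1.2 : ℝ) / 2))⁻¹ ≤ 3 ^ r := by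
      rw [mul_inv]
      calc _ ≤ (3 : ℝ) ^ ((r : ℝ) / 2) * 3 ^ ((r : ℝ) / 2) := by
            gcongr
            · exact hpow2 x₁ hx₁ _ hp1'
            · exact hpow2 x₂ hx₂ _ hp2'
        _ = 3 ^ r := by
            rw [← Real.rpow_add (by norm_num), ← Real.rpow_natCast]; congr 1; ring
    have hg : |gaussianMonomial S (fun i => z.2 (Sum.inl i)) ((Real.sqrt x₁)⁻¹ • s₁)| ≤ A := by
      simpa using hA z.2 hz2 0 le_rfl ((Real.sqrt x₁)⁻¹ • s₁)
    have hcut := abs_scaledCutoff_le_one R s₁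
    have hcf := hcoeff z.1.1 hp1' z.1.2 hp2' z.2
    simp only [hK]
    rw [div_eq_mul_inv, abs_mul, abs_mul, abs_mul, abs_mul, abs_of_nonneg hpref0,
      abs_of_nonneg (show 0 ≤ (x₁ ^ ((z.1.1 : ℝ) / 2) * x₂ ^ ((z.1.2 : ℝ) / 2))⁻¹ by positivity)]
    calc _ ≤ 1 * A * (3 ^ ((d : ℝ) / 2) * 3 ^ ((d : ℝ) / 2) * N ^ (-(d : ℝ))) * B * 3 ^ r := by
          gcongr
      _ = _ := by ring
  have hbound : ∀ s₁, |∑ z ∈ Ix, K s₁ z * ∫ s₂, I s₁ z s₂| ≤ Ix.card *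
      (A * (3 ^ ((d : ℝ) / 2) * 3 ^ ((d : ℝ) / 2) * N ^ (-(d : ℝ))) * B * 3 ^ r *
        (C₀ * W * N ^ ((1 / 2 + ε) * d - (1 - 2 * ε) * κ))) := by
    intro s₁
    rw [← nsmul_eq_mul]
    refine (Finset.abs_sum_le_sum_abs _ _).trans (Finset.sum_le_card_nsmul _ _ _ fun z hz => ?_)
    rw [abs_mul]
    refine mul_le_mul (hKle s₁ z hz) (hmain N hN x₂ hx₂ hx₂N ρ W hρ z.2 (Finset.mem_product.1 hz).2
      s₁) (abs_nonneg _) (by positivity)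
  have hzero : ∀ s₁, 2 * R < ‖s₁‖ → ∑ z ∈ Ix, K s₁ z * ∫ s₂, I s₁ z s₂ = 0 := by
    intro s₁ hs₁
    refine Finset.sum_eq_zero fun z _ => ?_
    simp only [hK, scaledCutoff_eq_zero hR0 hs₁, zero_mul, zero_div]
  simp_rw [hinner]
  refine (abs_integral_le_of_bound_of_support hbound hzero).trans ?_
  rw [Measure.addHaar_real_closedBall _ _ (by positivity), finrank_euclideanSpace_fin, mul_pow,
    show R ^ d = N ^ ((1 / 2 + ε) * d) by
      rw [hR, ← Real.rpow_natCast (N ^ _), ← Real.rpow_mul hN0.le]]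
  refine le_of_eq ?_
  have e : N ^ (2 * d * ε - (1 - 2 * ε) * κ) = N ^ (-(d : ℝ)) *
      N ^ ((1 / 2 + ε) * d - (1 - 2 * ε) * κ) * N ^ ((1 / 2 + ε) * d) := by
    rw [← Real.rpow_add hN0, ← Real.rpow_add hN0]; congr 1; ring
  rw [e]
  ring

end MainTerm

/-! ### `C^k` norms on compact manifolds -/

section CkNorm

variable {E : Type*} [NormedAddCommGroup E] [NormedSpace ℝ E]
  {H : Type*} [TopologicalSpace H] (I : ModelWithCorners ℝ E H) [I.Boundaryless]
  {M : Type*} [TopologicalSpace M] [ChartedSpace H M] [IsManifold I ∞ M]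
  {V : Type*} [NormedAddCommGroup V] [NormedSpace ℝ V]

omit [I.Boundaryless] in
theorem contDiffOn_comp_extChartAt_symm {k : ℕ} {Φ : M → V} {s : Set M}
    (hΦ : ContMDiffOn I 𝓘(ℝ, V) k Φ s) (c : M) :
    ContDiffOn ℝ k (Φ ∘ (extChartAt I c).symm)
      ((extChartAt I c).target ∩ (extChartAt I c).symm ⁻¹' s) := by
  rw [← contMDiffOn_iff_contDiffOn]
  exact hΦ.comp ((contMDiffOn_extChartAt_symm c).mono Set.inter_subset_left)
    Set.inter_subset_right

omit [IsManifold I ∞ M] in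
theorem isOpen_target_inter_preimage {s : Set M} (hs : IsOpen s) (c : M) :
    IsOpen ((extChartAt I c).target ∩ (extChartAt I c).symm ⁻¹' s) :=
  (continuousOn_extChartAt_symm c).isOpen_inter_preimage (isOpen_extChartAt_target c) hs

theorem contDiffOn_target {k : ℕ} {Φ : M → V} (hΦ : ContMDiff I 𝓘(ℝ, V) k Φ) (c : M) :
    ContDiffOn ℝ k (Φ ∘ (extChartAt I c).symm) (extChartAt I c).target := by
  have := contDiffOn_comp_extChartAt_symm I (hΦ.contMDiffOn (s := Set.univ)) c
  simpa using this

variable [CompactSpace M] [T2Space M]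

/-- The chart cover in which the `C^k` norm is read. -/
def normCover (H : Type*) [TopologicalSpace H] (M : Type*) [TopologicalSpace M]
    [ChartedSpace H M] [CompactSpace M] [T2Space M] : ChartCover H M :=
  Classical.choice (ChartCover.nonempty H M)

theorem exists_forall_piece_norm_iteratedFDeriv_le {k : ℕ} {Φ : M → V}
    (hΦ : ContMDiff I 𝓘(ℝ, V) k Φ) :
    ∃ A : ℝ, 1 ≤ A ∧ ∀ z ∈ (normCover H M).centers, ∀ p ∈ (normCover H M).piece z, ∀ j ≤ k,
      ‖iteratedFDeriv ℝ j (Φ ∘ (extChartAt I z).symm) (extChartAt I z p)‖ ≤ A := by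
  have h : ∀ z ∈ (normCover H M).centers, ∃ A : ℝ, ∀ p ∈ (normCover H M).piece z, ∀ j ≤ k,
      ‖iteratedFDeriv ℝ j (Φ ∘ (extChartAt I z).symm) (extChartAt I z p)‖ ≤ A := by
    intro z hz
    have hsub : (normCover H M).piece z ⊆ (extChartAt I z).source := by
      rw [extChartAt_source]
      exact (normCover H M).piece_subset z hz
    obtain ⟨A, -, hA⟩ := exists_forall_norm_iteratedFDeriv_le (isOpen_extChartAt_target (I := I) z)
      (((normCover H M).isCompact_piece z hz).image_of_continuousOn
        ((continuousOn_extChartAt z).mono hsub))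
      (by
        rintro _ ⟨p, hp, rfl⟩
        exact (extChartAt I z).map_source (hsub hp))
      (contDiffOn_target I hΦ z)
    exact ⟨A, fun p hp j hj => hA _ ⟨p, hp, rfl⟩ j hj⟩
  choose! A hA using h
  refine ⟨1 + ∑ z ∈ (normCover H M).centers, |A z|, ?_, fun z hz p hp j hj => ?_⟩
  · have := Finset.sum_nonneg fun z (_ : z ∈ (normCover H M).centers) => abs_nonneg (A z)
    linarith
  · have h1 := Finset.single_le_sum (f := fun z => |A z|) (fun _ _ => abs_nonneg _) hz
    have h2 := hA z hz p hp j hj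
    have h3 := le_abs_self (A z)
    linarith

omit [IsManifold I ∞ M] in
theorem ckNorm_le {k : ℕ} {A : M → ℝ} {B : ℝ} (hB : 0 ≤ B)
    (h : ∀ z ∈ (normCover H M).centers, ∀ p ∈ (normCover H M).piece z, ∀ j ≤ k,
      ‖iteratedFDeriv ℝ j (A ∘ (extChartAt I z).symm) (extChartAt I z p)‖ ≤ B) :
    ckNorm I k A ≤ B := by
  refine Real.sSup_le ?_ hB
  rintro r ⟨z, hz, j, hj, p, hp, rfl⟩
  rw [I.range_eq_univ, iteratedFDerivWithin_univ]
  exact h z hz p hp j hj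

/-- The supremum that defines the `C^k` norm is over a bounded family, hence dominates each of its
members. For functions that are not `C^k` it may be the junk value `0` of an unbounded supremum. -/
theorem norm_iteratedFDeriv_le_ckNorm {k : ℕ} {A : M → ℝ} (hA : ContMDiff I 𝓘(ℝ, ℝ) k A) {z : M}
    (hz : z ∈ (normCover H M).centers) {p : M} (hp : p ∈ (normCover H M).piece z) {j : ℕ}
    (hj : j ≤ k) :
    ‖iteratedFDeriv ℝ j (A ∘ (extChartAt I z).symm) (extChartAt I z p)‖ ≤ ckNorm I k A := by
  refine le_csSup ?_ ⟨z, hz, j, hj, p, hp, ?_⟩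
  · obtain ⟨B, -, hB⟩ := exists_forall_piece_norm_iteratedFDeriv_le I hA
    refine ⟨B, ?_⟩
    rintro r ⟨z, hz, j, hj, p, hp, rfl⟩
    rw [I.range_eq_univ, iteratedFDerivWithin_univ]
    exact hB z hz p hp j hj
  · rw [I.range_eq_univ, iteratedFDerivWithin_univ]

theorem abs_le_ckNorm {k : ℕ} {A : M → ℝ} (hA : ContMDiff I 𝓘(ℝ, ℝ) k A) (p : M) :
    |A p| ≤ ckNorm I k A := by
  obtain ⟨z, hz, hp⟩ := (normCover H M).covers p
  have h := norm_iteratedFDeriv_le_ckNorm I hA hz hp (Nat.zero_le k)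
  have hsrc : p ∈ (extChartAt I z).source := by
    rw [extChartAt_source]
    exact (normCover H M).piece_subset z hz hp
  rwa [norm_iteratedFDeriv_zero, Function.comp_apply, (extChartAt I z).left_inv hsrc] at h

omit [IsManifold I ∞ M] [I.Boundaryless] in
theorem ckNorm_nonneg (k : ℕ) (A : M → ℝ) : 0 ≤ ckNorm I k A := by
  refine Real.sSup_nonneg ?_
  rintro r ⟨z, hz, j, hj, p, hp, rfl⟩
  exact norm_nonneg _

/-- The `C^k` norm of a smooth multiple of `F ∘ φ`, with `φ` smooth, is controlled by the
derivatives of `F`. -/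
theorem exists_ckNorm_mul_comp_le {k : ℕ} {θ : M → ℝ} {φ : M → V} (hθ : ContMDiff I 𝓘(ℝ, ℝ) k θ)
    (hφ : ContMDiff I 𝓘(ℝ, V) k φ) :
    ∃ C : ℝ, 0 ≤ C ∧ ∀ (F : V → ℝ) (B : ℝ), ContDiff ℝ k F → 0 ≤ B →
      (∀ j ≤ k, ∀ u, ‖iteratedFDeriv ℝ j F u‖ ≤ B) →
      ckNorm I k (fun p => θ p * F (φ p)) ≤ C * B := by
  obtain ⟨A₁, hA₁1, hA₁⟩ := exists_forall_piece_norm_iteratedFDeriv_le I hθ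
  obtain ⟨A₂, hA₂1, hA₂⟩ := exists_forall_piece_norm_iteratedFDeriv_le I hφ
  refine ⟨2 ^ k * (k.factorial : ℝ) * (A₁ + A₂) ^ (k + 1), by positivity, ?_⟩
  intro F B hF hB hFB
  refine ckNorm_le I (by positivity) fun z hz p hp j hj => ?_
  have hsrc : p ∈ (extChartAt I z).source := by
    rw [extChartAt_source]
    exact (normCover H M).piece_subset z hz hp
  exact norm_iteratedFDeriv_mul_comp_le (isOpen_extChartAt_target (I := I) z) isOpen_univ
    (contDiffOn_target I hθ z) (contDiffOn_target I hφ z) hF.contDiffOn (Set.mapsTo_univ _ _)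
    ((extChartAt I z).map_source hsrc) (by linarith) hB
    (fun i hi => (hA₁ z hz p hp i hi).trans (by linarith))
    (fun i hi => (hA₂ z hz p hp i hi).trans (by linarith)) (fun i hi => hFB i hi _) hj

/-- The function `g A` read in the chart at `c`, extended by zero. -/
def localRep (c : M) (g A : M → ℝ) : E → ℝ :=
  (extChartAt I c).target.indicator fun u =>
    g ((extChartAt I c).symm u) * A ((extChartAt I c).symm u)

variable {g : M → ℝ} {c : M}

omit [I.Boundaryless] [IsManifold I ∞ M] [CompactSpace M] [T2Space M] in
theorem localRep_extChartAt {A : M → ℝ} {p : M} (hp : p ∈ (chartAt H c).source) :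
    localRep I c g A (extChartAt I c p) = g p * A p := by
  rw [← extChartAt_source I] at hp
  rw [localRep, Set.indicator_of_mem ((extChartAt I c).map_source hp),
    (extChartAt I c).left_inv hp]

omit [I.Boundaryless] [IsManifold I ∞ M] [T2Space M] in
theorem isCompact_image_tsupport (hgc : tsupport g ⊆ (chartAt H c).source) :
    IsCompact (extChartAt I c '' tsupport g) := by
  rw [← extChartAt_source I] at hgc
  exact (isClosed_tsupport g).isCompact.image_of_continuousOn ((continuousOn_extChartAt c).mono hgc)

omit [I.Boundaryless] [IsManifold I ∞ M] [CompactSpace M] [T2Space M] in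
theorem localRep_eq_zero {A : M → ℝ} {u : E} (hu : u ∉ extChartAt I c '' tsupport g) :
    localRep I c g A u = 0 := by
  by_cases hut : u ∈ (extChartAt I c).target
  · have h0 : g ((extChartAt I c).symm u) = 0 :=
      image_eq_zero_of_notMem_tsupport fun h => hu ⟨_, h, (extChartAt I c).right_inv hut⟩
    rw [localRep, Set.indicator_of_mem hut, h0, zero_mul]
  · exact Set.indicator_of_notMem hut _

omit [IsManifold I ∞ M] [T2Space M] [I.Boundaryless] in
theorem localRep_eventuallyEq_zero (hgc : tsupport g ⊆ (chartAt H c).source) (A : M → ℝ) {u : E}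
    (hu : u ∉ extChartAt I c '' tsupport g) : localRep I c g A =ᶠ[𝓝 u] 0 := by
  filter_upwards [(isCompact_image_tsupport I hgc).isClosed.isOpen_compl.mem_nhds hu] with v hv
  exact localRep_eq_zero I hv

omit [T2Space M] in
theorem contDiff_localRep {k : ℕ} (hg : ContMDiff I 𝓘(ℝ, ℝ) k g)
    (hgc : tsupport g ⊆ (chartAt H c).source) {A : M → ℝ} (hA : ContMDiff I 𝓘(ℝ, ℝ) k A) :
    ContDiff ℝ k (localRep I c g A) := by
  rw [contDiff_iff_contDiffAt]
  intro u
  by_cases hu : u ∈ extChartAt I c '' tsupport g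
  · obtain ⟨p, hp, rfl⟩ := hu
    have hp' : p ∈ (extChartAt I c).source := by
      rw [extChartAt_source]
      exact hgc hp
    have ht := (extChartAt I c).map_source hp'
    have hn := (isOpen_extChartAt_target (I := I) c).mem_nhds ht
    have h1 := ((contDiffOn_target I hg c).mul (contDiffOn_target I hA c)).contDiffAt hn
    refine h1.congr_of_eventuallyEq ?_
    filter_upwards [hn] with v hv
    exact Set.indicator_of_mem hv _
  · exact contDiffAt_const.congr_of_eventuallyEq (localRep_eventuallyEq_zero I hgc A hu)

theorem exists_norm_iteratedFDeriv_localRep_le {k : ℕ} (hg : ContMDiff I 𝓘(ℝ, ℝ) k g)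
    (hgc : tsupport g ⊆ (chartAt H c).source) :
    ∃ C : ℝ, 0 ≤ C ∧ ∀ A : M → ℝ, ContMDiff I 𝓘(ℝ, ℝ) k A → ∀ j ≤ k, ∀ u,
      ‖iteratedFDeriv ℝ j (localRep I c g A) u‖ ≤ C * ckNorm I k A := by
  set U : M → Set E := fun z =>
    (extChartAt I c).target ∩ (extChartAt I c).symm ⁻¹' (extChartAt I z).source with hU
  set φ : M → E → E := fun z => extChartAt I z ∘ (extChartAt I c).symm with hφ
  have hUo : ∀ z, IsOpen (U z) := fun z =>
    isOpen_target_inter_preimage I (isOpen_extChartAt_source z) c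
  have hφs : ∀ z, ContDiffOn ℝ k (φ z) (U z) := fun z =>
    contDiffOn_comp_extChartAt_symm I (by
      rw [extChartAt_source]
      exact contMDiffOn_extChartAt) c
  have hgs : ∀ z, ContDiffOn ℝ k (g ∘ (extChartAt I c).symm) (U z) := fun z =>
    (contDiffOn_target I hg c).mono Set.inter_subset_left
  have hsrc : tsupport g ⊆ (extChartAt I c).source := by
    rw [extChartAt_source]
    exact hgc
  have hex : ∀ z ∈ (normCover H M).centers, ∃ B : ℝ, 1 ≤ B ∧
      ∀ p ∈ tsupport g ∩ (normCover H M).piece z, ∀ j ≤ k,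
        ‖iteratedFDeriv ℝ j (g ∘ (extChartAt I c).symm) (extChartAt I c p)‖ ≤ B ∧
        ‖iteratedFDeriv ℝ j (φ z) (extChartAt I c p)‖ ≤ B := by
    intro z hz
    have hQ : IsCompact (extChartAt I c '' (tsupport g ∩ (normCover H M).piece z)) :=
      (((normCover H M).isCompact_piece z hz).inter_left
        (isClosed_tsupport g)).image_of_continuousOn
        ((continuousOn_extChartAt c).mono (Set.inter_subset_left.trans hsrc))
    have hQU : extChartAt I c '' (tsupport g ∩ (normCover H M).piece z) ⊆ U z := by
      rintro _ ⟨p, ⟨hp1, hp2⟩, rfl⟩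
      refine ⟨(extChartAt I c).map_source (hsrc hp1), ?_⟩
      rw [Set.mem_preimage, (extChartAt I c).left_inv (hsrc hp1), extChartAt_source]
      exact (normCover H M).piece_subset z hz hp2
    obtain ⟨B₁, hB₁1, hB₁⟩ := exists_forall_norm_iteratedFDeriv_le (hUo z) hQ hQU (hgs z)
    obtain ⟨B₂, hB₂1, hB₂⟩ := exists_forall_norm_iteratedFDeriv_le (hUo z) hQ hQU (hφs z)
    exact ⟨B₁ + B₂, by linarith, fun p hp j hj =>
      ⟨(hB₁ _ ⟨p, hp, rfl⟩ j hj).trans (by linarith),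
        (hB₂ _ ⟨p, hp, rfl⟩ j hj).trans (by linarith)⟩⟩
  choose! B hB1 hB using hex
  refine ⟨∑ z ∈ (normCover H M).centers, 2 ^ k * (k.factorial : ℝ) * (B z) ^ (k + 1),
    Finset.sum_nonneg fun z hz => by
      have := hB1 z hz
      positivity, fun A hA j hj u => ?_⟩
  have hn := ckNorm_nonneg I k A
  by_cases hu : u ∈ extChartAt I c '' tsupport g
  · obtain ⟨p, hp, rfl⟩ := hu
    obtain ⟨z, hz, hpz⟩ := (normCover H M).covers p
    have hpU : extChartAt I c p ∈ U z := by
      refine ⟨(extChartAt I c).map_source (hsrc hp), ?_⟩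
      rw [Set.mem_preimage, (extChartAt I c).left_inv (hsrc hp), extChartAt_source]
      exact (normCover H M).piece_subset z hz hpz
    have hφp : φ z (extChartAt I c p) = extChartAt I z p := by
      simp only [hφ, Function.comp_apply, (extChartAt I c).left_inv (hsrc hp)]
    have key := norm_iteratedFDeriv_mul_comp_le (hUo z) (isOpen_extChartAt_target (I := I) z)
      (hgs z) (hφs z) (contDiffOn_target I hA z)
      (fun v hv => (extChartAt I z).map_source hv.2) hpU (hB1 z hz) hn
      (fun i hi => (hB z hz p ⟨hp, hpz⟩ i hi).1) (fun i hi => (hB z hz p ⟨hp, hpz⟩ i hi).2)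
      (fun i hi => by
        rw [hφp]
        exact norm_iteratedFDeriv_le_ckNorm I hA hz hpz hi) hj
    have heq : localRep I c g A =ᶠ[𝓝 (extChartAt I c p)] fun v =>
        (g ∘ (extChartAt I c).symm) v * (A ∘ (extChartAt I z).symm) (φ z v) := by
      filter_upwards [(hUo z).mem_nhds hpU] with v hv
      rw [localRep, Set.indicator_of_mem hv.1]
      simp only [hφ, Function.comp_apply, (extChartAt I z).left_inv hv.2]
    rw [(heq.iteratedFDeriv ℝ j).eq_of_nhds]
    refine key.trans ?_
    gcongr
    exact Finset.single_le_sum (f := fun z => 2 ^ k * (k.factorial : ℝ) * (B z) ^ (k + 1))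
      (fun z hz => by
        have := hB1 z hz
        positivity) hz
  · rw [((localRep_eventuallyEq_zero I hgc A hu).iteratedFDeriv ℝ j).eq_of_nhds]
    have h0 : iteratedFDeriv ℝ j (0 : E → ℝ) u = 0 := by
      rw [iteratedFDeriv_zero]; rfl
    rw [h0, norm_zero]
    refine mul_nonneg (Finset.sum_nonneg fun z hz => ?_) hn
    have := hB1 z hz
    positivity

end CkNorm

/-! ### Correlations of the base weighted by a function of the cocycle -/

section BaseEstimate

variable {d : ℕ}

theorem ckNormEuclidean_nonneg (k : ℕ) (φ : EuclideanSpace ℝ (Fin d) → ℝ) :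
    0 ≤ ckNormEuclidean k φ := by
  refine Real.sSup_nonneg ?_
  rintro r ⟨j, hj, s, rfl⟩
  exact norm_nonneg _

theorem ckNormEuclidean_le {k : ℕ} {φ : EuclideanSpace ℝ (Fin d) → ℝ} {B : ℝ} (hB : 0 ≤ B)
    (h : ∀ j ≤ k, ∀ s, ‖iteratedFDeriv ℝ j φ s‖ ≤ B) : ckNormEuclidean k φ ≤ B := by
  refine Real.sSup_le ?_ hB
  rintro r ⟨j, hj, s, rfl⟩
  exact h j hj s

theorem support_subset_box_of_eq_zero {φ : EuclideanSpace ℝ (Fin d) → ℝ} {R : ℝ}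
    (h : ∀ s, R < ‖s‖ → φ s = 0) :
    Function.support φ ⊆ box (fun _ => -R) fun _ => R := by
  intro s hs
  have h1 : ‖s‖ ≤ R := by
    by_contra hc
    exact hs (h s (not_le.1 hc))
  intro i
  have h2 : ‖s i‖ ≤ ‖s‖ := PiLp.norm_apply_le s i
  rw [Real.norm_eq_abs] at h2
  exact abs_le.1 (h2.trans h1)

theorem rpow_neg_le_of_third_le {N x q : ℝ} (hN : 0 < N) (hx : N / 3 ≤ x) (hq : 0 ≤ q) :
    x ^ (-q) ≤ 3 ^ q * N ^ (-q) := by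
  refine (Real.rpow_le_rpow_of_nonpos (by linarith) hx (by linarith)).trans (le_of_eq ?_)
  rw [Real.div_rpow hN.le (by norm_num), div_eq_mul_inv, ← Real.rpow_neg (by norm_num), neg_neg,
    mul_comm]

variable {E X : Type*} [NormedAddCommGroup E] [NormedSpace ℝ E]
  [TopologicalSpace X] [ChartedSpace E X]

theorem continuous_birkhoffSum {f : X → X} {τ : X → EuclideanSpace ℝ (Fin d)}
    (hf : Continuous f) (hτ : Continuous τ) (N : ℕ) : Continuous (birkhoffSum f τ N) := by
  unfold birkhoffSum
  exact continuous_finsetSum _ fun i _ => hτ.comp (hf.iterate i)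

variable [IsManifold 𝓘(ℝ, E) ∞ X] [CompactSpace X] [T2Space X] [MeasurableSpace X] [BorelSpace X]
  {μ : Measure X} [IsProbabilityMeasure μ] {f : X → X} {τ : X → EuclideanSpace ℝ (Fin d)}

omit [T2Space X] in
/-- Restricting to the event that the cocycle is of its typical size at two times costs at most
the moderate deviation probabilities. -/
theorem exists_abs_integral_sub_cutoff_le (hf : Continuous f) (hτ : Continuous τ)
    {r₂ κ ε : ℝ} (hκ : 0 < κ) (hr₂ : κ < r₂) (hε : 0 < ε) (hA2 : ModerateDeviations μ f τ r₂) :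
    ∃ C : ℝ, 0 ≤ C ∧ ∀ (b : X → ℝ) (M : ℝ), Continuous b → (∀ x, |b x| ≤ M) →
      ∀ N₁ N : ℕ, 0 < N₁ → N₁ ≤ N → (N : ℝ) / 3 ≤ N₁ →
      |(∫ x, b x ∂μ) - ∫ x, b x * (scaledCutoff ((N : ℝ) ^ (1 / 2 + ε)) (birkhoffSum f τ N₁ x) *
        scaledCutoff ((N : ℝ) ^ (1 / 2 + ε)) (birkhoffSum f τ N x)) ∂μ| ≤
        C * M * (N : ℝ) ^ (-κ) := by
  obtain ⟨C, hC⟩ := hA2 ε hε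
  refine ⟨2 * |C| * 3 ^ r₂, by positivity, ?_⟩
  intro b M hb hM N₁ N hN₁ hN₁N hN3
  have hN : 0 < N := hN₁.trans_le hN₁N
  have hN1 : (1 : ℝ) ≤ N := by exact_mod_cast hN
  have hN0 : (0 : ℝ) < N := by linarith
  have hM0 : 0 ≤ M := by
    obtain ⟨x⟩ : Nonempty X := μ.nonempty_of_neZero
    exact (abs_nonneg _).trans (hM x)
  set R : ℝ := (N : ℝ) ^ (1 / 2 + ε) with hR
  have hR0 : 0 < R := Real.rpow_pos_of_pos hN0 _
  set bad : ℕ → Set X := fun m => {x | (m : ℝ) ^ ((1 : ℝ) / 2 + ε) < ‖birkhoffSum f τ m x‖}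
    with hbad
  have hbm : ∀ m, MeasurableSet (bad m) := fun m =>
    (isOpen_lt continuous_const (continuous_birkhoffSum hf hτ m).norm).measurableSet
  have hcut : ∀ m, Continuous fun x => scaledCutoff R (birkhoffSum f τ m x) := fun m =>
    (contDiff_scaledCutoff R (n := 0)).continuous.comp (continuous_birkhoffSum hf hτ m)
  have hone : ∀ m : ℕ, m ≤ N → ∀ x, x ∉ bad m → scaledCutoff R (birkhoffSum f τ m x) = 1 := by
    intro m hm x hx
    refine scaledCutoff_eq_one hR0 ((not_lt.1 hx).trans ?_)
    apply Real.rpow_le_rpow (Nat.cast_nonneg m) (by exact_mod_cast hm) (by linarith)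
  have hi₂ : Integrable (fun x => b x * (scaledCutoff R (birkhoffSum f τ N₁ x) *
      scaledCutoff R (birkhoffSum f τ N x))) μ :=
    integrable_of_continuous (hb.mul ((hcut N₁).mul (hcut N)))
  rw [← integral_sub (integrable_of_continuous hb) hi₂]
  have hpt : ∀ x, ‖b x - b x * (scaledCutoff R (birkhoffSum f τ N₁ x) *
      scaledCutoff R (birkhoffSum f τ N x))‖ ≤ (bad N₁ ∪ bad N).indicator (fun _ => M) x := by
    intro x
    by_cases hx : x ∈ bad N₁ ∪ bad N
    · rw [Set.indicator_of_mem hx, ← mul_one_sub, norm_mul]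
      set p := scaledCutoff R (birkhoffSum f τ N₁ x)
      set q := scaledCutoff R (birkhoffSum f τ N x)
      have hp0 : 0 ≤ p := scaledCutoff_nonneg R _
      have hq0 : 0 ≤ q := scaledCutoff_nonneg R _
      have hpq : p * q ≤ 1 :=
        mul_le_one₀ (scaledCutoff_le_one R _) hq0 (scaledCutoff_le_one R _)
      have h1 : ‖1 - p * q‖ ≤ 1 := by
        rw [Real.norm_of_nonneg (by linarith)]
        linarith [mul_nonneg hp0 hq0]
      calc ‖b x‖ * ‖1 - p * q‖ ≤ M * 1 := mul_le_mul (hM x) h1 (norm_nonneg _) hM0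
        _ = M := mul_one M
    · rw [Set.mem_union, not_or] at hx
      rw [hone N₁ hN₁N x hx.1, hone N le_rfl x hx.2]
      simp only [mul_one, sub_self, norm_zero]
      exact Set.indicator_nonneg (fun _ _ => hM0) x
  have hmu : ∀ m : ℕ, 0 < m → (N : ℝ) / 3 ≤ m → μ.real (bad m) ≤
      |C| * (3 ^ r₂ * (N : ℝ) ^ (-κ)) := by
    intro m hm hm3
    refine (hC m hm).trans ?_
    have h1 : C * (m : ℝ) ^ (-r₂) ≤ |C| * (m : ℝ) ^ (-r₂) :=
      mul_le_mul_of_nonneg_right (le_abs_self C) (by positivity)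
    refine h1.trans ?_
    gcongr
    refine (rpow_neg_le_of_third_le hN0 hm3 (by linarith)).trans ?_
    gcongr
  refine (norm_integral_le_of_norm_le ((integrable_const M).indicator
    ((hbm N₁).union (hbm N))) (ae_of_all _ hpt)).trans ?_
  rw [integral_indicator_const M ((hbm N₁).union (hbm N)), smul_eq_mul]
  calc μ.real (bad N₁ ∪ bad N) * M ≤ (μ.real (bad N₁) + μ.real (bad N)) * M := by
        gcongr
        exact measureReal_union_le _ _
    _ ≤ (|C| * (3 ^ r₂ * (N : ℝ) ^ (-κ)) + |C| * (3 ^ r₂ * (N : ℝ) ^ (-κ))) * M := by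
        gcongr
        · exact hmu N₁ hN₁ hN3
        · exact hmu N hN (by linarith)
    _ = _ := by ring

/-- Size of the remainder of the Edgeworth expansion for test functions supported in boxes of side
`4 N^{1/2+ε}`, at the times `m` and `N`, when `m` and `N - m` are comparable with `N`: the volumes
of the boxes cancel the factors `N^{-d/2}` up to `N^{2dε}`, which leaves `N^{2dε - r/2}`. -/
theorem edgeworth_error_le {d r : ℕ} {ε q nn c₁ c₂ B₁ B₂ D D' N m : ℝ} (hnn : 0 ≤ nn)
    (hc₁ : 0 ≤ c₁) (hcB₁ : c₁ ≤ B₁) (hc₂ : 0 ≤ c₂) (hcB₂ : c₂ ≤ B₂) (hD : D ≤ |D'|) (hN : 1 ≤ N)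
    (hm : N / 3 ≤ m) (hm' : N / 3 ≤ N - m) (hq : 2 * d * ε - r / 2 ≤ q) :
    nn * ((c₁ * (4 * N ^ (1 / 2 + ε)) ^ d) * (c₂ * (4 * N ^ (1 / 2 + ε)) ^ d)) *
      (D * (N - m) ^ (-(d : ℝ) / 2) * m ^ (-((d : ℝ) + r) / 2)) ≤
    nn * (B₁ * 4 ^ d * (B₂ * 4 ^ d)) *
      (|D'| * 3 ^ ((d : ℝ) / 2) * 3 ^ (((d : ℝ) + r) / 2)) * N ^ q := by
  have hN0 : 0 < N := by linarith
  have hm0 : 0 < m := by linarith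
  have hm0' : 0 < N - m := by linarith
  have e1 : (N - m) ^ (-(d : ℝ) / 2) ≤ 3 ^ ((d : ℝ) / 2) * N ^ (-((d : ℝ) / 2)) := by
    rw [neg_div]
    exact rpow_neg_le_of_third_le hN0 hm' (by positivity)
  have e2 : m ^ (-((d : ℝ) + r) / 2) ≤
      3 ^ (((d : ℝ) + r) / 2) * N ^ (-(((d : ℝ) + r) / 2)) := by
    rw [neg_div]
    exact rpow_neg_le_of_third_le hN0 hm (by positivity)
  have e3 : D * (N - m) ^ (-(d : ℝ) / 2) * m ^ (-((d : ℝ) + r) / 2) ≤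
      |D'| * (3 ^ ((d : ℝ) / 2) * N ^ (-((d : ℝ) / 2))) *
        (3 ^ (((d : ℝ) + r) / 2) * N ^ (-(((d : ℝ) + r) / 2))) := by
    gcongr
  have hB₁ : 0 ≤ B₁ := hc₁.trans hcB₁
  have hB₂ : 0 ≤ B₂ := hc₂.trans hcB₂
  have hR : (N ^ (1 / 2 + ε)) ^ d = N ^ ((1 / 2 + ε) * d) := by
    rw [← Real.rpow_natCast (N ^ _), ← Real.rpow_mul hN0.le]
  have hle : nn * ((c₁ * (4 * N ^ (1 / 2 + ε)) ^ d) * (c₂ * (4 * N ^ (1 / 2 + ε)) ^ d)) ≤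
      nn * ((B₁ * (4 * N ^ (1 / 2 + ε)) ^ d) * (B₂ * (4 * N ^ (1 / 2 + ε)) ^ d)) := by
    gcongr
  refine (mul_le_mul_of_nonneg_left e3 (by positivity)).trans
    ((mul_le_mul_of_nonneg_right hle (by positivity)).trans ?_)
  have hexp : N ^ ((1 / 2 + ε) * d) * N ^ ((1 / 2 + ε) * d) * N ^ (-((d : ℝ) / 2)) *
      N ^ (-(((d : ℝ) + r) / 2)) ≤ N ^ q := by
    rw [← Real.rpow_add hN0, ← Real.rpow_add hN0, ← Real.rpow_add hN0]
    apply Real.rpow_le_rpow_of_exponent_le hN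
    linarith
  rw [mul_pow, hR]
  refine le_trans (le_of_eq ?_) (mul_le_mul_of_nonneg_left hexp (by positivity :
    0 ≤ nn * (B₁ * 4 ^ d * (B₂ * 4 ^ d)) *
      (|D'| * 3 ^ ((d : ℝ) / 2) * 3 ^ (((d : ℝ) + r) / 2))))
  ring

set_option maxHeartbeats 1000000 in
/-- If the averages of `ρ` over cubes decay, then so do the correlations of the base weighted by
`ρ ∘ τ_N`. The Edgeworth expansion is used at the times `N / 2` and `N`, with the constant function
`1` as the middle observable. -/
theorem exists_abs_integral_mul_birkhoffSum_le (hf : Continuous f) (hτ : Continuous τ) {r : ℕ}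
    {r₂ κ : ℝ} (hκ : 0 < κ) (hr : 2 * κ < r) (hr₂ : κ < r₂)
    (hA1 : MixingDoubleEdgeworth (E := E) μ f τ r) (hA2 : ModerateDeviations μ f τ r₂) :
    ∃ k₁ k₂ : ℕ, ∀ δ > (0 : ℝ), ∃ C : ℝ, 0 ≤ C ∧
      ∀ (a a' : C^k₁⟮𝓘(ℝ, E), X; ℝ⟯) (ρ : EuclideanSpace ℝ (Fin d) → ℝ) (W : ℝ),
      AverageDecay κ W ρ → ContDiff ℝ k₂ ρ → (∀ j ≤ k₂, ∀ u, ‖iteratedFDeriv ℝ j ρ u‖ ≤ W) →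
      ∀ N : ℕ, 0 < N →
        |∫ x, a x * a' (f^[N] x) * ρ (birkhoffSum f τ N x) ∂μ| ≤
          C * (ckNorm 𝓘(ℝ, E) k₁ a * ckNorm 𝓘(ℝ, E) k₁ a') * W * (N : ℝ) ^ (-κ + δ) := by
  obtain ⟨k₁, k₂, dl, S, P, D, Cp, hdl, hS, -, hdeg, hcoeff, hexp⟩ := hA1
  refine ⟨k₁, k₂, fun δ hδ => ?_⟩
  obtain ⟨ε, hε, hε2, hεδ⟩ : ∃ ε : ℝ, 0 < ε ∧ ε ≤ 1 / 2 ∧ 2 * ε * (d + κ) ≤ δ := by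
    have hdk : 0 < (d : ℝ) + κ := by positivity
    refine ⟨min (1 / 2) (δ / (2 * (d + κ))), by positivity, min_le_left _ _, ?_⟩
    have := min_le_right (1 / 2) (δ / (2 * (d + κ)))
    rw [le_div_iff₀ (by positivity)] at this
    linarith
  obtain ⟨Db, hDb⟩ := hdl.bddAbove_range
  have hDb' : ∀ m, dl m ≤ |Db| := fun m => (hDb ⟨m, rfl⟩).trans (le_abs_self _)
  obtain ⟨C₁, hC₁, hmain⟩ := exists_abs_edgeworthIntegral_le hS D r hκ hε hε2
  obtain ⟨C₂, hC₂, hcut⟩ := exists_abs_integral_sub_cutoff_le (μ := μ) hf hτ hκ hr₂ hε hA2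
  obtain ⟨B, hB1, hB⟩ := exists_norm_iteratedFDeriv_scaledCutoff_le (EuclideanSpace ℝ (Fin d)) k₂
  set one : C^k₁⟮𝓘(ℝ, E), X; ℝ⟯ := 1 with hone
  set n₁ := ckNorm 𝓘(ℝ, E) k₁ one with hn₁
  have hn₁0 : 0 ≤ n₁ := ckNorm_nonneg _ _ _
  set C₃ := n₁ * ((B * 4 ^ d) * (2 ^ k₂ * B * 4 ^ d)) *
    (|Db| * (3 ^ ((d : ℝ) / 2)) * 3 ^ (((d : ℝ) + r) / 2)) with hC₃
  have hC₃0 : 0 ≤ C₃ := by positivity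
  refine ⟨1 + C₂ + C₃ + C₁ * (|Cp| * n₁), by positivity, ?_⟩
  intro a a' ρ W hρ hρc hρW N hN
  set na := ckNorm 𝓘(ℝ, E) k₁ a with hna
  set na' := ckNorm 𝓘(ℝ, E) k₁ a' with hna'
  have hna0 : 0 ≤ na := ckNorm_nonneg _ _ _
  have hna'0 : 0 ≤ na' := ckNorm_nonneg _ _ _
  have hW : 0 ≤ W := (abs_nonneg _).trans (hρ.abs_le 0)
  have hac : Continuous a := a.contMDiff.continuous
  have ha'c : Continuous a' := a'.contMDiff.continuous
  have haN : ∀ x, |a x| ≤ na := abs_le_ckNorm _ a.contMDiff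
  have ha'N : ∀ x, |a' x| ≤ na' := abs_le_ckNorm _ a'.contMDiff
  set b : X → ℝ := fun x => a x * a' (f^[N] x) * ρ (birkhoffSum f τ N x) with hb
  have hbc : Continuous b := (hac.mul (ha'c.comp (hf.iterate N))).mul
    (hρ.continuous.comp (continuous_birkhoffSum hf hτ N))
  have hbM : ∀ x, |b x| ≤ na * na' * W := by
    intro x
    rw [hb, abs_mul, abs_mul]
    have := haN x
    have := ha'N (f^[N] x)
    have := hρ.abs_le (birkhoffSum f τ N x)
    gcongr
  have hnn : 0 ≤ na * na' * W := by positivity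
  have hN1 : (1 : ℝ) ≤ N := by exact_mod_cast hN
  have hN0 : (0 : ℝ) < N := by linarith
  rcases Nat.lt_or_ge N 2 with hlt | h2N
  · -- for `N = 1` the bound is trivial
    obtain rfl : N = 1 := by omega
    have h1 := norm_integral_le_of_norm_le_const (μ := μ) (f := b) (ae_of_all _ hbM)
    rw [probReal_univ, mul_one] at h1
    refine h1.trans ?_
    rw [Nat.cast_one, Real.one_rpow, mul_one]
    have : 0 ≤ C₂ + C₃ + C₁ * (|Cp| * n₁) := by positivity
    nlinarith
  set N₁ := N / 2 with hN₁
  have hN₁0 : 0 < N₁ := by omega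
  have hN₁N : N₁ < N := by omega
  have hmin : min N₁ (N - N₁) = N₁ := by omega
  have hmax : max N₁ (N - N₁) = N - N₁ := by omega
  have h3 : (N : ℝ) / 3 ≤ N₁ := by
    have : N ≤ 3 * N₁ := by omega
    have : (N : ℝ) ≤ 3 * N₁ := by exact_mod_cast this
    linarith
  have hsub : ((N - N₁ : ℕ) : ℝ) = (N : ℝ) - N₁ := by
    push_cast [hN₁N.le]; ring
  have h3' : (N : ℝ) / 3 ≤ (N : ℝ) - N₁ := by
    rw [← hsub]
    have : N ≤ 3 * (N - N₁) := by omega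
    have : (N : ℝ) ≤ 3 * ((N - N₁ : ℕ) : ℝ) := by exact_mod_cast this
    linarith
  set R : ℝ := (N : ℝ) ^ (1 / 2 + ε) with hR
  have hR1 : 1 ≤ R := Real.one_le_rpow hN1 (by linarith)
  have hR0 : 0 < R := by linarith
  set φ₂ : EuclideanSpace ℝ (Fin d) → ℝ := fun s => scaledCutoff R s * ρ s with hφ₂
  have hχd : ∀ j ≤ k₂, ∀ u : EuclideanSpace ℝ (Fin d),
      ‖iteratedFDeriv ℝ j (scaledCutoff R) u‖ ≤ B := by
    intro j hj u
    refine (hB R hR0 j hj u).trans ?_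
    calc R⁻¹ ^ j * B ≤ 1 * B := by
          gcongr
          exact pow_le_one₀ (by positivity) (inv_le_one_of_one_le₀ hR1)
      _ = B := one_mul B
  have hφ₂d : ∀ j ≤ k₂, ∀ u, ‖iteratedFDeriv ℝ j φ₂ u‖ ≤ 2 ^ k₂ * B * W := by
    intro j hj u
    have := norm_iteratedFDeriv_mul_le_of_le (k := j) (c := 1) (A := B) (B := W) (u := u)
      (contDiff_scaledCutoff R) (hρc.of_le (by exact_mod_cast hj)) zero_le_one (by linarith)
      (fun i hi => by simpa using hχd i (hi.trans hj) u)
      (fun i hi => by simpa using hρW i (hi.trans hj) u)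
    refine this.trans ?_
    rw [one_pow, one_mul]
    gcongr
    norm_num
  have hck₁ := ckNormEuclidean_le (by linarith) hχd
  have hck₂ := ckNormEuclidean_le (by positivity) hφ₂d
  have hexp' := hexp a one a' N₁ N hN₁0 hN₁N (scaledCutoff R) φ₂ (fun _ => -(2 * R))
    (fun _ => 2 * R) (fun _ => -(2 * R)) (fun _ => 2 * R) (contDiff_scaledCutoff R)
    ((contDiff_scaledCutoff R).mul hρc)
    (support_subset_box_of_eq_zero fun s hs => scaledCutoff_eq_zero hR0 hs)
    (support_subset_box_of_eq_zero fun s hs => by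
      simp only [hφ₂, scaledCutoff_eq_zero hR0 hs, zero_mul])
  rw [hmin, hmax, hsub, volumeReal_box_const (by linarith),
    show 2 * R - -(2 * R) = 4 * R by ring] at hexp'
  have hm := hmain N hN1 N₁ ((N : ℝ) - N₁) h3 h3' (by
    have : (0 : ℝ) ≤ N₁ := Nat.cast_nonneg _
    linarith) ρ W hρ (fun p₁ p₂ => P p₁ p₂ a one a') (|Cp| * (na * n₁ * na')) (by positivity)
    (fun p₁ hp₁ p₂ hp₂ => hdeg p₁ hp₁ p₂ hp₂ _ _ _)
    (fun p₁ hp₁ p₂ hp₂ m => (hcoeff p₁ hp₁ p₂ hp₂ _ _ _ m).trans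
      (mul_le_mul_of_nonneg_right (le_abs_self Cp) (by positivity)))
  have hc := hcut b (na * na' * W) hbc hbM N₁ N hN₁0 hN₁N.le h3
  have hint : ∫ x, a x * one (f^[N₁] x) * a' (f^[N] x) * scaledCutoff R (birkhoffSum f τ N₁ x) *
      φ₂ (birkhoffSum f τ N x) ∂μ = ∫ x, b x * (scaledCutoff R (birkhoffSum f τ N₁ x) *
        scaledCutoff R (birkhoffSum f τ N x)) ∂μ := by
    congr 1; ext x
    simp only [hb, hφ₂, hone, ContMDiffMap.coe_one, Pi.one_apply]
    ring
  rw [hint] at hexp'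
  have hpow : ∀ p : ℝ, p ≤ -κ + δ → (N : ℝ) ^ p ≤ (N : ℝ) ^ (-κ + δ) := fun p hp =>
    Real.rpow_le_rpow_of_exponent_le hN1 hp
  have herr := edgeworth_error_le (d := d) (r := r) (q := -κ + δ) (nn := na * n₁ * na') (ε := ε)
    (by positivity) (ckNormEuclidean_nonneg k₂ (scaledCutoff (V := EuclideanSpace ℝ (Fin d)) R))
    hck₁ (ckNormEuclidean_nonneg k₂ φ₂) hck₂ (hDb' N₁) hN1 h3 h3' (by nlinarith)
  rw [← hR, show na * n₁ * na' * (B * 4 ^ d * (2 ^ k₂ * B * W * 4 ^ d)) *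
    (|Db| * 3 ^ ((d : ℝ) / 2) * 3 ^ (((d : ℝ) + r) / 2)) = C₃ * (na * na') * W by
      rw [hC₃]; ring] at herr
  have hm' := hm.trans (b := C₁ * (|Cp| * (na * n₁ * na')) * W * (N : ℝ) ^ (2 * d * ε -
    (1 - 2 * ε) * κ)) (c := C₁ * (|Cp| * n₁) * (na * na') * W * (N : ℝ) ^ (-κ + δ)) (by
      rw [show C₁ * (|Cp| * (na * n₁ * na')) * W = C₁ * (|Cp| * n₁) * (na * na') * W by ring]
      gcongr
      · linarith)
  have hc' : C₂ * (na * na' * W) * (N : ℝ) ^ (-κ) ≤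
      C₂ * (na * na') * W * (N : ℝ) ^ (-κ + δ) := by
    rw [show C₂ * (na * na' * W) = C₂ * (na * na') * W by ring]
    gcongr
    linarith
  have hfin := (abs_le.1 (hexp'.trans herr))
  have hfin2 := abs_le.1 hm'
  have hfin3 := abs_le.1 (hc.trans hc')
  have hone' : 0 ≤ 1 * (na * na') * W * (N : ℝ) ^ (-κ + δ) := by positivity
  rw [abs_le]
  constructor
  · linarith [hfin.1, hfin2.1, hfin3.1]
  · linarith [hfin.2, hfin2.2, hfin3.2]

end BaseEstimate

/-! ### Smoothness of fiber correlations -/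

section FlowDerivatives

variable {V : Type} [NormedAddCommGroup V] [NormedSpace ℝ V]
  {E Y : Type*} [NormedAddCommGroup E] [NormedSpace ℝ E]
  [TopologicalSpace Y] [CompactSpace Y] [ChartedSpace E Y] [IsManifold 𝓘(ℝ, E) ∞ Y]
  {G : V → Y → Y}

omit [CompactSpace Y] in
/-- Differentiating a smooth function along a flow gives a smooth function along the flow: the
derivative at time `t` is read off at the point `G t y`. -/
theorem exists_hasFDerivAt_comp_flow
    (hG : ContMDiff (𝓘(ℝ, V).prod 𝓘(ℝ, E)) 𝓘(ℝ, E) ∞ (fun p : V × Y => G p.1 p.2))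
    (hG_add : ∀ s t y, G (s + t) y = G s (G t y))
    {W : Type} [NormedAddCommGroup W] [NormedSpace ℝ W] {Φ : Y → W}
    (hΦ : ContMDiff 𝓘(ℝ, E) 𝓘(ℝ, W) ∞ Φ) :
    ∃ Φ₁ : Y → (V →L[ℝ] W), ContMDiff 𝓘(ℝ, E) 𝓘(ℝ, V →L[ℝ] W) ∞ Φ₁ ∧
      ∀ t y, HasFDerivAt (fun s => Φ (G s y)) (Φ₁ (G t y)) t := by
  have hsm : ContMDiff (𝓘(ℝ, V).prod 𝓘(ℝ, E)) 𝓘(ℝ, W) ∞ (fun p : V × Y => Φ (G p.1 p.2)) :=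
    hΦ.comp hG
  have hsl : ∀ y, ContDiff ℝ ∞ (fun s => Φ (G s y)) := fun y => by
    rw [← contMDiff_iff_contDiff]
    exact hsm.comp (contMDiff_id.prodMk contMDiff_const)
  refine ⟨fun y => fderiv ℝ (fun s => Φ (G s y)) 0, fun y₀ => ?_, fun t y => ?_⟩
  · have hsw : ContMDiff (𝓘(ℝ, E).prod 𝓘(ℝ, V)) 𝓘(ℝ, W) ∞
        (Function.uncurry fun (y : Y) (s : V) => Φ (G s y)) :=
      hsm.comp (contMDiff_snd.prodMk contMDiff_fst)
    have := ContMDiffAt.mfderiv (n := ∞) (m := ∞) (x₀ := y₀) (fun (y : Y) (s : V) => Φ (G s y))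
      (fun _ => (0 : V)) hsw.contMDiffAt contMDiffAt_const (by simp)
    simpa only [inTangentCoordinates_model_space, mfderiv_eq_fderiv] using this
  · have h0 : HasFDerivAt (fun s => Φ (G s (G t y))) (fderiv ℝ (fun s => Φ (G s (G t y))) 0)
        (t - t) := by
      rw [sub_self]
      exact ((hsl _).differentiable (by simp)).differentiableAt.hasFDerivAt
    have h1 := HasFDerivAt.comp (f := fun s => id s - t) t h0 ((hasFDerivAt_id t).sub_const t)
    rw [ContinuousLinearMap.comp_id] at h1
    refine h1.congr_of_eventuallyEq (Eventually.of_forall fun s => ?_)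
    simp [← hG_add]

/-- The derivatives of a smooth function along the orbits of a flow on a compact manifold are
uniformly bounded. -/
theorem exists_norm_iteratedFDeriv_comp_flow_le
    (hG : ContMDiff (𝓘(ℝ, V).prod 𝓘(ℝ, E)) 𝓘(ℝ, E) ∞ (fun p : V × Y => G p.1 p.2))
    (hG_add : ∀ s t y, G (s + t) y = G s (G t y)) (k : ℕ) :
    ∀ {W : Type} [NormedAddCommGroup W] [NormedSpace ℝ W] {Φ : Y → W},
    ContMDiff 𝓘(ℝ, E) 𝓘(ℝ, W) ∞ Φ →
    ∃ C : ℝ, 1 ≤ C ∧ ∀ j ≤ k, ∀ y t, ‖iteratedFDeriv ℝ j (fun s => Φ (G s y)) t‖ ≤ C := by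
  have hzero : ∀ {W : Type} [NormedAddCommGroup W] [NormedSpace ℝ W] {Φ : Y → W},
      ContMDiff 𝓘(ℝ, E) 𝓘(ℝ, W) ∞ Φ → ∃ C : ℝ, 1 ≤ C ∧ ∀ y, ‖Φ y‖ ≤ C := by
    intro W _ _ Φ hΦ
    obtain ⟨C, hC⟩ := (isCompact_range hΦ.continuous.norm).bddAbove
    exact ⟨max 1 C, le_max_left _ _, fun y => (hC ⟨y, rfl⟩).trans (le_max_right _ _)⟩
  induction k with
  | zero =>
    intro W _ _ Φ hΦ
    obtain ⟨C, hC1, hC⟩ := hzero hΦ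
    refine ⟨C, hC1, fun j hj y t => ?_⟩
    obtain rfl : j = 0 := by omega
    rw [norm_iteratedFDeriv_zero]
    exact hC _
  | succ k ih =>
    intro W _ _ Φ hΦ
    obtain ⟨C, hC1, hC⟩ := hzero hΦ
    obtain ⟨Φ₁, hΦ₁, hd⟩ := exists_hasFDerivAt_comp_flow hG hG_add hΦ
    obtain ⟨C', hC1', hC'⟩ := ih hΦ₁
    refine ⟨max C C', hC1.trans (le_max_left _ _), fun j hj y t => ?_⟩
    rcases j with _ | j
    · rw [norm_iteratedFDeriv_zero]
      exact (hC _).trans (le_max_left _ _)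
    · rw [← norm_iteratedFDeriv_fderiv,
        show fderiv ℝ (fun s => Φ (G s y)) = fun s => Φ₁ (G s y) from
          funext fun s => (hd s y).fderiv]
      exact (hC' j (by omega) y t).trans (le_max_right _ _)

variable [SecondCountableTopology Y] [MeasurableSpace Y] [BorelSpace Y]
  {ν : Measure Y} [IsProbabilityMeasure ν]

/-- Derivatives of the average over `y` of a smooth function along the orbits. -/
theorem contDiff_integral_comp_flow
    (hG : ContMDiff (𝓘(ℝ, V).prod 𝓘(ℝ, E)) 𝓘(ℝ, E) ∞ (fun p : V × Y => G p.1 p.2))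
    (hG_add : ∀ s t y, G (s + t) y = G s (G t y))
    {b : Y → ℝ} (hb : Continuous b) {M : ℝ} (hM : ∀ y, |b y| ≤ M) (k : ℕ) :
    ∀ {W : Type} [NormedAddCommGroup W] [NormedSpace ℝ W] {Φ : Y → W} {C : ℝ},
    ContMDiff 𝓘(ℝ, E) 𝓘(ℝ, W) ∞ Φ →
    (∀ j ≤ k, ∀ y t, ‖iteratedFDeriv ℝ j (fun s => Φ (G s y)) t‖ ≤ C) →
    ContDiff ℝ k (fun t => ∫ y, b y • Φ (G t y) ∂ν) ∧
      ∀ j ≤ k, ∀ t, ‖iteratedFDeriv ℝ j (fun t => ∫ y, b y • Φ (G t y) ∂ν) t‖ ≤ M * C := by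
  have hGc : ∀ t, Continuous (G t) := fun t => hG.continuous.comp (Continuous.prodMk_right t)
  have hmeas : ∀ {W : Type} [NormedAddCommGroup W] [NormedSpace ℝ W] {Φ : Y → W},
      Continuous Φ → ∀ t, AEStronglyMeasurable (fun y => b y • Φ (G t y)) ν := by
    intro W _ _ Φ hΦ t
    exact (hb.smul (hΦ.comp (hGc t))).aestronglyMeasurable
  have hderiv : ∀ {W : Type} [NormedAddCommGroup W] [NormedSpace ℝ W] {Φ : Y → W}
      {Φ₁ : Y → (V →L[ℝ] W)}, ContMDiff 𝓘(ℝ, E) 𝓘(ℝ, W) ∞ Φ →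
      ContMDiff 𝓘(ℝ, E) 𝓘(ℝ, V →L[ℝ] W) ∞ Φ₁ →
      (∀ t y, HasFDerivAt (fun s => Φ (G s y)) (Φ₁ (G t y)) t) →
      ∀ t, HasFDerivAt (fun t => ∫ y, b y • Φ (G t y) ∂ν) (∫ y, b y • Φ₁ (G t y) ∂ν) t := by
    intro W _ _ Φ Φ₁ hΦ hΦ₁ hd t
    obtain ⟨C, hC⟩ := (isCompact_range hΦ.continuous.norm).bddAbove
    obtain ⟨C₁, hC₁⟩ := (isCompact_range hΦ₁.continuous.norm).bddAbove
    refine hasFDerivAt_integral_of_dominated_of_fderiv_le (bound := fun _ => M * C₁)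
      (F' := fun t y => b y • Φ₁ (G t y))
      (univ_mem) (Eventually.of_forall (hmeas hΦ.continuous)) ?_ (hmeas hΦ₁.continuous t)
      (ae_of_all _ fun y s _ => ?_) (integrable_const _) (ae_of_all _ fun y s _ => ?_)
    · refine Integrable.of_bound (hmeas hΦ.continuous t) (M * C) (ae_of_all _ fun y => ?_)
      rw [norm_smul]
      exact mul_le_mul (hM y) (hC ⟨_, rfl⟩) (norm_nonneg _) ((abs_nonneg _).trans (hM y))
    · rw [norm_smul]
      exact mul_le_mul (hM y) (hC₁ ⟨_, rfl⟩) (norm_nonneg _) ((abs_nonneg _).trans (hM y))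
    · exact (hd s y).const_smul (b y)
  have hzero : ∀ {W : Type} [NormedAddCommGroup W] [NormedSpace ℝ W] {Φ : Y → W} {C : ℝ},
      (∀ y t, ‖Φ (G t y)‖ ≤ C) → ∀ t, ‖∫ y, b y • Φ (G t y) ∂ν‖ ≤ M * C := by
    intro W _ _ Φ C hC t
    refine (norm_integral_le_of_norm_le_const (C := M * C) (ae_of_all _ fun y => ?_)).trans ?_
    · rw [norm_smul]
      exact mul_le_mul (hM y) (hC y t) (norm_nonneg _) ((abs_nonneg _).trans (hM y))
    · rw [probReal_univ, mul_one]
  induction k with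
  | zero =>
    intro W _ _ Φ C hΦ hC
    obtain ⟨Φ₁, hΦ₁, hd⟩ := exists_hasFDerivAt_comp_flow hG hG_add hΦ
    refine ⟨?_, fun j hj t => ?_⟩
    · rw [Nat.cast_zero, contDiff_zero]
      exact continuous_iff_continuousAt.2 fun t => (hderiv hΦ hΦ₁ hd t).continuousAt
    · obtain rfl : j = 0 := by omega
      rw [norm_iteratedFDeriv_zero]
      exact hzero (fun y t => by simpa using hC 0 le_rfl y t) t
  | succ k ih =>
    intro W _ _ Φ C hΦ hC
    obtain ⟨Φ₁, hΦ₁, hd⟩ := exists_hasFDerivAt_comp_flow hG hG_add hΦ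
    have hf : fderiv ℝ (fun t => ∫ y, b y • Φ (G t y) ∂ν) = fun t => ∫ y, b y • Φ₁ (G t y) ∂ν :=
      funext fun t => (hderiv hΦ hΦ₁ hd t).fderiv
    obtain ⟨hcd, hbd⟩ := ih hΦ₁ (C := C) (fun j hj y t => by
      have := hC (j + 1) (by omega) y t
      rwa [← norm_iteratedFDeriv_fderiv,
        show fderiv ℝ (fun s => Φ (G s y)) = fun s => Φ₁ (G s y) from
          funext fun s => (hd s y).fderiv] at this)
    refine ⟨?_, fun j hj t => ?_⟩
    · rw [Nat.cast_succ, contDiff_succ_iff_fderiv]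
      refine ⟨fun t => (hderiv hΦ hΦ₁ hd t).differentiableAt, by simp, ?_⟩
      rwa [hf]
    · rcases j with _ | j
      · rw [norm_iteratedFDeriv_zero]
        exact hzero (fun y t => by simpa using hC 0 (by omega) y t) t
      · rw [← norm_iteratedFDeriv_fderiv, hf]
        exact hbd j (by omega) t

end FlowDerivatives

section FiberCorrelationDerivatives

variable {d : ℕ} {E Y : Type*} [NormedAddCommGroup E] [NormedSpace ℝ E]
  [TopologicalSpace Y] [CompactSpace Y] [ChartedSpace E Y] [IsManifold 𝓘(ℝ, E) ∞ Y]
  [SecondCountableTopology Y] [MeasurableSpace Y] [BorelSpace Y]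
  {ν : Measure Y} [IsProbabilityMeasure ν] {G : EuclideanSpace ℝ (Fin d) → Y → Y}

/-- The derivatives of the fiber correlation of `b` with `θ · (F ∘ φ)` fall on the second function
only, so that `b` may be merely continuous. The constant does not depend on `b` or `F`. -/
theorem exists_norm_iteratedFDeriv_fiberCorrelation_le
    (hG : ContMDiff (𝓘(ℝ, EuclideanSpace ℝ (Fin d)).prod 𝓘(ℝ, E)) 𝓘(ℝ, E) ∞
      (fun p : EuclideanSpace ℝ (Fin d) × Y => G p.1 p.2))
    (hG_add : ∀ s t y, G (s + t) y = G s (G t y))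
    {W : Type} [NormedAddCommGroup W] [NormedSpace ℝ W] {θ : Y → ℝ} {φ : Y → W}
    (hθ : ContMDiff 𝓘(ℝ, E) 𝓘(ℝ, ℝ) ∞ θ) (hφ : ContMDiff 𝓘(ℝ, E) 𝓘(ℝ, W) ∞ φ) (k : ℕ) :
    ∃ C : ℝ, 0 ≤ C ∧ ∀ (F : W → ℝ) (B : ℝ), ContDiff ℝ ∞ F → 0 ≤ B →
      (∀ j ≤ k, ∀ u, ‖iteratedFDeriv ℝ j F u‖ ≤ B) → ∀ (b : Y → ℝ) (M : ℝ), Continuous b →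
      (∀ y, |b y| ≤ M) →
      ContDiff ℝ k (fiberCorrelation ν G b fun y => θ y * F (φ y)) ∧
        ∀ j ≤ k, ∀ t, ‖iteratedFDeriv ℝ j (fiberCorrelation ν G b fun y => θ y * F (φ y)) t‖ ≤
          M * (C * B) := by
  obtain ⟨A, hA1, hA⟩ := exists_norm_iteratedFDeriv_comp_flow_le hG hG_add k hθ
  obtain ⟨A', hA1', hA'⟩ := exists_norm_iteratedFDeriv_comp_flow_le hG hG_add k hφ
  set A₀ := max A A' with hA₀
  have hsl : ∀ {W' : Type} [NormedAddCommGroup W'] [NormedSpace ℝ W'] {Φ : Y → W'},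
      ContMDiff 𝓘(ℝ, E) 𝓘(ℝ, W') ∞ Φ → ∀ y, ContDiff ℝ k (fun s => Φ (G s y)) := by
    intro W' _ _ Φ hΦ y
    rw [← contMDiff_iff_contDiff]
    exact ((hΦ.comp hG).comp (contMDiff_id.prodMk contMDiff_const)).of_le
      (by exact_mod_cast le_top)
  refine ⟨2 ^ k * k.factorial * A₀ ^ (k + 1), ?_, fun F B hF hB hFB b M hb hM => ?_⟩
  · have : 0 ≤ A₀ := by linarith [le_max_left A A']
    positivity
  exact contDiff_integral_comp_flow hG hG_add hb hM k (W := ℝ)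
    (Φ := fun y => θ y * F (φ y)) (hθ.mul (hF.contMDiff.comp hφ)) fun j hj y t =>
      norm_iteratedFDeriv_mul_comp_le (U := Set.univ) (T := Set.univ) isOpen_univ isOpen_univ
        (hsl hθ y).contDiffOn (hsl hφ y).contDiffOn
        (hF.of_le (by exact_mod_cast le_top)).contDiffOn (Set.mapsTo_univ _ _) (Set.mem_univ t)
        (hA1.trans (le_max_left _ _)) hB
        (fun i hi => (hA i hi y t).trans (le_max_left _ _))
        (fun i hi => (hA' i hi y t).trans (le_max_right _ _)) (fun i hi => hFB i hi _) hj

end FiberCorrelationDerivatives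

/-! ### Expansion into plane waves -/

section Expansion

open scoped FourierTransform

variable {ι : Type} [Fintype ι]

/-- The frequency `2 π l` of the plane waves that are periodic under integer translations. -/
def freq (l : ι → ℤ) : EuclideanSpace ℝ ι := WithLp.toLp 2 fun i => 2 * Real.pi * (l i : ℝ)

/-- The characters of the torus, lifted to `ℝ^ι`, are the exponentials of integer frequency. -/
theorem fourier_prod_coe (l : ι → ℤ) (x : ι → ℝ) :
    UnitAddTorus.mFourier l (fun i => (x i : UnitAddCircle)) =
      Complex.exp ((inner ℝ (freq l) (WithLp.toLp 2 x) : ℝ) * Complex.I) := by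
  have h : ∀ i, fourier (l i) (x i : UnitAddCircle) =
      Complex.exp (2 * Real.pi * (l i : ℝ) * (x i : ℝ) * Complex.I) := by
    intro i
    rw [fourier_coe_apply]
    congr 1
    push_cast
    ring
  simp only [UnitAddTorus.mFourier, ContinuousMap.coe_mk, h]
  rw [← Complex.exp_sum, PiLp.inner_apply]
  congr 1
  push_cast
  rw [Finset.sum_mul]
  refine Finset.sum_congr rfl fun i _ => ?_
  simp [freq]
  ring

/-- The representative in `(-1/2, 1/2]` of a point of the circle. -/
def circleRep (z : UnitAddCircle) : ℝ := (AddCircle.equivIoc (1 : ℝ) (-(1 / 2)) z : ℝ)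

theorem coe_circleRep (z : UnitAddCircle) : ((circleRep z : ℝ) : UnitAddCircle) = z :=
  AddCircle.coe_equivIoc

theorem norm_eq_abs_circleRep (z : UnitAddCircle) : ‖z‖ = |circleRep z| := by
  have h := (AddCircle.equivIoc (1 : ℝ) (-(1 / 2)) z).2
  have : |circleRep z| ≤ |(1 : ℝ)| / 2 := by
    rw [abs_one, abs_le]
    constructor
    · exact h.1.le
    · have := h.2; unfold circleRep; linarith
  rw [← (AddCircle.norm_coe_eq_abs_iff 1 one_ne_zero).2 this]
  exact congrArg _ (coe_circleRep z).symm

theorem circleRep_coe {t : ℝ} (ht : |t| < 1 / 2) : circleRep (t : UnitAddCircle) = t := by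
  rw [abs_lt] at ht
  have : t ∈ Set.Ioc (-(1 / 2) : ℝ) (-(1 / 2) + 1) := ⟨ht.1, by linarith [ht.2]⟩
  unfold circleRep
  rw [AddCircle.equivIoc_coe_eq this]

theorem continuousAt_circleRep {z : UnitAddCircle} (hz : ‖z‖ < 1 / 2) :
    ContinuousAt circleRep z := by
  have : z ≠ ((-(1 / 2) : ℝ) : UnitAddCircle) := by
    rintro rfl
    rw [(AddCircle.norm_coe_eq_abs_iff 1 one_ne_zero).2 (by norm_num [abs_of_pos])] at hz
    norm_num [abs_of_pos] at hz
  exact continuous_subtype_val.continuousAt.comp (AddCircle.continuousAt_equivIoc _ _ this)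

/-- A function on `ℝ^ι` supported near the origin, viewed on the torus by means of the cube
`(-1/2, 1/2]^ι`, near whose boundary it vanishes. -/
def torusFunction {F : EuclideanSpace ℝ ι → ℝ} (hF : Continuous F)
    (hs : ∀ u, 1 / 4 < ‖u‖ → F u = 0) : C(UnitAddTorus ι, ℂ) where
  toFun x := F (WithLp.toLp 2 fun i => circleRep (x i))
  continuous_toFun := by
    refine Complex.continuous_ofReal.comp (continuous_iff_continuousAt.2 fun x => ?_)
    by_cases hx : ∀ i, ‖x i‖ < 1 / 2
    · refine hF.continuousAt.comp ((PiLp.continuous_toLp 2 _).continuousAt.comp ?_)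
      exact continuousAt_pi.2 fun i => ContinuousAt.comp
        (f := fun x : UnitAddTorus ι => x i) (continuousAt_circleRep (hx i))
        (continuous_apply i).continuousAt
    · push Not at hx
      obtain ⟨i, hi⟩ := hx
      refine (continuousAt_const (y := (0 : ℝ))).congr ?_
      have hopen : IsOpen {x : UnitAddTorus ι | 1 / 4 < ‖x i‖} :=
        isOpen_lt continuous_const (continuous_apply i).norm
      filter_upwards [hopen.mem_nhds (show 1 / 4 < ‖x i‖ by linarith)] with z hz
      refine (hs _ ?_).symm
      refine lt_of_lt_of_le hz ?_
      rw [norm_eq_abs_circleRep]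
      exact PiLp.norm_apply_le (WithLp.toLp 2 fun i => circleRep (z i)) i

theorem torusFunction_coe {F : EuclideanSpace ℝ ι → ℝ} (hF : Continuous F)
    (hs : ∀ u, 1 / 4 < ‖u‖ → F u = 0) {u : EuclideanSpace ℝ ι} (hu : ‖u‖ < 1 / 2) :
    torusFunction hF hs (fun i => (u i : UnitAddCircle)) = F u := by
  have : (fun i => circleRep (u i : UnitAddCircle)) = u.ofLp :=
    funext fun i => circleRep_coe ((PiLp.norm_apply_le u i).trans_lt hu)
  simp [torusFunction, this]

/-- The Fourier coefficients of a function supported in the unit cube are the values of its Fourier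
transform at integer points. -/
theorem mFourierCoeff_torusFunction {F : EuclideanSpace ℝ ι → ℝ} (hF : Continuous F)
    (hs : ∀ u, 1 / 4 < ‖u‖ → F u = 0) (l : ι → ℤ) :
    UnitAddTorus.mFourierCoeff (torusFunction hF hs) l =
      𝓕 (fun u => (F u : ℂ)) (WithLp.toLp 2 fun i => (l i : ℝ)) := by
  rw [UnitAddTorus.mFourierCoeff_eq_integral _ _ (fun _ => -(1 / 2))]
  have h0 : ∀ x : ι → ℝ, x ∉ {x : ι → ℝ | ∀ i, x i ∈ Set.Ioc (-(1 / 2) : ℝ) (-(1 / 2) + 1)} →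
      F (WithLp.toLp 2 x) = 0 := by
    intro x hx
    simp only [Set.mem_ofPred_eq, not_forall] at hx
    obtain ⟨i, hi⟩ := hx
    refine hs _ (lt_of_lt_of_le ?_ (PiLp.norm_apply_le (WithLp.toLp 2 x) i))
    rw [Real.norm_eq_abs]
    by_contra hcon
    rw [not_lt, abs_le] at hcon
    simp only at hcon
    exact hi ⟨by linarith [hcon.1], by linarith [hcon.2]⟩
  have hm : MeasurableSet {x : ι → ℝ | ∀ i, x i ∈ Set.Ioc (-(1 / 2) : ℝ) (-(1 / 2) + 1)} :=
    MeasurableSet.univ_pi' fun i => measurableSet_Ioc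
  have h1 : ∀ x ∈ {x : ι → ℝ | ∀ i, x i ∈ Set.Ioc (-(1 / 2) : ℝ) (-(1 / 2) + 1)},
      UnitAddTorus.mFourier (-l) (fun i => (x i : UnitAddCircle)) •
        torusFunction hF hs (fun i => (x i : UnitAddCircle)) =
      Complex.exp ((inner ℝ (freq (-l)) (WithLp.toLp 2 x) : ℝ) * Complex.I) •
        (F (WithLp.toLp 2 x) : ℂ) := by
    intro x hx
    rw [fourier_prod_coe]
    congr 2
    have : (fun i => circleRep (x i : UnitAddCircle)) = x := by
      funext i
      unfold circleRep
      rw [AddCircle.equivIoc_coe_eq (hx i)]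
    simp [torusFunction, this]
  rw [setIntegral_congr_fun hm h1, setIntegral_eq_integral_of_forall_compl_eq_zero
    (fun x hx => by rw [h0 x hx]; simp)]
  rw [Real.fourier_eq', ← (PiLp.volume_preserving_toLp ι).integral_comp
    (MeasurableEquiv.toLp 2 (ι → ℝ)).measurableEmbedding]
  refine integral_congr_ae (ae_of_all _ fun x => ?_)
  simp only
  congr 3
  simp only [freq, PiLp.inner_apply, Pi.neg_apply]
  norm_cast
  rw [Finset.mul_sum]
  refine Finset.sum_congr rfl fun i _ => ?_
  simp
  ring

/-- Fourier coefficients of a smooth function supported near the origin decay rapidly. -/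
theorem exists_norm_fourier_le (ι : Type) [Fintype ι] (p : ℕ) :
    ∃ C : ℝ, 0 ≤ C ∧ ∀ (F : EuclideanSpace ℝ ι → ℝ) (B : ℝ), ContDiff ℝ p F →
      (∀ u, 1 / 4 < ‖u‖ → F u = 0) → (∀ j ≤ p, ∀ u, ‖iteratedFDeriv ℝ j F u‖ ≤ B) →
      ∀ l : ι → ℤ, (1 + ‖freq l‖) ^ p *
        ‖𝓕 (fun u => (F u : ℂ)) (WithLp.toLp 2 fun i => (l i : ℝ))‖ ≤ C * B := by
  set S : ℝ := volume.real (Metric.closedBall (0 : EuclideanSpace ℝ ι) (1 / 4)) with hS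
  have hS0 : 0 ≤ S := measureReal_nonneg
  refine ⟨2 ^ p * (1 + (2 * Real.pi) ^ p) * (2 ^ p * ((p + 1 : ℕ) * S)), by positivity,
    fun F B hF hs hB l => ?_⟩
  set w : EuclideanSpace ℝ ι := WithLp.toLp 2 fun i => (l i : ℝ) with hw
  have hfreq : ‖freq l‖ = 2 * Real.pi * ‖w‖ := by
    have : freq l = (2 * Real.pi) • w := rfl
    rw [this, norm_smul, Real.norm_of_nonneg (by positivity)]
  have hB0 : 0 ≤ B := (norm_nonneg _).trans (hB 0 (Nat.zero_le _) 0)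
  set Fc : EuclideanSpace ℝ ι → ℂ := fun u => (F u : ℂ) with hFc
  have hFcd : ContDiff ℝ ((p : ℕ∞) : WithTop ℕ∞) Fc := Complex.ofRealCLM.contDiff.comp hF
  have hnorm : ∀ j ≤ p, ∀ u, ‖iteratedFDeriv ℝ j Fc u‖ = ‖iteratedFDeriv ℝ j F u‖ := by
    intro j hj u
    exact Complex.ofRealLI.norm_iteratedFDeriv_comp_left hF.contDiffAt (by exact_mod_cast hj)
  have hvan : ∀ j : ℕ, ∀ u, 1 / 4 < ‖u‖ → ‖iteratedFDeriv ℝ j Fc u‖ = 0 := by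
    intro j u hu
    rw [norm_eq_zero]
    by_contra hne
    have h1 : u ∈ tsupport Fc := support_iteratedFDeriv_subset j (Function.mem_support.2 hne)
    have h2 : tsupport Fc ⊆ Metric.closedBall 0 (1 / 4) := by
      refine closure_minimal (fun v hv => ?_) Metric.isClosed_closedBall
      rw [mem_closedBall_zero_iff]
      by_contra hcon
      exact hv (by simp [hFc, hs v (not_le.1 hcon)])
    exact absurd (mem_closedBall_zero_iff.1 (h2 h1)) (not_le.2 hu)
  have hcont : ∀ n ≤ p, Continuous fun v => ‖iteratedFDeriv ℝ n Fc v‖ := fun n hn =>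
    (hFcd.continuous_iteratedFDeriv (by exact_mod_cast hn)).norm
  have key : ∀ n ≤ p, ‖w‖ ^ n * ‖𝓕 Fc w‖ ≤ 2 ^ p * ((p + 1 : ℕ) * S) * B := by
    intro n hn
    have h := Real.pow_mul_norm_iteratedFDeriv_fourier_le (K := 0) (N := (p : ℕ∞)) hFcd
      (fun k n hk hn => by
        obtain rfl : k = 0 := by exact_mod_cast nonpos_iff_eq_zero.1 hk
        have hn : n ≤ p := by exact_mod_cast hn
        simp only [pow_zero, one_mul]
        refine integrable_of_bound_of_support (hcont n hn) (A := B) (R := 1 / 4) (fun u => ?_)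
          (hvan n)
        rw [abs_norm, hnorm n hn]
        exact hB n hn u) (k := 0) (n := n) le_rfl (by exact_mod_cast hn) w
    rw [norm_iteratedFDeriv_zero] at h
    refine h.trans ?_
    have hsum : ∑ q ∈ Finset.range (0 + 1) ×ˢ Finset.range (n + 1),
        ∫ v, ‖v‖ ^ q.1 * ‖iteratedFDeriv ℝ q.2 Fc v‖ ≤
        ∑ q ∈ Finset.range (0 + 1) ×ˢ Finset.range (n + 1), B * S := by
      refine Finset.sum_le_sum fun q hq => ?_
      simp only [Finset.mem_product, Finset.mem_range] at hq
      obtain ⟨hq1, hq2⟩ := hq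
      have hq1 : q.1 = 0 := by omega
      have hq2 : q.2 ≤ p := by omega
      simp only [hq1, pow_zero, one_mul]
      refine (le_abs_self _).trans (abs_integral_le_of_bound_of_support (fun u => ?_) (hvan q.2))
      rw [abs_norm, hnorm _ hq2]
      exact hB _ hq2 u
    have hn' : (n : ℝ) ≤ p := by exact_mod_cast hn
    refine (mul_le_mul_of_nonneg_left hsum (by positivity)).trans ?_
    simp only [Finset.sum_const, Finset.card_product, Finset.card_range, nsmul_eq_mul]
    push_cast
    simp only [pow_zero, one_mul, mul_zero, zero_add]
    have h2 : (2 : ℝ) ^ n ≤ 2 ^ p := pow_le_pow_right₀ (by norm_num) hn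
    calc (2 : ℝ) ^ n * (((n : ℝ) + 1) * (B * S)) ≤ 2 ^ p * (((p : ℝ) + 1) * (B * S)) := by
          gcongr
      _ = _ := by ring
  have h0 := key 0 (Nat.zero_le _)
  have hp := key p le_rfl
  rw [pow_zero, one_mul] at h0
  have hpow : (1 + ‖freq l‖) ^ p ≤ 2 ^ p * (1 + (2 * Real.pi) ^ p * ‖w‖ ^ p) := by
    rw [hfreq]
    refine (add_pow_le zero_le_one (by positivity) p).trans ?_
    rw [one_pow, mul_pow]
    gcongr
    · norm_num
    · omega
  calc (1 + ‖freq l‖) ^ p * ‖𝓕 Fc w‖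
      ≤ 2 ^ p * (1 + (2 * Real.pi) ^ p * ‖w‖ ^ p) * ‖𝓕 Fc w‖ := by gcongr
    _ = 2 ^ p * (‖𝓕 Fc w‖ + (2 * Real.pi) ^ p * (‖w‖ ^ p * ‖𝓕 Fc w‖)) := by ring
    _ ≤ 2 ^ p * (2 ^ p * ((p + 1 : ℕ) * S) * B +
        (2 * Real.pi) ^ p * (2 ^ p * ((p + 1 : ℕ) * S) * B)) := by gcongr
    _ = _ := by ring

theorem exists_summable_freq (ι : Type) [Fintype ι] :
    ∃ p : ℕ, Summable fun l : ι → ℤ => ((1 + ‖freq l‖) ^ p)⁻¹ := by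
  classical
  have h1 : Summable fun n : ℤ => ((1 + |(n : ℝ)|) ^ 2)⁻¹ := by
    have hz : Summable fun n : ℤ => 1 / |(n : ℝ)| ^ 2 := by
      simpa using Real.summable_one_div_int_pow.2 one_lt_two
    refine Summable.of_norm_bounded_eventually hz ?_
    rw [Filter.eventually_cofinite]
    refine (Set.finite_singleton (0 : ℤ)).subset fun n hn => ?_
    by_contra hne
    refine hn ?_
    have : 0 < |(n : ℝ)| := abs_pos.2 (by exact_mod_cast hne)
    rw [Real.norm_of_nonneg (by positivity), one_div]
    gcongr
    linarith
  refine ⟨2 * Fintype.card ι, ?_⟩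
  refine Summable.of_nonneg_of_le (f := fun l : ι → ℤ => ∏ i, ((1 + |(l i : ℝ)|) ^ 2)⁻¹)
    (fun l => by positivity) (fun l => ?_) ?_
  · rw [Finset.prod_inv_distrib]
    refine inv_anti₀ (Finset.prod_pos fun i _ => by positivity) ?_
    rw [pow_mul]
    refine (Finset.prod_le_prod (g := fun _ => (1 + ‖freq l‖) ^ 2) (fun i _ => by positivity)
      fun i _ => ?_).trans_eq (by rw [Finset.prod_const, Finset.card_univ])
    have h2 : |(l i : ℝ)| ≤ ‖freq l‖ := by
      refine le_trans ?_ (PiLp.norm_apply_le (freq l) i)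
      simp only [freq, norm_mul, Real.norm_eq_abs]
      rw [abs_of_pos (by norm_num : (0 : ℝ) < 2), abs_of_pos Real.pi_pos]
      have := Real.pi_gt_three
      nlinarith [abs_nonneg (l i : ℝ)]
    gcongr
  · refine summable_of_sum_le (c := ∏ _i : ι, ∑' n : ℤ, ((1 + |(n : ℝ)|) ^ 2)⁻¹)
      (fun l => Finset.prod_nonneg fun i _ => by positivity) fun s => ?_
    have hsub : s ⊆ Fintype.piFinset fun i => s.image fun l => l i := fun l hl => by
      rw [Fintype.mem_piFinset]
      exact fun i => Finset.mem_image_of_mem _ hl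
    refine (Finset.sum_le_sum_of_subset_of_nonneg hsub
      fun l _ _ => Finset.prod_nonneg fun i _ => by positivity).trans ?_
    rw [← Finset.prod_univ_sum (fun i => s.image fun l => l i)
      (fun _ (n : ℤ) => ((1 + |(n : ℝ)|) ^ 2)⁻¹)]
    exact Finset.prod_le_prod (fun i _ => Finset.sum_nonneg fun n _ => by positivity)
      fun i _ => h1.sum_le_tsum _ fun n _ => by positivity

/-- The phases of cosine and of minus sine. -/
def phase (b : Bool) : ℝ := if b then Real.pi / 2 else 0

/-- The real plane waves of integer frequency: `cos ⟨2 π l, u⟩` and `- sin ⟨2 π l, u⟩`. -/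
def wave (i : (ι → ℤ) × Bool) : EuclideanSpace ℝ ι → ℝ := planeWave (freq i.1) (phase i.2)

/-- The size of the frequency of a plane wave. -/
def weight (i : (ι → ℤ) × Bool) : ℝ := 1 + ‖freq i.1‖

theorem one_le_weight (i : (ι → ℤ) × Bool) : 1 ≤ weight i :=
  le_add_of_nonneg_right (norm_nonneg _)

theorem weight_pos (i : (ι → ℤ) × Bool) : 0 < weight i := zero_lt_one.trans_le (one_le_weight i)

theorem exists_summable_weight (ι : Type) [Fintype ι] :
    ∃ p : ℕ, Summable fun i : (ι → ℤ) × Bool => (weight i ^ p)⁻¹ := by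
  obtain ⟨p, hp⟩ := exists_summable_freq ι
  refine ⟨p, ?_⟩
  have := hp.mul_of_nonneg (g := fun _ : Bool => (1 : ℝ)) (Summable.of_finite)
    (fun l => by positivity) (fun _ => zero_le_one)
  simpa [weight] using this

/-- Fourier inversion in real form for a function supported near the origin. -/
theorem hasSum_planeWave {F : EuclideanSpace ℝ ι → ℝ} (hF : Continuous F)
    (hs : ∀ u, 1 / 4 < ‖u‖ → F u = 0)
    (hsum : Summable fun l : ι → ℤ =>
      𝓕 (fun u => (F u : ℂ)) (WithLp.toLp 2 fun i => (l i : ℝ)))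
    {u : EuclideanSpace ℝ ι} (hu : ‖u‖ < 1 / 2) :
    HasSum (fun l : ι → ℤ =>
      (𝓕 (fun u => (F u : ℂ)) (WithLp.toLp 2 fun i => (l i : ℝ))).re *
        Real.cos (inner ℝ (freq l) u) -
      (𝓕 (fun u => (F u : ℂ)) (WithLp.toLp 2 fun i => (l i : ℝ))).im *
        Real.sin (inner ℝ (freq l) u)) (F u) := by
  have h1 : Summable (UnitAddTorus.mFourierCoeff (torusFunction hF hs)) := by
    simpa only [← mFourierCoeff_torusFunction hF hs] using hsum
  have h2 := Complex.reCLM.hasSum (UnitAddTorus.hasSum_mFourier_series_apply_of_summable h1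
    fun i => (u i : UnitAddCircle))
  rw [torusFunction_coe hF hs hu] at h2
  refine (h2.congr_fun fun l => ?_)
  rw [mFourierCoeff_torusFunction hF hs, fourier_prod_coe]
  simp only [smul_eq_mul, Complex.reCLM_apply, Complex.mul_re, Complex.exp_ofReal_mul_I_re,
    Complex.exp_ofReal_mul_I_im, WithLp.toLp_ofLp]

variable {ι₁ ι₂ : Type} [Fintype ι₁] [Fintype ι₂]

/-- The two blocks of coordinates of a vector. -/
def splitCoordinates (ι₁ ι₂ : Type) [Fintype ι₁] [Fintype ι₂] :
    EuclideanSpace ℝ (ι₁ ⊕ ι₂) →L[ℝ] EuclideanSpace ℝ ι₁ × EuclideanSpace ℝ ι₂ :=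
  LinearMap.toContinuousLinearMap
    { toFun := fun z => (WithLp.toLp 2 fun i => z (Sum.inl i), WithLp.toLp 2 fun i => z (Sum.inr i))
      map_add' := fun _ _ => rfl
      map_smul' := fun _ _ => rfl }

theorem splitCoordinates_apply (z : EuclideanSpace ℝ (ι₁ ⊕ ι₂)) :
    splitCoordinates ι₁ ι₂ z =
      (WithLp.toLp 2 fun i => z (Sum.inl i), WithLp.toLp 2 fun i => z (Sum.inr i)) := rfl

theorem norm_le_add_norm_splitCoordinates (z : EuclideanSpace ℝ (ι₁ ⊕ ι₂)) :
    ‖z‖ ≤ ‖(splitCoordinates ι₁ ι₂ z).1‖ + ‖(splitCoordinates ι₁ ι₂ z).2‖ := by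
  have h : ‖z‖ ^ 2 = ‖(splitCoordinates ι₁ ι₂ z).1‖ ^ 2 + ‖(splitCoordinates ι₁ ι₂ z).2‖ ^ 2 := by
    simp [EuclideanSpace.norm_sq_eq, splitCoordinates_apply]
  refine le_of_sq_le_sq ?_ (by positivity)
  nlinarith [norm_nonneg (splitCoordinates ι₁ ι₂ z).1, norm_nonneg (splitCoordinates ι₁ ι₂ z).2]

theorem norm_inl_le_norm (z : EuclideanSpace ℝ (ι₁ ⊕ ι₂)) :
    ‖(splitCoordinates ι₁ ι₂ z).1‖ ≤ ‖z‖ ∧ ‖(splitCoordinates ι₁ ι₂ z).2‖ ≤ ‖z‖ := by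
  have h : ‖z‖ ^ 2 = ‖(splitCoordinates ι₁ ι₂ z).1‖ ^ 2 + ‖(splitCoordinates ι₁ ι₂ z).2‖ ^ 2 := by
    simp [EuclideanSpace.norm_sq_eq, splitCoordinates_apply]
  constructor <;> refine le_of_sq_le_sq ?_ (norm_nonneg _) <;> rw [h] <;> simp

theorem norm_iteratedFDeriv_comp_linear_le {V V' : Type*} [NormedAddCommGroup V]
    [NormedSpace ℝ V] [NormedAddCommGroup V'] [NormedSpace ℝ V'] (J : V →L[ℝ] V') {F : V' → ℝ}
    {k : ℕ} {B : ℝ} (hF : ContDiff ℝ k F) (hB : ∀ j ≤ k, ∀ u, ‖iteratedFDeriv ℝ j F u‖ ≤ B)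
    {j : ℕ} (hj : j ≤ k) (z : V) : ‖iteratedFDeriv ℝ j (F ∘ J) z‖ ≤ (1 + ‖J‖) ^ k * B := by
  rw [J.iteratedFDeriv_comp_right hF z (by exact_mod_cast hj)]
  refine (ContinuousMultilinearMap.norm_compContinuousLinearMap_le _ _).trans ?_
  rw [Finset.prod_const, Finset.card_univ, Fintype.card_fin, mul_comm]
  have h1 : ‖J‖ ^ j ≤ (1 + ‖J‖) ^ k :=
    (pow_le_pow_left₀ (norm_nonneg _) (by linarith) j).trans
      (pow_le_pow_right₀ (by linarith [norm_nonneg J]) hj)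
  have h2 := hB j hj (J z)
  gcongr

/-- The coefficients of the products of waves in the expansion of a wave in two blocks of
variables, from the addition formulas for cosine and sine. -/
def blockCoefficient (c : ℂ) : Bool × Bool → ℝ
  | (false, false) => c.re
  | (true, true) => -c.re
  | (true, false) => c.im
  | (false, true) => c.im

theorem abs_blockCoefficient_le (c : ℂ) (b : Bool × Bool) : |blockCoefficient c b| ≤ ‖c‖ := by
  have h1 := Complex.abs_re_le_norm c
  have h2 := Complex.abs_im_le_norm c
  rcases b with ⟨_ | _, _ | _⟩ <;> simpa [blockCoefficient]

/-- A smooth function of two groups of variables, supported near the origin, is the sum of a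
rapidly convergent series of products of plane waves. -/
theorem exists_wave_expansion (ι₁ ι₂ : Type) [Fintype ι₁] [Fintype ι₂] (p : ℕ) :
    ∃ (K : ℕ) (C : ℝ), 0 ≤ C ∧ ∀ (F : EuclideanSpace ℝ ι₁ × EuclideanSpace ℝ ι₂ → ℝ) (B : ℝ),
      ContDiff ℝ K F → (∀ u, 1 / 8 < ‖u‖ → F u = 0) →
      (∀ j ≤ K, ∀ u, ‖iteratedFDeriv ℝ j F u‖ ≤ B) →
      ∃ c : ((ι₁ → ℤ) × Bool) × ((ι₂ → ℤ) × Bool) → ℝ,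
        (∀ q, |c q| * (weight q.1 * weight q.2) ^ p ≤ C * B) ∧
        ∀ u : EuclideanSpace ℝ ι₁ × EuclideanSpace ℝ ι₂, ‖u‖ < 1 / 4 →
          HasSum (fun q => c q * (wave q.1 u.1 * wave q.2 u.2)) (F u) := by
  obtain ⟨p₁, hp₁⟩ := exists_summable_weight ι₁
  obtain ⟨p₂, hp₂⟩ := exists_summable_weight ι₂
  -- The product of the two weights is at most the square of the size of the joint frequency, which
  -- is why `2 P` derivatives are needed; `p₁` and `p₂` powers are spent on summability.
  set P := p + p₁ + p₂ with hP
  obtain ⟨C, hC, hdecay⟩ := exists_norm_fourier_le (ι₁ ⊕ ι₂) (P + P)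
  set J := splitCoordinates ι₁ ι₂ with hJ
  refine ⟨P + P, C * (1 + ‖J‖) ^ (P + P), by positivity, fun F B hF hs hB => ?_⟩
  have hB0 : 0 ≤ B := (norm_nonneg _).trans (hB 0 (Nat.zero_le _) 0)
  have hFJ : ContDiff ℝ (P + P : ℕ) (F ∘ J) := hF.comp J.contDiff
  have hFs : ∀ z, 1 / 4 < ‖z‖ → (F ∘ J) z = 0 := by
    intro z hz
    refine hs _ ?_
    have := norm_le_add_norm_splitCoordinates z
    rw [Prod.norm_def, lt_max_iff]
    by_contra! hcon
    linarith [hcon.1, hcon.2]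
  have hFB : ∀ j ≤ P + P, ∀ z, ‖iteratedFDeriv ℝ j (F ∘ J) z‖ ≤ (1 + ‖J‖) ^ (P + P) * B := by
    exact fun j hj z => norm_iteratedFDeriv_comp_linear_le J hF hB hj z
  set a : (ι₁ → ℤ) × (ι₂ → ℤ) → ℂ := fun l =>
    𝓕 (fun z => ((F ∘ J) z : ℂ)) (WithLp.toLp 2 fun i => ((Sum.elim l.1 l.2 i : ℤ) : ℝ)) with ha
  have hsplit : ∀ l : (ι₁ → ℤ) × (ι₂ → ℤ), J (freq (Sum.elim l.1 l.2)) = (freq l.1, freq l.2) :=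
    fun l => rfl
  have hB' := fun l : (ι₁ → ℤ) × (ι₂ → ℤ) =>
    hdecay (F ∘ J) _ hFJ hFs hFB (Sum.elim l.1 l.2 : ι₁ ⊕ ι₂ → ℤ)
  set c : ((ι₁ → ℤ) × Bool) × ((ι₂ → ℤ) × Bool) → ℝ := fun q =>
    blockCoefficient (a (q.1.1, q.2.1)) (q.1.2, q.2.2) with hc
  have hcP : ∀ q, |c q| * (weight q.1 * weight q.2) ^ P ≤ C * (1 + ‖J‖) ^ (P + P) * B := by
    intro q
    have hw : weight q.1 * weight q.2 ≤
        (1 + ‖freq (Sum.elim q.1.1 q.2.1)‖) * (1 + ‖freq (Sum.elim q.1.1 q.2.1)‖) := by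
      have h := norm_inl_le_norm (freq (Sum.elim q.1.1 q.2.1))
      rw [← hJ, hsplit (q.1.1, q.2.1)] at h
      have h1 := h.1
      have h2 := h.2
      simp only at h1 h2
      unfold weight
      gcongr
    calc |c q| * (weight q.1 * weight q.2) ^ P
        ≤ ‖a (q.1.1, q.2.1)‖ * ((1 + ‖freq (Sum.elim q.1.1 q.2.1)‖) *
          (1 + ‖freq (Sum.elim q.1.1 q.2.1)‖)) ^ P := by
          have := (weight_pos q.1).le
          have := (weight_pos q.2).le
          exact mul_le_mul (abs_blockCoefficient_le _ _) (pow_le_pow_left₀ (by positivity) hw _)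
            (by positivity) (norm_nonneg _)
      _ = (1 + ‖freq (Sum.elim q.1.1 q.2.1)‖) ^ (P + P) * ‖a (q.1.1, q.2.1)‖ := by
          rw [mul_pow, ← pow_add, mul_comm]
      _ ≤ C * ((1 + ‖J‖) ^ (P + P) * B) := hB' (q.1.1, q.2.1)
      _ = _ := by ring
  set Q := C * (1 + ‖J‖) ^ (P + P) * B with hQ
  have hQ0 : 0 ≤ Q := by positivity
  -- summability of the coefficients
  have hcs : Summable fun q => |c q| := by
    refine Summable.of_nonneg_of_le (fun q => abs_nonneg _) (fun q => ?_)
      ((hp₁.mul_of_nonneg hp₂ (fun i => by have := weight_pos i; positivity)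
        (fun i => by have := weight_pos i; positivity)).mul_left Q)
    have h1 := one_le_weight q.1
    have h2 := one_le_weight q.2
    have hle : weight q.1 ^ p₁ * weight q.2 ^ p₂ ≤ (weight q.1 * weight q.2) ^ P := by
      rw [mul_pow]
      gcongr <;> first | assumption | omega
    have h3 := hcP q
    have hpos : 0 < weight q.1 ^ p₁ * weight q.2 ^ p₂ := by positivity
    rw [← mul_inv, ← div_eq_mul_inv, le_div_iff₀ hpos]
    exact (mul_le_mul_of_nonneg_left hle (abs_nonneg _)).trans h3
  have has : Summable fun l : (ι₁ ⊕ ι₂) → ℤ =>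
      𝓕 (fun z => ((F ∘ J) z : ℂ)) (WithLp.toLp 2 fun i => (l i : ℝ)) := by
    rw [← (Equiv.sumArrowEquivProdArrow ι₁ ι₂ ℤ).symm.summable_iff]
    have hsub : ∀ b : Bool × Bool, Summable fun l : (ι₁ → ℤ) × (ι₂ → ℤ) =>
        |c ((l.1, b.1), (l.2, b.2))| := fun b => hcs.comp_injective
          (i := fun l : (ι₁ → ℤ) × (ι₂ → ℤ) => ((l.1, b.1), (l.2, b.2))) (by
            rintro ⟨l, l'⟩ ⟨m, m'⟩ h
            simp only [Prod.mk.injEq, and_true] at h ⊢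
            exact h)
    refine Summable.of_norm_bounded ((hsub (false, false)).add (hsub (true, false))) fun l => ?_
    exact Complex.norm_le_abs_re_add_abs_im _
  refine ⟨c, fun q => ?_, fun u hu => ?_⟩
  · refine (mul_le_mul_of_nonneg_left ?_ (abs_nonneg _)).trans (hcP q)
    exact pow_le_pow_right₀ (one_le_mul_of_one_le_of_one_le (one_le_weight _) (one_le_weight _))
      (by omega)
  · set z : EuclideanSpace ℝ (ι₁ ⊕ ι₂) := WithLp.toLp 2 (Sum.elim u.1 u.2) with hz
    have hJz : J z = u := rfl
    have hznorm : ‖z‖ < 1 / 2 := by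
      refine (norm_le_add_norm_splitCoordinates z).trans_lt ?_
      rw [← hJ, hJz]
      have h1 := (norm_fst_le u).trans_lt hu
      have h2 := (norm_snd_le u).trans_lt hu
      linarith
    have hmain := hasSum_planeWave hFJ.continuous hFs has hznorm
    rw [← (Equiv.sumArrowEquivProdArrow ι₁ ι₂ ℤ).symm.hasSum_iff] at hmain
    set g : ((ι₁ → ℤ) × Bool) × ((ι₂ → ℤ) × Bool) → ℝ := fun q =>
      c q * (wave q.1 u.1 * wave q.2 u.2) with hg
    have hgs : Summable g := by
      refine Summable.of_norm_bounded hcs fun q => ?_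
      rw [hg, Real.norm_eq_abs, abs_mul, abs_mul]
      have h1 : |wave q.1 u.1| ≤ 1 := abs_planeWave_le _ _ _
      have h2 : |wave q.2 u.2| ≤ 1 := abs_planeWave_le _ _ _
      exact mul_le_of_le_one_right (abs_nonneg _) (mul_le_one₀ h1 (abs_nonneg _) h2)
    have hgs' := hgs.hasSum
    rw [← (Equiv.prodProdProdComm (ι₁ → ℤ) (ι₂ → ℤ) Bool Bool).hasSum_iff] at hgs'
    have hfib := hgs'.prod_fiberwise (g := fun l => ∑ b : Bool × Bool,
      (g ∘ (Equiv.prodProdProdComm (ι₁ → ℤ) (ι₂ → ℤ) Bool Bool)) (l, b))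
      fun l => hasSum_fintype _
    have heq : (∑' q, g q) = (F ∘ J) z := by
      refine hfib.unique (hmain.congr_fun fun l => ?_)
      have hin : inner ℝ (freq (Sum.elim l.1 l.2)) z =
          inner ℝ (freq l.1) u.1 + inner ℝ (freq l.2) u.2 := by
        simp [PiLp.inner_apply, freq, hz]
      simp only [Function.comp_apply, Fintype.sum_prod_type, Fintype.univ_bool,
        Finset.mem_singleton, Bool.true_eq_false, not_false_eq_true, Finset.sum_insert,
        Finset.sum_singleton, Equiv.prodProdProdComm_apply, hg, hc, blockCoefficient, wave,
        planeWave, phase, if_true, Bool.false_eq_true, if_false, add_zero,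
        Real.cos_add_pi_div_two]
      have e : (Equiv.sumArrowEquivProdArrow ι₁ ι₂ ℤ).symm l = Sum.elim l.1 l.2 := rfl
      rw [e, hin, Real.cos_add, Real.sin_add]
      simp only [ha, Function.comp_apply]
      ring
    rw [Function.comp_apply, hJz] at heq
    rw [← heq]
    exact hgs.hasSum

end Expansion

/-! ### Wave expansions on a product of manifolds -/

/-- A finite smooth partition of unity `χ` on `M`, subordinate to charts, together with smooth
functions `g` equal to one on the support of `χ` and supported in the same charts, and linear
changes of variables `L` that bring the charts near the origin. -/
structure WaveAtlas (E : Type*) [NormedAddCommGroup E] [NormedSpace ℝ E] (M : Type*)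
    [TopologicalSpace M] [ChartedSpace E M] where
  centers : Finset M
  χ : M → M → ℝ
  g : M → M → ℝ
  L : M → (E ≃L[ℝ] EuclideanSpace ℝ (Fin (Module.finrank ℝ E)))
  contMDiff_χ : ∀ c, ContMDiff 𝓘(ℝ, E) 𝓘(ℝ, ℝ) ∞ (χ c)
  contMDiff_g : ∀ c, ContMDiff 𝓘(ℝ, E) 𝓘(ℝ, ℝ) ∞ (g c)
  sum_χ : ∀ p, ∑ c ∈ centers, χ c p = 1
  tsupport_g : ∀ c, tsupport (g c) ⊆ (chartAt E c).source
  g_eq_one : ∀ c p, χ c p ≠ 0 → g c p = 1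
  norm_le : ∀ c, ∀ p ∈ tsupport (g c), ‖L c (extChartAt 𝓘(ℝ, E) c p)‖ ≤ 1 / 8

section Atlas

variable {E : Type*} [NormedAddCommGroup E] [NormedSpace ℝ E]
  {M : Type*} [TopologicalSpace M] [CompactSpace M] [T2Space M] [ChartedSpace E M]
  [IsManifold 𝓘(ℝ, E) ∞ M]

theorem WaveAtlas.nonempty (E : Type*) [NormedAddCommGroup E] [NormedSpace ℝ E]
    [FiniteDimensional ℝ E] (M : Type*) [TopologicalSpace M] [CompactSpace M] [T2Space M]
    [ChartedSpace E M] [IsManifold 𝓘(ℝ, E) ∞ M] : Nonempty (WaveAtlas E M) := by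
  obtain ⟨f, hf⟩ := SmoothPartitionOfUnity.exists_isSubordinate_chartAt_source 𝓘(ℝ, E) M
  have hfin : {c | (Function.support (f c)).Nonempty}.Finite :=
    f.locallyFinite.finite_nonempty_of_compact
  have hg : ∀ c : M, ∃ g : M → ℝ, ContMDiff 𝓘(ℝ, E) 𝓘(ℝ, ℝ) ∞ g ∧
      tsupport g ⊆ (chartAt E c).source ∧ ∀ p, f c p ≠ 0 → g p = 1 := by
    intro c
    obtain ⟨g, h0, h1, -⟩ := exists_contMDiffMap_zero_one_nhds_of_isClosed 𝓘(ℝ, E) (n := ⊤)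
      (chartAt E c).open_source.isClosed_compl (isClosed_tsupport (f c))
      (Set.disjoint_left.2 fun x hx hx' => hx (hf c hx'))
    refine ⟨g, g.contMDiff, fun x hx => ?_, fun p hp => ?_⟩
    · by_contra hcon
      refine (notMem_tsupport_iff_eventuallyEq.2 ?_) hx
      exact (eventually_nhdsSet_iff_forall.1 h0) x hcon
    · exact ((eventually_nhdsSet_iff_forall.1 h1) p (subset_tsupport _ hp)).self_of_nhds
  choose g hgs hgc hg1 using hg
  have e : E ≃L[ℝ] EuclideanSpace ℝ (Fin (Module.finrank ℝ E)) :=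
    ContinuousLinearEquiv.ofFinrankEq (by simp)
  have hL : ∀ c : M, ∃ L : E ≃L[ℝ] EuclideanSpace ℝ (Fin (Module.finrank ℝ E)),
      ∀ p ∈ tsupport (g c), ‖L (extChartAt 𝓘(ℝ, E) c p)‖ ≤ 1 / 8 := by
    intro c
    obtain ⟨R, hR⟩ := ((isCompact_image_tsupport 𝓘(ℝ, E) (hgc c)).image
      e.continuous.norm).bddAbove
    set R' := max R 1 with hR'
    have hR'0 : 0 < R' := zero_lt_one.trans_le (le_max_right _ _)
    refine ⟨e.trans (ContinuousLinearEquiv.smulLeft (Units.mk0 (8 * R')⁻¹ (by positivity))),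
      fun p hp => ?_⟩
    have h1 : ‖e (extChartAt 𝓘(ℝ, E) c p)‖ ≤ R' :=
      (hR ⟨_, ⟨p, hp, rfl⟩, rfl⟩).trans (le_max_left _ _)
    change ‖(8 * R')⁻¹ • e (extChartAt 𝓘(ℝ, E) c p)‖ ≤ 1 / 8
    rw [norm_smul, Real.norm_of_nonneg (by positivity), inv_mul_le_iff₀ (by positivity)]
    linarith
  choose L hL using hL
  refine ⟨⟨hfin.toFinset, fun c => f c, g, L, fun c => (f c).contMDiff, hgs, fun p => ?_, hgc,
    hg1, hL⟩⟩
  rw [← f.sum_eq_one (Set.mem_univ p)]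
  refine (finsum_eq_sum_of_support_subset _ fun c hc => ?_).symm
  simp only [Set.Finite.coe_toFinset]
  exact ⟨p, hc⟩

namespace WaveAtlas

variable (𝒜 : WaveAtlas E M)

/-- The coordinates in a chart, cut off so as to be smooth on the whole manifold. -/
def coord (c p : M) : EuclideanSpace ℝ (Fin (Module.finrank ℝ E)) :=
  𝒜.g c p • 𝒜.L c (extChartAt 𝓘(ℝ, E) c p)

omit [CompactSpace M] [T2Space M] in
theorem contMDiff_coord (c : M) :
    ContMDiff 𝓘(ℝ, E) 𝓘(ℝ, EuclideanSpace ℝ (Fin (Module.finrank ℝ E))) ∞ (𝒜.coord c) := by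
  refine contMDiff_of_tsupport fun p hp => ?_
  have hp' : p ∈ (chartAt E c).source := 𝒜.tsupport_g c (tsupport_smul_subset_left _ _ hp)
  exact (𝒜.contMDiff_g c).contMDiffAt.smul
    ((𝒜.L c).contDiff.contMDiff.contMDiffAt.comp p (contMDiffAt_extChartAt' hp'))

/-- The indices of the atoms: a chart, an integer frequency and a phase. -/
abbrev Index : Type _ :=
  {c // c ∈ 𝒜.centers} × ((Fin (Module.finrank ℝ E) → ℤ) × Bool)

/-- The atoms: a plane wave in a chart, times a function of the partition of unity. -/
def atom (i : 𝒜.Index) (p : M) : ℝ := 𝒜.χ i.1 p * wave i.2 (𝒜.coord i.1 p)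

theorem contMDiff_atom (i : 𝒜.Index) : ContMDiff 𝓘(ℝ, E) 𝓘(ℝ, ℝ) ∞ (𝒜.atom i) :=
  (𝒜.contMDiff_χ _).mul ((contDiff_planeWave _ _).contMDiff.comp (𝒜.contMDiff_coord _))

omit [CompactSpace M] [T2Space M] [IsManifold 𝓘(ℝ, E) ∞ M] in
theorem exists_summable_weight : ∃ p : ℕ, Summable fun i : 𝒜.Index => (weight i.2 ^ p)⁻¹ := by
  obtain ⟨p, hp⟩ := SkewMixing.exists_summable_weight (Fin (Module.finrank ℝ E))
  refine ⟨p, ?_⟩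
  have := Summable.mul_of_nonneg (f := fun _ : {c // c ∈ 𝒜.centers} => (1 : ℝ))
    Summable.of_finite hp (fun _ => zero_le_one) (fun i => by have := weight_pos i; positivity)
  simpa using this

/-- The `C^k` norm of an atom grows at most like the `k`-th power of its frequency. -/
theorem exists_ckNorm_atom_le (k : ℕ) :
    ∃ C : ℝ, 0 ≤ C ∧ ∀ i, ckNorm 𝓘(ℝ, E) k (𝒜.atom i) ≤ C * weight i.2 ^ k := by
  have h : ∀ c : M, ∃ C : ℝ, 0 ≤ C ∧ ∀ (F : EuclideanSpace ℝ (Fin (Module.finrank ℝ E)) → ℝ)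
      (B : ℝ), ContDiff ℝ k F → 0 ≤ B → (∀ j ≤ k, ∀ u, ‖iteratedFDeriv ℝ j F u‖ ≤ B) →
      ckNorm 𝓘(ℝ, E) k (fun p => 𝒜.χ c p * F (𝒜.coord c p)) ≤ C * B := fun c =>
    exists_ckNorm_mul_comp_le 𝓘(ℝ, E) ((𝒜.contMDiff_χ c).of_le (by exact_mod_cast le_top))
      ((𝒜.contMDiff_coord c).of_le (by exact_mod_cast le_top))
  choose C hC0 hC using h
  refine ⟨(∑ c ∈ 𝒜.centers, C c) * k.factorial,
    mul_nonneg (Finset.sum_nonneg fun c _ => hC0 c) (by positivity), fun i => ?_⟩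
  have hw := weight_pos i.2
  refine (hC i.1 (wave i.2) (k.factorial * weight i.2 ^ k) (contDiff_planeWave _ _) (by positivity)
    fun j hj u => norm_iteratedFDeriv_planeWave_le _ _ hj u).trans ?_
  rw [mul_assoc]
  refine mul_le_mul_of_nonneg_right ?_ (by positivity)
  exact Finset.single_le_sum (f := C) (fun c _ => hC0 c) i.1.2

end WaveAtlas

theorem hasSum_prod_of_fintype {α β : Type*} [Fintype α] {f : α × β → ℝ} {s : α → ℝ}
    (h : ∀ a, HasSum (fun b => f (a, b)) (s a)) : HasSum f (∑ a, s a) := by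
  classical
  have h1 : ∀ a, HasSum (fun q : α × β => if q.1 = a then f q else 0) (s a) := fun a => by
    refine (Function.Injective.hasSum_iff (g := fun b : β => (a, b))
      (fun b b' hb => (Prod.mk.inj hb).2) ?_).1 (by simpa [Function.comp_def] using h a)
    rintro ⟨a', b⟩ hq
    refine if_neg fun hne => hq ⟨b, ?_⟩
    simp only at hne
    rw [hne]
  simpa using hasSum_sum (s := Finset.univ) fun a _ => h1 a

end Atlas

section ProductExpansion

variable {EX EY : Type*} [NormedAddCommGroup EX] [NormedSpace ℝ EX]
  [NormedAddCommGroup EY] [NormedSpace ℝ EY]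
  {X : Type*} [TopologicalSpace X] [CompactSpace X] [T2Space X] [ChartedSpace EX X]
  [IsManifold 𝓘(ℝ, EX) ∞ X]
  {Y : Type*} [TopologicalSpace Y] [CompactSpace Y] [T2Space Y] [ChartedSpace EY Y]
  [IsManifold 𝓘(ℝ, EY) ∞ Y]

/-- A smooth function on a product of compact manifolds, multiplied by a product of functions of
the two partitions of unity, is a rapidly convergent series of products of atoms. -/
theorem exists_local_atom_expansion (𝒜 : WaveAtlas EX X) (ℬ : WaveAtlas EY Y) (p : ℕ) :
    ∃ K : ℕ, ∀ a b, ∃ C : ℝ, 0 ≤ C ∧ ∀ H : X × Y → ℝ,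
      ContMDiff (𝓘(ℝ, EX).prod 𝓘(ℝ, EY)) 𝓘(ℝ, ℝ) K H →
      ∃ c : ((Fin (Module.finrank ℝ EX) → ℤ) × Bool) × ((Fin (Module.finrank ℝ EY) → ℤ) × Bool) →
          ℝ,
        (∀ q, |c q| * (weight q.1 * weight q.2) ^ p ≤
          C * ckNorm (𝓘(ℝ, EX).prod 𝓘(ℝ, EY)) K H) ∧
        ∀ x y, HasSum (fun q => c q * ((𝒜.χ a x * wave q.1 (𝒜.coord a x)) *
          (ℬ.χ b y * wave q.2 (ℬ.coord b y)))) (𝒜.χ a x * ℬ.χ b y * H (x, y)) := by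
  obtain ⟨K, C, hC, hexp⟩ := exists_wave_expansion (Fin (Module.finrank ℝ EX))
    (Fin (Module.finrank ℝ EY)) p
  refine ⟨K, fun a b => ?_⟩
  set I := 𝓘(ℝ, EX).prod 𝓘(ℝ, EY) with hI
  set g : X × Y → ℝ := fun z => 𝒜.g a z.1 * ℬ.g b z.2 with hg
  have hgsm : ContMDiff I 𝓘(ℝ, ℝ) K g :=
    (((𝒜.contMDiff_g a).comp contMDiff_fst).mul ((ℬ.contMDiff_g b).comp contMDiff_snd)).of_le
      (by exact_mod_cast le_top)
  have hgts : tsupport g ⊆ tsupport (𝒜.g a) ×ˢ tsupport (ℬ.g b) := by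
    refine closure_minimal (fun z hz => ?_) ((isClosed_tsupport _).prod (isClosed_tsupport _))
    exact ⟨subset_tsupport _ (left_ne_zero_of_mul hz), subset_tsupport _ (right_ne_zero_of_mul hz)⟩
  have hgc : tsupport g ⊆ (chartAt (ModelProd EX EY) (a, b)).source := by
    rw [prodChartedSpace_chartAt, OpenPartialHomeomorph.prod_source]
    exact hgts.trans (Set.prod_mono (𝒜.tsupport_g a) (ℬ.tsupport_g b))
  obtain ⟨C', hC', hloc⟩ := exists_norm_iteratedFDeriv_localRep_le I hgsm hgc
  set J : EuclideanSpace ℝ (Fin (Module.finrank ℝ EX)) ×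
      EuclideanSpace ℝ (Fin (Module.finrank ℝ EY)) →L[ℝ] EX × EY :=
    ((𝒜.L a).symm.prodCongr (ℬ.L b).symm).toContinuousLinearMap with hJ
  refine ⟨C * ((1 + ‖J‖) ^ K * C'), by positivity, fun H hH => ?_⟩
  set F := localRep I (a, b) g H ∘ J with hF
  have hlocc : ContDiff ℝ K (localRep I (a, b) g H) := contDiff_localRep I hgsm hgc hH
  have hJapp : ∀ u, J u = ((𝒜.L a).symm u.1, (ℬ.L b).symm u.2) := fun u => rfl
  have hext : ∀ z : X × Y, extChartAt I (a, b) z =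
      (extChartAt 𝓘(ℝ, EX) a z.1, extChartAt 𝓘(ℝ, EY) b z.2) := fun z => by
    rw [hI, extChartAt_prod]; rfl
  have hFs : ∀ u, 1 / 8 < ‖u‖ → F u = 0 := by
    intro u hu
    refine localRep_eq_zero I ?_
    rintro ⟨z, hz, hzu⟩
    rw [hext, hJapp, Prod.mk.injEq] at hzu
    have h1 := 𝒜.norm_le a z.1 (hgts hz).1
    have h2 := ℬ.norm_le b z.2 (hgts hz).2
    rw [hzu.1, ContinuousLinearEquiv.apply_symm_apply] at h1
    rw [hzu.2, ContinuousLinearEquiv.apply_symm_apply] at h2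
    exact absurd (max_le h1 h2) (not_le.2 hu)
  obtain ⟨c, hc, hsum⟩ := hexp F ((1 + ‖J‖) ^ K * (C' * ckNorm I K H)) (hlocc.comp J.contDiff) hFs
    fun j hj u => norm_iteratedFDeriv_comp_linear_le J hlocc (hloc H hH) hj u
  refine ⟨c, fun q => (hc q).trans_eq (by ring), fun x y => ?_⟩
  by_cases hχ : 𝒜.χ a x = 0 ∨ ℬ.χ b y = 0
  · rcases hχ with h | h <;> simp [h, hasSum_zero]
  · push Not at hχ
    have h1 := 𝒜.g_eq_one a x hχ.1
    have h2 := ℬ.g_eq_one b y hχ.2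
    have hx : x ∈ tsupport (𝒜.g a) := subset_tsupport _ (by simp [h1])
    have hy : y ∈ tsupport (ℬ.g b) := subset_tsupport _ (by simp [h2])
    have hcx : 𝒜.coord a x = 𝒜.L a (extChartAt 𝓘(ℝ, EX) a x) := by
      rw [WaveAtlas.coord, h1, one_smul]
    have hcy : ℬ.coord b y = ℬ.L b (extChartAt 𝓘(ℝ, EY) b y) := by
      rw [WaveAtlas.coord, h2, one_smul]
    have hnorm : ‖(𝒜.coord a x, ℬ.coord b y)‖ < 1 / 4 := by
      rw [hcx, hcy]
      exact (max_le (𝒜.norm_le a x hx) (ℬ.norm_le b y hy)).trans_lt (by norm_num)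
    have hval : F (𝒜.coord a x, ℬ.coord b y) = H (x, y) := by
      have : J (𝒜.coord a x, ℬ.coord b y) = extChartAt I (a, b) (x, y) := by
        rw [hJapp, hext, hcx, hcy]
        simp
      rw [hF, Function.comp_apply, this, localRep_extChartAt]
      · simp [hg, h1, h2]
      · rw [prodChartedSpace_chartAt, OpenPartialHomeomorph.prod_source]
        exact ⟨𝒜.tsupport_g a hx, ℬ.tsupport_g b hy⟩
    have h := (hsum _ hnorm).mul_left (𝒜.χ a x * ℬ.χ b y)
    rw [hval] at h
    refine h.congr_fun fun q => ?_
    ring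

/-- A smooth function on a product of compact manifolds is a rapidly convergent series of products
of atoms. -/
theorem exists_atom_expansion (𝒜 : WaveAtlas EX X) (ℬ : WaveAtlas EY Y) (p : ℕ) :
    ∃ (K : ℕ) (C : ℝ), 0 ≤ C ∧ ∀ H : X × Y → ℝ,
      ContMDiff (𝓘(ℝ, EX).prod 𝓘(ℝ, EY)) 𝓘(ℝ, ℝ) K H →
      ∃ c : 𝒜.Index × ℬ.Index → ℝ,
        (∀ q, |c q| * (weight q.1.2 * weight q.2.2) ^ p ≤
          C * ckNorm (𝓘(ℝ, EX).prod 𝓘(ℝ, EY)) K H) ∧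
        ∀ x y, HasSum (fun q => c q * (𝒜.atom q.1 x * ℬ.atom q.2 y)) (H (x, y)) := by
  obtain ⟨K, h⟩ := exists_local_atom_expansion 𝒜 ℬ p
  choose C hC0 hC using h
  refine ⟨K, ∑ a ∈ 𝒜.centers, ∑ b ∈ ℬ.centers, C a b,
    Finset.sum_nonneg fun a _ => Finset.sum_nonneg fun b _ => hC0 a b, fun H hH => ?_⟩
  choose c hc hsum using fun a b => hC a b H hH
  refine ⟨fun q => c q.1.1 q.2.1 (q.1.2, q.2.2), fun q => ?_, fun x y => ?_⟩
  · refine (hc q.1.1 q.2.1 (q.1.2, q.2.2)).trans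
      (mul_le_mul_of_nonneg_right ?_ (ckNorm_nonneg _ _ _))
    refine le_trans ?_ (Finset.single_le_sum (f := fun a => ∑ b ∈ ℬ.centers, C a b)
      (fun a _ => Finset.sum_nonneg fun b _ => hC0 a b) q.1.1.2)
    exact Finset.single_le_sum (f := fun b => C q.1.1 b) (fun b _ => hC0 _ b) q.2.1.2
  · rw [← (Equiv.prodProdProdComm _ _ _ _).hasSum_iff]
    have h := hasSum_prod_of_fintype (α := {a // a ∈ 𝒜.centers} × {b // b ∈ ℬ.centers})
      (f := (fun q : 𝒜.Index × ℬ.Index => c q.1.1 q.2.1 (q.1.2, q.2.2) *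
        (𝒜.atom q.1 x * ℬ.atom q.2 y)) ∘ (Equiv.prodProdProdComm _ _ _ _))
      fun r => hsum r.1 r.2 x y
    have hone : ∑ r : {a // a ∈ 𝒜.centers} × {b // b ∈ ℬ.centers},
        𝒜.χ r.1 x * ℬ.χ r.2 y * H (x, y) = H (x, y) := by
      rw [← Finset.sum_mul, Fintype.sum_prod_type]
      simp only
      rw [← Finset.sum_mul_sum]
      rw [Finset.sum_coe_sort 𝒜.centers (fun c => 𝒜.χ c x), 𝒜.sum_χ,
        Finset.sum_coe_sort ℬ.centers (fun c => ℬ.χ c y), ℬ.sum_χ, one_mul, one_mul]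
    rwa [hone] at h

end ProductExpansion

/-! ### Uniform bounds for ergodic integrals of atoms -/

section Uniform

open scoped BoundedContinuousFunction

variable {d : ℕ} {Y : Type*} [TopologicalSpace Y] [CompactSpace Y] [MeasurableSpace Y]
  [BorelSpace Y] [SecondCountableTopology Y] {ν : Measure Y} [IsProbabilityMeasure ν]
  {G : EuclideanSpace ℝ (Fin d) → Y → Y}
  (hGc : Continuous fun p : EuclideanSpace ℝ (Fin d) × Y => G p.1 p.2)

include hGc

/-- A large deviation bound for ergodic integrals, together with the trivial bound `M T^d`, gives
a bound in mean square. -/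
theorem integral_sq_ergodicIntegral_le {b : Y → ℝ} (hb : Continuous b) {M : ℝ}
    (hM : ∀ y, |b y| ≤ M) {β m C T : ℝ} (hm : 2 * d * (1 - β) ≤ m) (hT : 1 ≤ T)
    (h : ν.real {y | T ^ ((d : ℝ) * β) < |ergodicIntegral G b T y|} ≤ C * T ^ (-m)) :
    ∫ y, ergodicIntegral G b T y ^ 2 ∂ν ≤ (1 + M ^ 2 * |C|) * (T ^ ((d : ℝ) * β)) ^ 2 := by
  have hT0 : 0 < T := zero_lt_one.trans_le hT
  have hS := continuous_ergodicIntegral hGc hb T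
  set q : ℝ := (d : ℝ) * β with hq
  set bad := {y | T ^ q < |ergodicIntegral G b T y|} with hbad
  have hbm : MeasurableSet bad := (isOpen_lt continuous_const hS.abs).measurableSet
  have hpt : ∀ y, ergodicIntegral G b T y ^ 2 ≤
      (T ^ q) ^ 2 + bad.indicator (fun _ => (M * T ^ d) ^ 2) y := by
    intro y
    by_cases hy : y ∈ bad
    · rw [Set.indicator_of_mem hy, ← sq_abs]
      have h1 := abs_ergodicIntegral_le (G := G) hM hT0.le y
      have h2 : |ergodicIntegral G b T y| ^ 2 ≤ (M * T ^ d) ^ 2 := by gcongr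
      have h3 : 0 ≤ (T ^ q) ^ 2 := by positivity
      linarith
    · rw [Set.indicator_of_notMem hy, add_zero, ← sq_abs]
      have h1 : |ergodicIntegral G b T y| ≤ T ^ q := not_lt.1 hy
      gcongr
  have hint : Integrable (bad.indicator fun _ => (M * T ^ d) ^ 2) ν :=
    (integrable_const _).indicator hbm
  refine (integral_mono (integrable_of_continuous (hS.pow 2))
    ((integrable_const _).add hint) hpt).trans ?_
  rw [integral_add' (integrable_const _) hint, integral_const, probReal_univ, one_smul,
    integral_indicator_const _ hbm, smul_eq_mul]
  have h1 : ν.real bad ≤ |C| * T ^ (-m) :=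
    h.trans (mul_le_mul_of_nonneg_right (le_abs_self C) (by positivity))
  have h2 : T ^ (-m) * (T ^ d) ^ 2 ≤ (T ^ q) ^ 2 := by
    rw [← Real.rpow_natCast (T ^ d), ← Real.rpow_natCast (T ^ q), ← Real.rpow_natCast T,
      ← Real.rpow_mul hT0.le, ← Real.rpow_mul hT0.le, ← Real.rpow_add hT0]
    refine Real.rpow_le_rpow_of_exponent_le hT ?_
    push_cast
    rw [hq]
    linarith
  calc (T ^ q) ^ 2 + ν.real bad * (M * T ^ d) ^ 2
      ≤ (T ^ q) ^ 2 + (|C| * T ^ (-m)) * (M * T ^ d) ^ 2 := by gcongr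
    _ = (T ^ q) ^ 2 + M ^ 2 * |C| * (T ^ (-m) * (T ^ d) ^ 2) := by ring
    _ ≤ (T ^ q) ^ 2 + M ^ 2 * |C| * (T ^ q) ^ 2 := by gcongr
    _ = _ := by ring

/-- The ergodic integral over a cube, as an operator on continuous functions. -/
def ergodicOperator {T : ℝ} (hT : 0 ≤ T) : C(Y, ℝ) →L[ℝ] C(Y, ℝ) :=
  LinearMap.mkContinuous
    { toFun := fun b => ⟨ergodicIntegral G b T, continuous_ergodicIntegral hGc b.continuous T⟩
      map_add' := fun b b' => by
        have hi : ∀ (b : C(Y, ℝ)) y, IntegrableOn (fun s => b (G s y))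
            (box (fun _ : Fin d => 0) fun _ => T) := fun b y =>
          ContinuousOn.integrableOn_compact (isCompact_box _ _)
            (b.continuous.comp (hGc.comp (Continuous.prodMk_left y))).continuousOn
        ext y
        exact integral_add (hi b y) (hi b' y)
      map_smul' := fun r b => by
        ext y
        exact integral_const_mul r _ }
    (T ^ d) fun b => by
      refine (ContinuousMap.norm_le _ (by positivity)).2 fun y => ?_
      rw [mul_comm]
      exact abs_ergodicIntegral_le (fun y => b.norm_coe_le_norm y) hT y

omit hGc [SecondCountableTopology Y] in
theorem norm_toLp_sq (b : C(Y, ℝ)) :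
    ‖ContinuousMap.toLp (E := ℝ) 2 ν ℝ b‖ ^ 2 = ∫ y, b y ^ 2 ∂ν := by
  rw [← real_inner_self_eq_norm_sq, ContinuousMap.inner_toLp]
  refine integral_congr_ae (ae_of_all _ fun y => ?_)
  simp [sq]

/-- If the ergodic integrals of every combination with bounded coefficients of a summable family
of functions grow at a given rate in mean square, they do so uniformly over the family. This is
the uniform boundedness principle for the operators `c ↦ T^{-q} S_T (∑ c_l b_l)`. -/
theorem exists_uniform_integral_sq_ergodicIntegral_le {Λ : Type*} {b : Λ → C(Y, ℝ)}
    (hb : Summable fun l => ‖b l‖) {q : ℝ}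
    (h : ∀ c : Λ → ℝ, (∃ M, ∀ l, |c l| ≤ M) → ∃ C : ℝ, ∀ T : ℝ, 1 ≤ T →
      ∫ y, ergodicIntegral G (∑' l, c l • b l : C(Y, ℝ)) T y ^ 2 ∂ν ≤ C * (T ^ q) ^ 2) :
    ∃ C : ℝ, 0 < C ∧ ∀ l, ∀ T : ℝ, 1 ≤ T →
      ∫ y, ergodicIntegral G (b l) T y ^ 2 ∂ν ≤ (C * T ^ q) ^ 2 := by
  classical
  let _ : TopologicalSpace Λ := ⊥
  have _ : DiscreteTopology Λ := ⟨rfl⟩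
  have hsum : ∀ c : Λ →ᵇ ℝ, Summable fun l => ‖c l • b l‖ := fun c => by
    refine Summable.of_nonneg_of_le (fun l => norm_nonneg _) (fun l => ?_) (hb.mul_left ‖c‖)
    rw [norm_smul]
    exact mul_le_mul_of_nonneg_right (c.norm_coe_le_norm l) (norm_nonneg _)
  let syn : (Λ →ᵇ ℝ) →L[ℝ] C(Y, ℝ) := LinearMap.mkContinuous
    { toFun := fun c => ∑' l, c l • b l
      map_add' := fun c c' => by
        rw [← Summable.tsum_add (hsum c).of_norm (hsum c').of_norm]
        simp [add_smul]
      map_smul' := fun r c => by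
        rw [RingHom.id_apply, ← Summable.tsum_const_smul r (hsum c).of_norm]
        simp [mul_smul] }
    (∑' l, ‖b l‖) fun c => by
      refine (norm_tsum_le_tsum_norm (hsum c)).trans ?_
      rw [mul_comm, ← tsum_mul_left]
      refine (hsum c).tsum_le_tsum (fun l => ?_) (hb.mul_left _)
      rw [norm_smul]
      exact mul_le_mul_of_nonneg_right (c.norm_coe_le_norm l) (norm_nonneg _)
  let g : {T : ℝ // 1 ≤ T} → (Λ →ᵇ ℝ) →L[ℝ] Lp ℝ 2 ν := fun T =>
    ((T : ℝ) ^ q)⁻¹ • (ContinuousMap.toLp (E := ℝ) 2 ν ℝ ∘L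
      (ergodicOperator hGc (zero_le_one.trans T.2) ∘L syn))
  have hg : ∀ T c, ‖g T c‖ ^ 2 = ((T : ℝ) ^ q)⁻¹ ^ 2 *
      ∫ y, ergodicIntegral G (∑' l, c l • b l : C(Y, ℝ)) T y ^ 2 ∂ν := by
    intro T c
    have hT : (0 : ℝ) ≤ T := zero_le_one.trans T.2
    have : g T c = ((T : ℝ) ^ q)⁻¹ • ContinuousMap.toLp (E := ℝ) 2 ν ℝ
        (ergodicOperator hGc hT (∑' l, c l • b l)) := rfl
    rw [this, norm_smul, mul_pow, norm_toLp_sq, Real.norm_of_nonneg (by positivity)]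
    rfl
  obtain ⟨C, hC⟩ := banach_steinhaus (g := g) fun c => by
    obtain ⟨C, hC⟩ := h c ⟨‖c‖, fun l => c.norm_coe_le_norm l⟩
    refine ⟨Real.sqrt C, fun T => Real.le_sqrt_of_sq_le ?_⟩
    have hT : (0 : ℝ) < T := zero_lt_one.trans_le T.2
    rw [hg, inv_pow, inv_mul_le_iff₀ (by positivity), mul_comm]
    exact hC T T.2
  refine ⟨max C 1, zero_lt_one.trans_le (le_max_right _ _), fun l T hT => ?_⟩
  -- evaluation at the coordinate vectors gives back the members of the family
  let e : Λ →ᵇ ℝ := BoundedContinuousFunction.ofNormedAddCommGroupDiscrete (Pi.single l 1) 1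
    fun l' => by
      by_cases hl : l' = l
      · subst hl; simp
      · simp [hl]
  have he : ‖e‖ ≤ 1 := BoundedContinuousFunction.norm_ofNormedAddCommGroup_le _ zero_le_one _
  have hes : (∑' l', e l' • b l') = b l := by
    rw [tsum_eq_single l fun l' hl' => by simp [e, hl']]
    simp [e]
  have h1 : ‖g ⟨T, hT⟩ e‖ ≤ max C 1 := by
    refine ((g ⟨T, hT⟩).le_opNorm e).trans ?_
    calc ‖g ⟨T, hT⟩‖ * ‖e‖ ≤ ‖g ⟨T, hT⟩‖ * 1 :=
          mul_le_mul_of_nonneg_left he (g ⟨T, hT⟩).opNorm_nonneg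
      _ ≤ max C 1 := by rw [mul_one]; exact (hC _).trans (le_max_left _ _)
  have h2 : ‖g ⟨T, hT⟩ e‖ ^ 2 ≤ (max C 1) ^ 2 := pow_le_pow_left₀ (norm_nonneg _) h1 2
  have hT0 : 0 < T := zero_lt_one.trans_le hT
  rw [hg, hes, inv_pow, inv_mul_le_iff₀ (by positivity)] at h2
  rw [mul_pow, mul_comm]
  exact h2

end Uniform

section Atoms

variable {d : ℕ} {E Y : Type*} [NormedAddCommGroup E] [NormedSpace ℝ E]
  [TopologicalSpace Y] [CompactSpace Y] [T2Space Y] [ChartedSpace E Y] [IsManifold 𝓘(ℝ, E) ∞ Y]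
  [SecondCountableTopology Y] [MeasurableSpace Y] [BorelSpace Y]
  {ν : Measure Y} [IsProbabilityMeasure ν] {G : EuclideanSpace ℝ (Fin d) → Y → Y}

namespace WaveAtlas

variable (ℬ : WaveAtlas E Y)

/-- An atom, minus its mean. -/
def centeredAtom (ν : Measure Y) (j : ℬ.Index) (y : Y) : ℝ := ℬ.atom j y - ∫ y, ℬ.atom j y ∂ν

omit [SecondCountableTopology Y] [MeasurableSpace Y] [BorelSpace Y] in
theorem continuous_atom (j : ℬ.Index) : Continuous (ℬ.atom j) := (ℬ.contMDiff_atom j).continuous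

omit [IsProbabilityMeasure ν] in
theorem continuous_centeredAtom (j : ℬ.Index) : Continuous (ℬ.centeredAtom ν j) :=
  (ℬ.continuous_atom j).sub continuous_const

theorem integral_centeredAtom (j : ℬ.Index) : ∫ y, ℬ.centeredAtom ν j y ∂ν = 0 := by
  unfold centeredAtom
  rw [integral_sub (integrable_of_continuous (ℬ.continuous_atom j)) (integrable_const _),
    integral_const, probReal_univ, one_smul, sub_self]

omit [T2Space Y] [IsManifold 𝓘(ℝ, E) ∞ Y] [SecondCountableTopology Y] [MeasurableSpace Y]
  [BorelSpace Y] in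
theorem exists_abs_atom_le : ∃ C : ℝ, 1 ≤ C ∧ ∀ j y, |ℬ.atom j y| ≤ C := by
  have h : ∀ c : Y, ∃ C : ℝ, 0 ≤ C ∧ ∀ y, |ℬ.χ c y| ≤ C := fun c =>
    exists_abs_le_of_continuous (ℬ.contMDiff_χ c).continuous
  choose C hC0 hC using h
  refine ⟨1 + ∑ c ∈ ℬ.centers, C c,
    le_add_of_nonneg_right (Finset.sum_nonneg fun c _ => hC0 c), fun j y => ?_⟩
  rw [atom, abs_mul]
  have h1 : |wave j.2 (ℬ.coord j.1 y)| ≤ 1 := abs_planeWave_le _ _ _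
  have h2 : C j.1 ≤ ∑ c ∈ ℬ.centers, C c :=
    Finset.single_le_sum (f := C) (fun c _ => hC0 c) j.1.2
  calc |ℬ.χ j.1 y| * |wave j.2 (ℬ.coord j.1 y)| ≤ |ℬ.χ j.1 y| * 1 := by gcongr
    _ ≤ 1 + ∑ c ∈ ℬ.centers, C c := by linarith [hC j.1 y]

theorem exists_abs_centeredAtom_le (ν : Measure Y) [IsProbabilityMeasure ν] :
    ∃ C : ℝ, 1 ≤ C ∧ ∀ j y, |ℬ.centeredAtom ν j y| ≤ C := by
  obtain ⟨C, hC1, hC⟩ := ℬ.exists_abs_atom_le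
  refine ⟨2 * C, by linarith, fun j y => ?_⟩
  have h1 := norm_integral_le_of_norm_le_const (μ := ν) (f := ℬ.atom j) (ae_of_all _ (hC j))
  rw [probReal_univ, mul_one] at h1
  calc |ℬ.centeredAtom ν j y| ≤ |ℬ.atom j y| + |∫ y, ℬ.atom j y ∂ν| := abs_sub _ _
    _ ≤ 2 * C := by
      have := hC j y
      have h1' : |∫ y, ℬ.atom j y ∂ν| ≤ C := h1
      linarith

/-- The ergodic integrals of all centered atoms grow at the same rate in mean square, with a
constant polynomial in the frequency. -/
theorem exists_integral_sq_ergodicIntegral_centeredAtom_le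
    (hGc : Continuous fun p : EuclideanSpace ℝ (Fin d) × Y => G p.1 p.2) {β : ℝ}
    (hA3 : FiberDeviations E ν G β) :
    ∃ (k : ℕ) (C : ℝ), 0 < C ∧ ∀ (j : ℬ.Index) (T : ℝ), 1 ≤ T →
      ∫ y, ergodicIntegral G (ℬ.centeredAtom ν j) T y ^ 2 ∂ν ≤
        (C * weight j.2 ^ k * T ^ ((d : ℝ) * β)) ^ 2 := by
  obtain ⟨k, hk⟩ := hA3
  obtain ⟨p, hp⟩ := SkewMixing.exists_summable_weight (Fin (Module.finrank ℝ E))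
  obtain ⟨A, hA1, hA⟩ := ℬ.exists_abs_centeredAtom_le ν
  refine ⟨k + p, ?_⟩
  suffices h : ∀ c : {c // c ∈ ℬ.centers}, ∃ C : ℝ, 0 < C ∧
      ∀ (i : (Fin (Module.finrank ℝ E) → ℤ) × Bool) (T : ℝ), 1 ≤ T →
      ∫ y, ergodicIntegral G (ℬ.centeredAtom ν (c, i)) T y ^ 2 ∂ν ≤
        (C * weight i ^ (k + p) * T ^ ((d : ℝ) * β)) ^ 2 by
    choose C hC0 hC using h
    refine ⟨1 + ∑ c, C c, add_pos_of_pos_of_nonneg one_pos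
      (Finset.sum_nonneg fun c _ => (hC0 c).le), fun j T hT => (hC j.1 j.2 T hT).trans ?_⟩
    have h1 : C j.1 ≤ 1 + ∑ c, C c := by
      have := Finset.single_le_sum (f := C) (fun c _ => (hC0 c).le) (Finset.mem_univ j.1)
      linarith
    have h2 := weight_pos j.2
    have h3 := hC0 j.1
    gcongr
  intro c
  -- The uniform boundedness principle is applied to the centered atoms of the chart `c` times the
  -- coefficients `a`: these decrease so fast that a combination of such functions with bounded
  -- coefficients is summable and of class `C^k`, hence satisfies the deviation bounds.
  set a : (Fin (Module.finrank ℝ E) → ℤ) × Bool → ℝ := fun i => (weight i ^ (k + p))⁻¹ with ha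
  have ha0 : ∀ i, 0 < a i := fun i => by have := weight_pos i; positivity
  have haw : ∀ i, a i * weight i ^ k = (weight i ^ p)⁻¹ := fun i => by
    have := (weight_pos i).ne'
    simp only [ha, pow_add]
    field_simp
  have hap : ∀ i, a i ≤ (weight i ^ p)⁻¹ := fun i => by
    rw [← haw]
    exact le_mul_of_one_le_right (ha0 i).le (one_le_pow₀ (one_le_weight i))
  set b : (Fin (Module.finrank ℝ E) → ℤ) × Bool → C(Y, ℝ) := fun i =>
    a i • ⟨ℬ.centeredAtom ν (c, i), ℬ.continuous_centeredAtom (c, i)⟩ with hb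
  have hbn : ∀ i, ‖b i‖ ≤ A * (weight i ^ p)⁻¹ := fun i => by
    rw [hb, norm_smul, Real.norm_of_nonneg (ha0 i).le, mul_comm]
    have h1 : ‖(⟨ℬ.centeredAtom ν (c, i), ℬ.continuous_centeredAtom (c, i)⟩ : C(Y, ℝ))‖ ≤ A :=
      (ContinuousMap.norm_le _ (by linarith)).2 fun y => hA (c, i) y
    exact mul_le_mul h1 (hap i) (ha0 i).le (by linarith)
  have hbs : Summable fun i => ‖b i‖ :=
    Summable.of_nonneg_of_le (fun i => norm_nonneg _) hbn (hp.mul_left A)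
  have hkey : ∀ x : (Fin (Module.finrank ℝ E) → ℤ) × Bool → ℝ, (∃ M, ∀ i, |x i| ≤ M) →
      ∃ C : ℝ, ∀ T : ℝ, 1 ≤ T → ∫ y, ergodicIntegral G (∑' i, x i • b i : C(Y, ℝ)) T y ^ 2 ∂ν ≤
        C * (T ^ ((d : ℝ) * β)) ^ 2 := by
    rintro x ⟨M, hM⟩
    have hM0 : 0 ≤ M := (abs_nonneg _).trans (hM (0, false))
    have hxs : Summable fun i => ‖x i • b i‖ := by
      refine Summable.of_nonneg_of_le (fun i => norm_nonneg _) (fun i => ?_) (hbs.mul_left M)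
      rw [norm_smul]
      exact mul_le_mul_of_nonneg_right (hM i) (norm_nonneg _)
    have hsum := hxs.of_norm.hasSum
    set B : C(Y, ℝ) := ∑' i, x i • b i with hB
    have hmean : ∫ y, B y ∂ν = 0 := by
      have h1 : ∀ i, ∫ y, (x i • b i : C(Y, ℝ)) y ∂ν = 0 := fun i => by
        have : ∀ y, (x i • b i : C(Y, ℝ)) y = x i * a i * ℬ.centeredAtom ν (c, i) y := fun y => by
          simp [hb, mul_assoc]
        simp only [this]
        rw [integral_const_mul, ℬ.integral_centeredAtom, mul_zero]
      have h2 := hasSum_integral_of_summable_integral_norm (μ := ν)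
        (F := fun i y => (x i • b i : C(Y, ℝ)) y)
        (fun i => integrable_of_continuous (x i • b i).continuous) ?_
      · simp only [h1] at h2
        have h3 := h2.unique hasSum_zero
        rw [← h3]
        refine integral_congr_ae (ae_of_all _ fun y => ?_)
        exact ((ContinuousMap.evalCLM ℝ y).hasSum hsum).tsum_eq.symm
      · refine Summable.of_nonneg_of_le (fun i => integral_nonneg fun y => norm_nonneg _)
          (fun i => ?_) hxs
        have := norm_integral_le_of_norm_le_const (μ := ν)
          (f := fun y => ‖(x i • b i : C(Y, ℝ)) y‖) (C := ‖x i • b i‖)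
          (ae_of_all _ fun y => by rw [norm_norm]; exact (x i • b i).norm_coe_le_norm y)
        rw [probReal_univ, mul_one] at this
        exact (le_abs_self _).trans this
    have hsmooth : ContMDiff 𝓘(ℝ, E) 𝓘(ℝ, ℝ) k B := by
      set Ψ : EuclideanSpace ℝ (Fin (Module.finrank ℝ E)) → ℝ := fun u =>
        ∑' i, x i * a i * wave i u with hΨ
      have hΨd : ContDiff ℝ ((k : ℕ∞) : WithTop ℕ∞) Ψ := by
        refine contDiff_tsum (v := fun _ i => M * k.factorial * (weight i ^ p)⁻¹)
          (fun i => contDiff_const.mul (contDiff_planeWave _ _)) (fun _ _ => hp.mul_left _)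
          fun j i u hj => ?_
        have hj : j ≤ k := by exact_mod_cast hj
        have h1 : iteratedFDeriv ℝ j (fun u => x i * a i * wave i u) u =
            (x i * a i) • iteratedFDeriv ℝ j (wave i) u :=
          iteratedFDeriv_const_smul_apply (a := x i * a i) (f := wave i)
            (contDiff_planeWave _ _).contDiffAt
        rw [h1, norm_smul, Real.norm_eq_abs, abs_mul, abs_of_pos (ha0 i)]
        have h2 : ‖iteratedFDeriv ℝ j (wave i) u‖ ≤ k.factorial * weight i ^ k :=
          norm_iteratedFDeriv_planeWave_le _ _ hj u
        have h3 := ha0 i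
        calc |x i| * a i * ‖iteratedFDeriv ℝ j (wave i) u‖
            ≤ M * a i * (k.factorial * weight i ^ k) := by
              have := hM i
              gcongr
          _ = M * k.factorial * (a i * weight i ^ k) := by ring
          _ = _ := by rw [haw]
      have hΨs : ∀ u, Summable fun i => x i * a i * wave i u := fun u => by
        refine Summable.of_norm_bounded (hp.mul_left M) fun i => ?_
        have h1 : |wave i u| ≤ 1 := abs_planeWave_le _ _ _
        have h2 := ha0 i
        rw [Real.norm_eq_abs, abs_mul, abs_mul, abs_of_pos h2]
        calc |x i| * a i * |wave i u| ≤ M * (weight i ^ p)⁻¹ * 1 := by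
              have := hM i
              have := hap i
              have := weight_pos i
              gcongr
          _ = _ := mul_one _
      have hms : Summable fun i => x i * a i * ∫ y, ℬ.atom (c, i) y ∂ν := by
        obtain ⟨A', hA'1, hA'⟩ := ℬ.exists_abs_atom_le
        refine Summable.of_norm_bounded ((hp.mul_left (M * A'))) fun i => ?_
        have h1 := norm_integral_le_of_norm_le_const (μ := ν) (f := ℬ.atom (c, i))
          (ae_of_all _ (hA' (c, i)))
        rw [probReal_univ, mul_one] at h1
        have h2 := ha0 i
        rw [norm_mul, norm_mul, Real.norm_eq_abs (a i), abs_of_pos h2]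
        calc ‖x i‖ * a i * ‖∫ y, ℬ.atom (c, i) y ∂ν‖ ≤ M * (weight i ^ p)⁻¹ * A' := by
              have : ‖x i‖ ≤ M := hM i
              have := hap i
              have := weight_pos i
              gcongr
          _ = _ := by ring
      have heq : (B : Y → ℝ) = fun y => ℬ.χ c y * Ψ (ℬ.coord c y) -
          ∑' i, x i * a i * ∫ y, ℬ.atom (c, i) y ∂ν := by
        funext y
        have h1 := ((ContinuousMap.evalCLM ℝ y).hasSum hsum)
        refine h1.unique (((((hΨs (ℬ.coord c y)).hasSum.mul_left (ℬ.χ c y)).sub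
          hms.hasSum)).congr_fun fun i => ?_)
        simp [hb, centeredAtom, atom]
        ring
      rw [heq]
      exact (((ℬ.contMDiff_χ c).of_le (by exact_mod_cast le_top)).mul
        (hΨd.contMDiff.comp ((ℬ.contMDiff_coord c).of_le (by exact_mod_cast le_top)))).sub
        contMDiff_const
    -- the deviation bound of this order beats the trivial bound `T^d` on the exceptional set
    obtain ⟨m, hm⟩ := exists_nat_ge (max 1 (2 * d * (1 - β)))
    have hm1 : 0 < m := by
      have : (1 : ℝ) ≤ m := (le_max_left _ _).trans hm
      exact_mod_cast zero_lt_one.trans_le this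
    obtain ⟨C, hC⟩ := hk B hsmooth hmean m hm1
    exact ⟨_, fun T hT => integral_sq_ergodicIntegral_le hGc B.continuous
      (fun y => B.norm_coe_le_norm y) ((le_max_right _ _).trans hm) hT
      (hC T (zero_lt_one.trans_le hT))⟩
  obtain ⟨C, hC0, hC⟩ := exists_uniform_integral_sq_ergodicIntegral_le (ν := ν) hGc hbs
    (q := (d : ℝ) * β) hkey
  refine ⟨C, hC0, fun i T hT => ?_⟩
  have h1 := hC i T hT
  have h2 : ∀ y, ergodicIntegral G (b i) T y =
      a i * ergodicIntegral G (ℬ.centeredAtom ν (c, i)) T y :=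
    fun y => integral_const_mul (a i) _
  simp only [h2, mul_pow] at h1
  rw [integral_const_mul] at h1
  have h3 := weight_pos i
  calc ∫ y, ergodicIntegral G (ℬ.centeredAtom ν (c, i)) T y ^ 2 ∂ν
      = (weight i ^ (k + p)) ^ 2 *
        (a i ^ 2 * ∫ y, ergodicIntegral G (ℬ.centeredAtom ν (c, i)) T y ^ 2 ∂ν) := by
        rw [ha]
        field_simp
    _ ≤ (weight i ^ (k + p)) ^ 2 * (C ^ 2 * (T ^ ((d : ℝ) * β)) ^ 2) := by gcongr
    _ = _ := by ring

end WaveAtlas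

end Atoms

/-! ### Correlations of the skew product -/

section FiberCentering

variable {d : ℕ} {Y : Type*} [TopologicalSpace Y] [CompactSpace Y]
  [SecondCountableTopology Y] [MeasurableSpace Y] [BorelSpace Y]
  {ν : Measure Y} [IsProbabilityMeasure ν] {G : EuclideanSpace ℝ (Fin d) → Y → Y}

omit [SecondCountableTopology Y] in
/-- The correlation of functions along the fiber does not change when a constant is subtracted
from the second one, provided the first one has zero mean. -/
theorem fiberCorrelation_sub_const
    (hGc : Continuous fun p : EuclideanSpace ℝ (Fin d) × Y => G p.1 p.2) {b b' : Y → ℝ}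
    (hb : Continuous b) (hb' : Continuous b') (h0 : ∫ y, b y ∂ν = 0) (r : ℝ) :
    fiberCorrelation ν G b (fun y => b' y - r) = fiberCorrelation ν G b b' := by
  funext t
  have hGt : Continuous (G t) := hGc.comp (Continuous.prodMk_right t)
  unfold fiberCorrelation
  simp only [mul_sub]
  have h1 : Integrable (fun y => b y * b' (G t y)) ν :=
    integrable_of_continuous (hb.mul (hb'.comp hGt))
  rw [integral_sub h1 ((integrable_of_continuous hb).mul_const r), integral_mul_const, h0,
    zero_mul, sub_zero]

omit [SecondCountableTopology Y] in
/-- Centering the first function in a fiber correlation changes it by a constant, because the flow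
preserves `ν`. -/
theorem fiberCorrelation_eq_add
    (hGc : Continuous fun p : EuclideanSpace ℝ (Fin d) × Y => G p.1 p.2)
    (hGν : ∀ t, MeasurePreserving (G t) ν ν) {b b' : Y → ℝ}
    (hb : Continuous b) (hb' : Continuous b') (t : EuclideanSpace ℝ (Fin d)) :
    fiberCorrelation ν G b b' t =
      fiberCorrelation ν G (fun y => b y - ∫ y, b y ∂ν) b' t +
        (∫ y, b y ∂ν) * ∫ y, b' y ∂ν := by
  have hGt : Continuous (G t) := hGc.comp (Continuous.prodMk_right t)
  have hinv : ∫ y, b' (G t y) ∂ν = ∫ y, b' y ∂ν := by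
    have h := integral_map (μ := ν) (hGν t).measurable.aemeasurable (f := b')
      hb'.aestronglyMeasurable
    rw [(hGν t).map_eq] at h
    exact h.symm
  unfold fiberCorrelation
  simp only [sub_mul]
  have h1 : Integrable (fun y => b y * b' (G t y)) ν :=
    integrable_of_continuous (hb.mul (hb'.comp hGt))
  have h2 : Integrable (fun y => b' (G t y)) ν := integrable_of_continuous (hb'.comp hGt)
  rw [integral_sub h1 (h2.const_mul _), integral_const_mul, hinv, sub_add_cancel]

end FiberCentering

section FiberAtoms

variable {d : ℕ} {E Y : Type*} [NormedAddCommGroup E] [NormedSpace ℝ E]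
  [TopologicalSpace Y] [CompactSpace Y] [T2Space Y] [ChartedSpace E Y] [IsManifold 𝓘(ℝ, E) ∞ Y]
  [SecondCountableTopology Y] [MeasurableSpace Y] [BorelSpace Y]
  {ν : Measure Y} [IsProbabilityMeasure ν] {G : EuclideanSpace ℝ (Fin d) → Y → Y}

/-- The correlations along the fiber of two atoms, the first one centered, are smooth functions of
time with rapidly decaying averages, with bounds polynomial in the frequencies. -/
theorem exists_fiberCorrelation_atom_bounds (ℬ : WaveAtlas E Y)
    (hG : ContMDiff (𝓘(ℝ, EuclideanSpace ℝ (Fin d)).prod 𝓘(ℝ, E)) 𝓘(ℝ, E) ∞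
      (fun p : EuclideanSpace ℝ (Fin d) × Y => G p.1 p.2))
    (hG_add : ∀ s t y, G (s + t) y = G s (G t y))
    (hGν : ∀ t, MeasurePreserving (G t) ν ν) {β : ℝ} (hA3 : FiberDeviations E ν G β) (k : ℕ) :
    ∃ (m : ℕ) (C : ℝ), 0 ≤ C ∧ ∀ j j' : ℬ.Index,
      AverageDecay (d * (1 - β)) (C * (weight j.2 * weight j'.2) ^ m)
        (fiberCorrelation ν G (ℬ.centeredAtom ν j) (ℬ.atom j')) ∧
      ContDiff ℝ k (fiberCorrelation ν G (ℬ.centeredAtom ν j) (ℬ.atom j')) ∧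
      ∀ l ≤ k, ∀ u,
        ‖iteratedFDeriv ℝ l (fiberCorrelation ν G (ℬ.centeredAtom ν j) (ℬ.atom j')) u‖ ≤
          C * (weight j.2 * weight j'.2) ^ m := by
  have hGc := hG.continuous
  obtain ⟨k₃, C₃, hC₃, h₃⟩ := ℬ.exists_integral_sq_ergodicIntegral_centeredAtom_le hGc hA3
  obtain ⟨M, hM1, hM⟩ := ℬ.exists_abs_centeredAtom_le ν
  obtain ⟨M', hM1', hM'⟩ := ℬ.exists_abs_atom_le
  have hder := fun c => exists_norm_iteratedFDeriv_fiberCorrelation_le (ν := ν) hG hG_add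
    (ℬ.contMDiff_χ c) (ℬ.contMDiff_coord c) k
  choose A hA0 hA using hder
  set A₀ := ∑ c ∈ ℬ.centers, A c with hA₀
  have hA₀0 : 0 ≤ A₀ := Finset.sum_nonneg fun c _ => hA0 c
  refine ⟨k₃ + k, C₃ * C₃ + M * M' + M * (A₀ * k.factorial), by positivity, fun j j' => ?_⟩
  have hw := one_le_weight j.2
  have hw' := one_le_weight j'.2
  set w := weight j.2
  set w' := weight j'.2
  have hww : 1 ≤ w * w' := one_le_mul_of_one_le_of_one_le hw hw'
  have hpow : 1 ≤ (w * w') ^ (k₃ + k) := one_le_pow₀ hww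
  have hpow₃ : (w * w') ^ k₃ ≤ (w * w') ^ (k₃ + k) := pow_le_pow_right₀ hww (by omega)
  have hpowk : w' ^ k ≤ (w * w') ^ (k₃ + k) :=
    (pow_le_pow_left₀ (by linarith) (le_mul_of_one_le_left (by linarith) hw) k).trans
      (pow_le_pow_right₀ hww (by omega))
  have hAj : A j'.1 ≤ A₀ := Finset.single_le_sum (f := A) (fun c _ => hA0 c) j'.1.2
  have h1 : 0 ≤ C₃ * C₃ := by positivity
  have h2 : 0 ≤ M * M' := by positivity
  have h3 : 0 ≤ M * (A₀ * k.factorial) := by positivity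
  have hd := hA j'.1 (wave j'.2) (k.factorial * w' ^ k) (contDiff_planeWave _ _) (by positivity)
    (fun l hl u => norm_iteratedFDeriv_planeWave_le _ _ hl u) (ℬ.centeredAtom ν j) M
    (ℬ.continuous_centeredAtom j) (hM j)
  refine ⟨⟨continuous_fiberCorrelation hGc (ℬ.continuous_centeredAtom j) (ℬ.continuous_atom j'),
    fun u => ?_, fun T hT u => ?_⟩, hd.1, fun l hl u => (hd.2 l hl u).trans ?_⟩
  · refine (abs_fiberCorrelation_le (hM j) (hM' j') u).trans ?_
    calc M * M' = (M * M') * 1 := (mul_one _).symm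
      _ ≤ (C₃ * C₃ + M * M' + M * (A₀ * k.factorial)) * (w * w') ^ (k₃ + k) := by
        gcongr
        linarith
  · have hT0 : 0 < T := zero_lt_one.trans_le hT
    rw [← fiberCorrelation_sub_const hGc (ℬ.continuous_centeredAtom j) (ℬ.continuous_atom j')
      (ℬ.integral_centeredAtom j) (∫ y, ℬ.atom j' y ∂ν)]
    refine (abs_integral_fiberCorrelation_cubeDifference_le hGc hG_add hGν
      (ℬ.continuous_centeredAtom j) (ℬ.continuous_centeredAtom j') hT0 (by positivity)
      (by positivity) (h₃ j T hT) (h₃ j' T hT) u).trans ?_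
    have hTe : (T ^ d)⁻¹ ^ 2 * (T ^ ((d : ℝ) * β) * T ^ ((d : ℝ) * β)) =
        T ^ (-2 * (d * (1 - β))) := by
      have hTd : (T ^ d)⁻¹ = T ^ (-(d : ℝ)) := by rw [Real.rpow_neg hT0.le, Real.rpow_natCast]
      rw [hTd, sq, ← Real.rpow_add hT0,
        ← Real.rpow_add hT0, ← Real.rpow_add hT0]
      congr 1
      ring
    calc (T ^ d)⁻¹ ^ 2 * (C₃ * w ^ k₃ * T ^ ((d : ℝ) * β) * (C₃ * w' ^ k₃ * T ^ ((d : ℝ) * β)))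
        = (C₃ * C₃) * (w * w') ^ k₃ *
          ((T ^ d)⁻¹ ^ 2 * (T ^ ((d : ℝ) * β) * T ^ ((d : ℝ) * β))) := by
          rw [mul_pow]; ring
      _ = (C₃ * C₃) * (w * w') ^ k₃ * T ^ (-2 * (d * (1 - β))) := by rw [hTe]
      _ ≤ _ := by
        gcongr
        linarith
  · calc M * (A j'.1 * (k.factorial * w' ^ k))
        ≤ M * (A₀ * (k.factorial * (w * w') ^ (k₃ + k))) := by gcongr
      _ = M * (A₀ * k.factorial) * (w * w') ^ (k₃ + k) := by ring
      _ ≤ _ := by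
        gcongr
        linarith

end FiberAtoms

section Iterates

variable {d : ℕ} {X Y : Type*} {f : X → X} {τ : X → EuclideanSpace ℝ (Fin d)}
  {G : EuclideanSpace ℝ (Fin d) → Y → Y}

theorem iterate_skewProduct (hG_zero : ∀ y, G 0 y = y)
    (hG_add : ∀ s t y, G (s + t) y = G s (G t y)) (N : ℕ) (z : X × Y) :
    (skewProduct f τ G)^[N] z = (f^[N] z.1, G (birkhoffSum f τ N z.1) z.2) := by
  induction N with
  | zero => simp [hG_zero]
  | succ N ih =>
    rw [Function.iterate_succ_apply', ih, birkhoffSum_succ, add_comm (birkhoffSum _ _ _ _), hG_add,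
      Function.iterate_succ_apply']
    rfl

theorem continuous_skewProduct [TopologicalSpace X] [TopologicalSpace Y] (hf : Continuous f)
    (hτ : Continuous τ) (hGc : Continuous fun p : EuclideanSpace ℝ (Fin d) × Y => G p.1 p.2) :
    Continuous (skewProduct f τ G) :=
  (hf.comp continuous_fst).prodMk (hGc.comp ((hτ.comp continuous_fst).prodMk continuous_snd))

variable [TopologicalSpace X] [CompactSpace X] [SecondCountableTopology X] [MeasurableSpace X]
  [BorelSpace X] [TopologicalSpace Y] [CompactSpace Y] [SecondCountableTopology Y]
  [MeasurableSpace Y] [BorelSpace Y] {μ : Measure X} [IsProbabilityMeasure μ]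
  {ν : Measure Y} [IsProbabilityMeasure ν]

/-- The correlation of products of functions of the base and of the fiber is the sum of a term
that involves the correlation along the fiber at the random time `τ_N`, and of a correlation of
the base. -/
theorem correlation_prod_eq (hf : Continuous f) (hτ : Continuous τ)
    (hGc : Continuous fun p : EuclideanSpace ℝ (Fin d) × Y => G p.1 p.2)
    (hG_zero : ∀ y, G 0 y = y) (hG_add : ∀ s t y, G (s + t) y = G s (G t y))
    (hGν : ∀ t, MeasurePreserving (G t) ν ν) {u u' : X → ℝ} {v v' : Y → ℝ} (hu : Continuous u)
    (hu' : Continuous u') (hv : Continuous v) (hv' : Continuous v') (N : ℕ) :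
    correlation (μ.prod ν) (skewProduct f τ G) (fun z => u z.1 * v z.2)
      (fun z => u' z.1 * v' z.2) N =
    (∫ x, u x * u' (f^[N] x) *
      fiberCorrelation ν G (fun y => v y - ∫ y, v y ∂ν) v' (birkhoffSum f τ N x) ∂μ) +
    (∫ y, v y ∂ν) * (∫ y, v' y ∂ν) *
      ((∫ x, u x * u' (f^[N] x) ∂μ) - (∫ x, u x ∂μ) * ∫ x, u' x ∂μ) := by
  have hF := (continuous_skewProduct hf hτ hGc).iterate N
  have hfN := hf.iterate N
  have hτN := continuous_birkhoffSum hf hτ N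
  have hint : ∫ z, u z.1 * v z.2 * (u' ((skewProduct f τ G)^[N] z).1 *
      v' ((skewProduct f τ G)^[N] z).2) ∂(μ.prod ν) =
      ∫ x, u x * u' (f^[N] x) * fiberCorrelation ν G v v' (birkhoffSum f τ N x) ∂μ := by
    rw [integral_prod _ (integrable_of_continuous (by fun_prop))]
    refine integral_congr_ae (ae_of_all _ fun x => ?_)
    simp only [fiberCorrelation]
    rw [← integral_const_mul]
    refine integral_congr_ae (ae_of_all _ fun y => ?_)
    simp only [iterate_skewProduct hG_zero hG_add]
    ring
  unfold correlation
  rw [hint, integral_prod_mul, integral_prod_mul]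
  have hvc : Continuous fun y => v y - ∫ y, v y ∂ν := hv.sub continuous_const
  have hcor := (continuous_fiberCorrelation (ν := ν) hGc hvc hv').comp hτN
  have huu : Continuous fun x => u x * u' (f^[N] x) := hu.mul (hu'.comp hfN)
  simp only [fiberCorrelation_eq_add hGc hGν hv hv', mul_add]
  have h1 : Integrable (fun x => u x * u' (f^[N] x) *
      fiberCorrelation ν G (fun y => v y - ∫ y, v y ∂ν) v' (birkhoffSum f τ N x)) μ :=
    integrable_of_continuous (huu.mul hcor)
  rw [integral_add h1 ((integrable_of_continuous huu).mul_const _), integral_mul_const]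
  ring

end Iterates

section Series

variable {Z : Type*} [TopologicalSpace Z] [CompactSpace Z] [MeasurableSpace Z]
  [OpensMeasurableSpace Z] {ζ : Measure Z} [IsProbabilityMeasure ζ] {Q : Type*} [Countable Q]

theorem hasSum_integral_mul {c : Q → ℝ} {e : Q → Z → ℝ} {H h : Z → ℝ} {A : ℝ}
    (hc : Summable fun q => |c q|) (he : ∀ q, Continuous (e q)) (heA : ∀ q z, |e q z| ≤ A)
    (hH : ∀ z, HasSum (fun q => c q * e q z) (H z)) (hh : Continuous h) :
    HasSum (fun q => c q * ∫ z, e q z * h z ∂ζ) (∫ z, H z * h z ∂ζ) := by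
  obtain ⟨B, hB0, hB⟩ := exists_abs_le_of_continuous hh
  have hbd : ∀ q z, ‖c q * (e q z * h z)‖ ≤ |c q| * (A * B) := fun q z => by
    rw [norm_mul, norm_mul]
    exact mul_le_mul_of_nonneg_left (mul_le_mul (heA q z) (hB z) (norm_nonneg _)
      ((abs_nonneg _).trans (heA q z))) (norm_nonneg _)
  have h1 := hasSum_integral_of_summable_integral_norm (μ := ζ)
    (F := fun q z => c q * (e q z * h z))
    (fun q => integrable_of_continuous (continuous_const.mul ((he q).mul hh)))
    (Summable.of_nonneg_of_le (fun q => integral_nonneg fun z => norm_nonneg _) (fun q => by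
      have := norm_integral_le_of_norm_le_const (μ := ζ)
        (f := fun z => ‖c q * (e q z * h z)‖) (C := |c q| * (A * B))
        (ae_of_all _ fun z => by rw [norm_norm]; exact hbd q z)
      rw [probReal_univ, mul_one] at this
      exact (Real.le_norm_self _).trans this) (hc.mul_right (A * B)))
  simp only [integral_const_mul] at h1
  have heq : ∀ z, H z * h z = ∑' q, c q * (e q z * h z) := fun z => by
    have h2 := (hH z).mul_right (h z)
    simp only [mul_assoc] at h2
    exact h2.tsum_eq.symm
  simp only [heq]
  exact h1

/-- Correlations of absolutely convergent series are controlled by those of their terms. -/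
theorem abs_correlation_le_of_hasSum {F : Z → Z} (hF : Continuous F) {e : Q → Z → ℝ} {A : ℝ}
    (he : ∀ q, Continuous (e q)) (heA : ∀ q z, |e q z| ≤ A) {g s : Q → ℝ} (hg : ∀ q, 1 ≤ g q)
    (hs : Summable s) {D : ℝ} (hD : 0 ≤ D) {N : ℕ}
    (hcor : ∀ q q', |correlation ζ F (e q) (e q') N| ≤ D * (g q * g q'))
    {H₁ H₂ : Z → ℝ} (hH₂ : Continuous H₂) {c₁ c₂ : Q → ℝ} {P₁ P₂ : ℝ}
    (hc₁ : ∀ q, |c₁ q| * g q ≤ P₁ * s q) (hc₂ : ∀ q, |c₂ q| * g q ≤ P₂ * s q)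
    (hs₁ : ∀ z, HasSum (fun q => c₁ q * e q z) (H₁ z))
    (hs₂ : ∀ z, HasSum (fun q => c₂ q * e q z) (H₂ z)) :
    |correlation ζ F H₁ H₂ N| ≤ D * (P₁ * ∑' q, s q) * (P₂ * ∑' q, s q) := by
  have hFN := hF.iterate N
  have hcs : ∀ {c : Q → ℝ} {P : ℝ}, (∀ q, |c q| * g q ≤ P * s q) → Summable fun q => |c q| :=
    fun h => Summable.of_nonneg_of_le (fun q => abs_nonneg _)
      (fun q => (le_mul_of_one_le_right (abs_nonneg _) (hg q)).trans (h q)) (hs.mul_left _)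
  -- expansion in the second variable
  have hright : ∀ q, HasSum (fun q' => c₂ q' * correlation ζ F (e q) (e q') N)
      (correlation ζ F (e q) H₂ N) := by
    intro q
    have h1 := hasSum_integral_mul (ζ := ζ) (hcs hc₂) (fun q' => (he q').comp hFN)
      (fun q' z => heA q' _) (fun z => hs₂ (F^[N] z)) (he q)
    have h2 := hasSum_integral_mul (ζ := ζ) (hcs hc₂) he heA hs₂ (continuous_const (y := (1 : ℝ)))
    simp only [mul_one] at h2
    have h3 := h1.sub (h2.mul_left (∫ z, e q z ∂ζ))
    unfold correlation
    have hcomm : ∀ h : Z → ℝ, ∫ z, h (F^[N] z) * e q z ∂ζ = ∫ z, e q z * h (F^[N] z) ∂ζ :=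
      fun h => by simp only [mul_comm]
    rw [hcomm] at h3
    refine h3.congr_fun fun q' => ?_
    simp only [Function.comp_apply]
    rw [hcomm]
    ring
  have hleft : HasSum (fun q => c₁ q * correlation ζ F (e q) H₂ N) (correlation ζ F H₁ H₂ N) := by
    have h1 := hasSum_integral_mul (ζ := ζ) (hcs hc₁) he heA hs₁ (hH₂.comp hFN)
    have h2 := hasSum_integral_mul (ζ := ζ) (hcs hc₁) he heA hs₁ (continuous_const (y := (1 : ℝ)))
    simp only [mul_one] at h2
    refine (h1.sub (h2.mul_right (∫ z, H₂ z ∂ζ))).congr_fun fun q => ?_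
    unfold correlation
    simp only [Function.comp_apply]
    ring
  have hb₂ : ∀ q, |correlation ζ F (e q) H₂ N| ≤ D * g q * (P₂ * ∑' q, s q) := by
    intro q
    refine (hright q).norm_le_of_bounded ((hs.hasSum.mul_left P₂).mul_left (D * g q)) fun q' => ?_
    rw [norm_mul]
    have h1 := hg q
    calc ‖c₂ q'‖ * ‖correlation ζ F (e q) (e q') N‖ ≤ |c₂ q'| * (D * (g q * g q')) :=
          mul_le_mul_of_nonneg_left (hcor q q') (abs_nonneg _)
      _ = D * g q * (|c₂ q'| * g q') := by ring
      _ ≤ D * g q * (P₂ * s q') :=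
          mul_le_mul_of_nonneg_left (hc₂ q') (mul_nonneg hD (by linarith))
  have hP : 0 ≤ P₂ * ∑' q, s q := by
    rw [← tsum_mul_left]
    exact tsum_nonneg fun q =>
      (mul_nonneg (abs_nonneg _) (zero_le_one.trans (hg q))).trans (hc₂ q)
  refine hleft.norm_le_of_bounded (((hs.hasSum.mul_left P₁).mul_left D).mul_right
    (P₂ * ∑' q, s q)) fun q => ?_
  rw [norm_mul]
  calc ‖c₁ q‖ * ‖correlation ζ F (e q) H₂ N‖ ≤ |c₁ q| * (D * g q * (P₂ * ∑' q, s q)) :=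
        mul_le_mul_of_nonneg_left (hb₂ q) (abs_nonneg _)
    _ = D * (|c₁ q| * g q) * (P₂ * ∑' q, s q) := by ring
    _ ≤ D * (P₁ * s q) * (P₂ * ∑' q, s q) :=
        mul_le_mul_of_nonneg_right (mul_le_mul_of_nonneg_left (hc₁ q) hD) hP

end Series

section SkewAtoms

variable {d : ℕ} {EX EY : Type*} [NormedAddCommGroup EX] [NormedSpace ℝ EX]
  [NormedAddCommGroup EY] [NormedSpace ℝ EY]
  {X : Type*} [TopologicalSpace X] [CompactSpace X] [T2Space X] [ChartedSpace EX X]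
  [IsManifold 𝓘(ℝ, EX) ∞ X] [MeasurableSpace X] [BorelSpace X] [SecondCountableTopology X]
  {Y : Type*} [TopologicalSpace Y] [CompactSpace Y] [T2Space Y] [ChartedSpace EY Y]
  [IsManifold 𝓘(ℝ, EY) ∞ Y] [MeasurableSpace Y] [BorelSpace Y] [SecondCountableTopology Y]
  {μ : Measure X} [IsProbabilityMeasure μ] {ν : Measure Y} [IsProbabilityMeasure ν]
  {f : X → X} {τ : X → EuclideanSpace ℝ (Fin d)} {G : EuclideanSpace ℝ (Fin d) → Y → Y}

/-- The correlations of products of atoms decay, with a constant polynomial in the frequencies. -/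
theorem exists_abs_correlation_atom_le (𝒜 : WaveAtlas EX X) (ℬ : WaveAtlas EY Y)
    (hf : Continuous f) (hτ : Continuous τ)
    (hG : ContMDiff (𝓘(ℝ, EuclideanSpace ℝ (Fin d)).prod 𝓘(ℝ, EY)) 𝓘(ℝ, EY) ∞
      (fun p : EuclideanSpace ℝ (Fin d) × Y => G p.1 p.2))
    (hG_zero : ∀ y, G 0 y = y) (hG_add : ∀ s t y, G (s + t) y = G s (G t y))
    (hGν : ∀ t, MeasurePreserving (G t) ν ν) {β : ℝ} {r₁ : ℕ} {r₂ r₄ : ℝ}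
    (hκ : 0 < d * (1 - β)) (hr₁ : 2 * (d * (1 - β)) < r₁) (hr₂ : d * (1 - β) < r₂)
    (hr₄ : d * (1 - β) < r₄) (hA1 : MixingDoubleEdgeworth (E := EX) μ f τ r₁)
    (hA2 : ModerateDeviations μ f τ r₂) (hA3 : FiberDeviations EY ν G β)
    (hA4 : BaseMixing EX μ f r₄) :
    ∃ m : ℕ, ∀ δ > (0 : ℝ), ∃ C : ℝ, 0 ≤ C ∧ ∀ (q q' : 𝒜.Index × ℬ.Index) (N : ℕ), 0 < N →
      |correlation (μ.prod ν) (skewProduct f τ G) (fun z => 𝒜.atom q.1 z.1 * ℬ.atom q.2 z.2)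
        (fun z => 𝒜.atom q'.1 z.1 * ℬ.atom q'.2 z.2) N| ≤
      C * (N : ℝ) ^ (-(d * (1 - β)) + δ) * ((weight q.1.2 * weight q.2.2) ^ m *
        (weight q'.1.2 * weight q'.2.2) ^ m) := by
  obtain ⟨k₁, k₂, hbase⟩ := exists_abs_integral_mul_birkhoffSum_le hf hτ hκ hr₁ hr₂ hA1 hA2
  obtain ⟨k₄, C₄, hmix⟩ := hA4
  obtain ⟨m, Cρ, hCρ, hρ⟩ := exists_fiberCorrelation_atom_bounds ℬ hG hG_add hGν hA3 k₂
  obtain ⟨A₁, hA₁0, hA₁⟩ := 𝒜.exists_ckNorm_atom_le k₁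
  obtain ⟨A₄, hA₄0, hA₄⟩ := 𝒜.exists_ckNorm_atom_le k₄
  obtain ⟨B, hB1, hB⟩ := ℬ.exists_abs_atom_le
  refine ⟨k₁ + k₄ + m, fun δ hδ => ?_⟩
  obtain ⟨C, hC, hbase⟩ := hbase δ hδ
  refine ⟨C * (A₁ * A₁) * Cρ + B * B * (|C₄| * (A₄ * A₄)), by positivity,
    fun q q' N hN => ?_⟩
  obtain ⟨i, j⟩ := q
  obtain ⟨i', j'⟩ := q'
  simp only
  have hN1 : (1 : ℝ) ≤ N := by exact_mod_cast hN
  have w1 := one_le_weight i.2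
  have w2 := one_le_weight i'.2
  have w3 := one_le_weight j.2
  have w4 := one_le_weight j'.2
  have hA₁i := hA₁ i
  have hA₁i' := hA₁ i'
  have hA₄i := hA₄ i
  have hA₄i' := hA₄ i'
  have hρj := hρ j j'
  set a := weight i.2
  set a' := weight i'.2
  set b := weight j.2
  set b' := weight j'.2
  set R := (N : ℝ) ^ (-(d * (1 - β)) + δ) with hR
  have hR0 : 0 ≤ R := by positivity
  set n := k₁ + k₄ + m with hn
  have hsm : ∀ (i : 𝒜.Index) (k : ℕ), ContMDiff 𝓘(ℝ, EX) 𝓘(ℝ, ℝ) k (𝒜.atom i) := fun i k =>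
    (𝒜.contMDiff_atom i).of_le (by exact_mod_cast le_top)
  rw [correlation_prod_eq hf hτ hG.continuous hG_zero hG_add hGν (hsm i 0).continuous
    (hsm i' 0).continuous (ℬ.continuous_atom j) (ℬ.continuous_atom j') N]
  have h1 := hbase ⟨𝒜.atom i, hsm i k₁⟩ ⟨𝒜.atom i', hsm i' k₁⟩ _ _ hρj.1 hρj.2.1 hρj.2.2 N hN
  simp only [ContMDiffMap.coeFn_mk] at h1
  have hpow : ∀ {x : ℝ} {k : ℕ}, 1 ≤ x → k ≤ n → x ^ k ≤ x ^ n := fun hx hk =>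
    pow_le_pow_right₀ hx hk
  have hfirst : C * (ckNorm 𝓘(ℝ, EX) k₁ (𝒜.atom i) * ckNorm 𝓘(ℝ, EX) k₁ (𝒜.atom i')) *
      (Cρ * (b * b') ^ m) * R ≤
      C * (A₁ * A₁) * Cρ * R * ((a * b) ^ n * (a' * b') ^ n) := by
    have e1 : ckNorm 𝓘(ℝ, EX) k₁ (𝒜.atom i) ≤ A₁ * a ^ n :=
      hA₁i.trans (mul_le_mul_of_nonneg_left (hpow w1 (by omega)) hA₁0)
    have e2 : ckNorm 𝓘(ℝ, EX) k₁ (𝒜.atom i') ≤ A₁ * a' ^ n :=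
      hA₁i'.trans (mul_le_mul_of_nonneg_left (hpow w2 (by omega)) hA₁0)
    have e3 : (b * b') ^ m ≤ (b * b') ^ n :=
      hpow (one_le_mul_of_one_le_of_one_le w3 w4) (by omega)
    have p1 := ckNorm_nonneg 𝓘(ℝ, EX) k₁ (𝒜.atom i)
    have p2 := ckNorm_nonneg 𝓘(ℝ, EX) k₁ (𝒜.atom i')
    calc _ ≤ C * ((A₁ * a ^ n) * (A₁ * a' ^ n)) * (Cρ * (b * b') ^ n) * R := by gcongr
      _ = _ := by rw [mul_pow, mul_pow, mul_pow]; ring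
  have hmean : ∀ j, |∫ y, ℬ.atom j y ∂ν| ≤ B := fun j => by
    have := norm_integral_le_of_norm_le_const (μ := ν) (f := ℬ.atom j) (ae_of_all _ (hB j))
    rwa [probReal_univ, mul_one] at this
  have h4 := hmix (𝒜.atom i) (𝒜.atom i') (hsm i k₄) (hsm i' k₄) N hN
  have hNr : (N : ℝ) ^ (-r₄) ≤ R := Real.rpow_le_rpow_of_exponent_le hN1 (by linarith)
  have hsecond : |(∫ y, ℬ.atom j y ∂ν) * (∫ y, ℬ.atom j' y ∂ν) *
      ((∫ x, 𝒜.atom i x * 𝒜.atom i' (f^[N] x) ∂μ) -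
        (∫ x, 𝒜.atom i x ∂μ) * ∫ x, 𝒜.atom i' x ∂μ)| ≤
      B * B * (|C₄| * (A₄ * A₄)) * R * ((a * b) ^ n * (a' * b') ^ n) := by
    rw [abs_mul, abs_mul]
    have e1 : ckNorm 𝓘(ℝ, EX) k₄ (𝒜.atom i) ≤ A₄ * (a * b) ^ n := by
      refine hA₄i.trans (mul_le_mul_of_nonneg_left ?_ hA₄0)
      exact (hpow w1 (by omega)).trans
        (pow_le_pow_left₀ (by linarith) (le_mul_of_one_le_right (by linarith) w3) n)
    have e2 : ckNorm 𝓘(ℝ, EX) k₄ (𝒜.atom i') ≤ A₄ * (a' * b') ^ n := by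
      refine hA₄i'.trans (mul_le_mul_of_nonneg_left ?_ hA₄0)
      exact (hpow w2 (by omega)).trans
        (pow_le_pow_left₀ (by linarith) (le_mul_of_one_le_right (by linarith) w4) n)
    have p1 := ckNorm_nonneg 𝓘(ℝ, EX) k₄ (𝒜.atom i)
    have p2 := ckNorm_nonneg 𝓘(ℝ, EX) k₄ (𝒜.atom i')
    have h5 : C₄ * (ckNorm 𝓘(ℝ, EX) k₄ (𝒜.atom i) * ckNorm 𝓘(ℝ, EX) k₄ (𝒜.atom i')) *
        (N : ℝ) ^ (-r₄) ≤ |C₄| * ((A₄ * (a * b) ^ n) * (A₄ * (a' * b') ^ n)) * R := by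
      have := le_abs_self C₄
      gcongr
    calc _ ≤ B * B * (|C₄| * ((A₄ * (a * b) ^ n) * (A₄ * (a' * b') ^ n)) * R) := by
          have m1 := hmean j
          have m2 := hmean j'
          have m3 := h4.trans h5
          gcongr
      _ = _ := by ring
  calc _ ≤ _ := abs_add_le _ _
    _ ≤ C * (A₁ * A₁) * Cρ * R * ((a * b) ^ n * (a' * b') ^ n) +
        B * B * (|C₄| * (A₄ * A₄)) * R * ((a * b) ^ n * (a' * b') ^ n) :=
      add_le_add (h1.trans hfirst) hsecond
    _ = _ := by ring

end SkewAtoms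

end SkewMixing

end

theorem mainTheorem10 {d : ℕ} (hd : 0 < d)
    {EX EY : Type*} [NormedAddCommGroup EX] [NormedSpace ℝ EX] [FiniteDimensional ℝ EX]
    [NormedAddCommGroup EY] [NormedSpace ℝ EY] [FiniteDimensional ℝ EY]
    {X : Type*} [TopologicalSpace X] [CompactSpace X] [T2Space X] [ChartedSpace EX X]
    [IsManifold 𝓘(ℝ, EX) ∞ X] [MeasurableSpace X] [BorelSpace X]
    {Y : Type*} [TopologicalSpace Y] [CompactSpace Y] [T2Space Y] [ChartedSpace EY Y]
    [IsManifold 𝓘(ℝ, EY) ∞ Y] [MeasurableSpace Y] [BorelSpace Y]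
    (μ : Measure X) [IsProbabilityMeasure μ] (ν : Measure Y) [IsProbabilityMeasure ν]
    (f : X → X) (hf : ContMDiff 𝓘(ℝ, EX) 𝓘(ℝ, EX) ∞ f) (hfμ : MeasurePreserving f μ μ)
    (τ : X → EuclideanSpace ℝ (Fin d))
    (hτ : ContMDiff 𝓘(ℝ, EX) 𝓘(ℝ, EuclideanSpace ℝ (Fin d)) ∞ τ)
    (G : EuclideanSpace ℝ (Fin d) → Y → Y)
    (hG : ContMDiff (𝓘(ℝ, EuclideanSpace ℝ (Fin d)).prod 𝓘(ℝ, EY)) 𝓘(ℝ, EY) ∞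
      (fun p : EuclideanSpace ℝ (Fin d) × Y => G p.1 p.2))
    (hG_zero : ∀ y, G 0 y = y) (hG_add : ∀ s t y, G (s + t) y = G s (G t y))
    (hGν : ∀ t, MeasurePreserving (G t) ν ν)
    (β : ℝ) (hβ : β < 1) (r₁ : ℕ) (r₂ r₄ : ℝ)
    (hr₁ : 2 * d * (1 - β) < r₁) (hr₂ : d * (1 - β) < r₂) (hr₄ : d * (1 - β) < r₄)
    (hA1' : SkewMixing.MixingDoubleEdgeworth (E := EX) μ f τ r₁)
    (hA2 : SkewMixing.ModerateDeviations μ f τ r₂)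
    (hA3' : SkewMixing.FiberDeviations EY ν G β)
    (hA4 : SkewMixing.BaseMixing EX μ f r₄) :
    ∃ K : ℕ, ∀ δ > (0 : ℝ), ∃ C : ℝ, ∀ H₁ H₂ : X × Y → ℝ,
      ContMDiff (𝓘(ℝ, EX).prod 𝓘(ℝ, EY)) 𝓘(ℝ, ℝ) K H₁ →
      ContMDiff (𝓘(ℝ, EX).prod 𝓘(ℝ, EY)) 𝓘(ℝ, ℝ) K H₂ →
      ∀ N : ℕ, 0 < N →
        |SkewMixing.correlation (μ.prod ν) (SkewMixing.skewProduct f τ G) H₁ H₂ N| ≤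
          C * SkewMixing.ckNorm (𝓘(ℝ, EX).prod 𝓘(ℝ, EY)) K H₁ *
            SkewMixing.ckNorm (𝓘(ℝ, EX).prod 𝓘(ℝ, EY)) K H₂ *
            (N : ℝ) ^ (d * (β - 1) + δ) := by
  have _ : SecondCountableTopology X := ChartedSpace.secondCountable_of_sigmaCompact EX X
  have _ : SecondCountableTopology Y := ChartedSpace.secondCountable_of_sigmaCompact EY Y
  obtain ⟨𝒜⟩ := SkewMixing.WaveAtlas.nonempty EX X
  obtain ⟨ℬ⟩ := SkewMixing.WaveAtlas.nonempty EY Y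
  have hκ : 0 < d * (1 - β) := mul_pos (by exact_mod_cast hd) (by linarith)
  obtain ⟨m, hatom⟩ := SkewMixing.exists_abs_correlation_atom_le 𝒜 ℬ hf.continuous hτ.continuous
    hG hG_zero hG_add hGν hκ (by linarith) hr₂ hr₄ hA1' hA2 hA3' hA4
  obtain ⟨p, hp⟩ := 𝒜.exists_summable_weight
  obtain ⟨p', hp'⟩ := ℬ.exists_summable_weight
  obtain ⟨K, C, hC, hexp⟩ := SkewMixing.exists_atom_expansion 𝒜 ℬ (m + p + p')
  obtain ⟨A, hA1, hA⟩ := 𝒜.exists_abs_atom_le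
  obtain ⟨A', hA1', hA'⟩ := ℬ.exists_abs_atom_le
  set s : 𝒜.Index × ℬ.Index → ℝ := fun q =>
    (SkewMixing.weight q.1.2 ^ p)⁻¹ * (SkewMixing.weight q.2.2 ^ p')⁻¹ with hs
  have hss : Summable s := hp.mul_of_nonneg hp'
    (fun i => by have := SkewMixing.weight_pos i.2; positivity)
    (fun i => by have := SkewMixing.weight_pos i.2; positivity)
  -- the decay of the coefficients compensates the growth of the constants with the frequencies
  have hcoef : ∀ {c : 𝒜.Index × ℬ.Index → ℝ} {P : ℝ},
      (∀ q, |c q| * (SkewMixing.weight q.1.2 * SkewMixing.weight q.2.2) ^ (m + p + p') ≤ P) →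
      ∀ q, |c q| * (SkewMixing.weight q.1.2 * SkewMixing.weight q.2.2) ^ m ≤ P * s q := by
    intro c P h q
    have h1 := SkewMixing.one_le_weight q.1.2
    have h2 := SkewMixing.one_le_weight q.2.2
    have h3 := h q
    set w := SkewMixing.weight q.1.2
    set w' := SkewMixing.weight q.2.2
    have hpos : 0 < w ^ p * w' ^ p' := by positivity
    change _ ≤ P * ((w ^ p)⁻¹ * (w' ^ p')⁻¹)
    rw [← mul_inv, ← div_eq_mul_inv, le_div_iff₀ hpos]
    have h4 : w ^ p * w' ^ p' ≤ (w * w') ^ (p + p') := by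
      rw [mul_pow]
      have h5 : w ^ p ≤ w ^ (p + p') := pow_le_pow_right₀ h1 (by omega)
      have h6 : w' ^ p' ≤ w' ^ (p + p') := pow_le_pow_right₀ h2 (by omega)
      gcongr
    calc |c q| * (w * w') ^ m * (w ^ p * w' ^ p')
        ≤ |c q| * (w * w') ^ m * (w * w') ^ (p + p') := by gcongr
      _ = |c q| * (w * w') ^ (m + p + p') := by rw [mul_assoc, ← pow_add, add_assoc]
      _ ≤ P := h3
  have hcard : Countable (𝒜.Index × ℬ.Index) := inferInstance
  refine ⟨K, fun δ hδ => ?_⟩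
  obtain ⟨D, hD, hcor⟩ := hatom δ hδ
  refine ⟨D * (C * ∑' q, s q) * (C * ∑' q, s q), fun H₁ H₂ hH₁ hH₂ N hN => ?_⟩
  obtain ⟨c₁, hc₁, hs₁⟩ := hexp H₁ hH₁
  obtain ⟨c₂, hc₂, hs₂⟩ := hexp H₂ hH₂
  have h := SkewMixing.abs_correlation_le_of_hasSum (ζ := μ.prod ν)
    (SkewMixing.continuous_skewProduct hf.continuous hτ.continuous hG.continuous)
    (e := fun (q : 𝒜.Index × ℬ.Index) (z : X × Y) => 𝒜.atom q.1 z.1 * ℬ.atom q.2 z.2)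
    (A := A * A') (fun q => ((𝒜.continuous_atom q.1).comp continuous_fst).mul
      ((ℬ.continuous_atom q.2).comp continuous_snd))
    (fun q z => by
      rw [abs_mul]
      exact mul_le_mul (hA q.1 z.1) (hA' q.2 z.2) (abs_nonneg _) (zero_le_one.trans hA1))
    (fun q => one_le_pow₀ (one_le_mul_of_one_le_of_one_le (SkewMixing.one_le_weight q.1.2)
      (SkewMixing.one_le_weight q.2.2))) hss (mul_nonneg hD (by positivity))
    (fun q q' => hcor q q' N hN) hH₂.continuous (hcoef hc₁) (hcoef hc₂)
    (fun z => hs₁ z.1 z.2) (fun z => hs₂ z.1 z.2)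
  refine h.trans_eq ?_
  rw [show d * (β - 1) + δ = -(d * (1 - β)) + δ by ring]
  ring
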